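/- Let $\Bbbk$ be a field and let $C$ be a cocommutative $\Bbbk$-coalgebra that is cosemisimple, i.e. a direct sum of simple coalgebras (a simple coalgebra being one with no subcoalgebras other than $0$ and itself). Let $\mathrm{Coalg}\,C$ be the category whose objects are the coalgebra morphisms $\phi:D\to C$ with $D$ a cocommutative $\Bbbk$-coalgebra, and whose morphisms from $\phi:D\to C$ to $\psi:E\to C$ are the coalgebra morphisms $f:D\to E$ with $\psi\circ f=\phi$. Let $\mathrm{Vec}^C$ be the category of $C$-comodules $(V,v:V\to V\otimes C)$ and comodule morphisms. For comodules $(V,v)$, $(W,w)$ let the cotensor product $V\otimes^C W$ be the equalizer of $v\otimes \mathrm{id}_W$ and $\mathrm{id}_V\otimes(\tau\circ w)$ from $V\otimes W$ to $V\otimes C\otimes W$ ($\tau$ being the transposition), with the coaction induced by $\mathrm{id}_V\otimes w$. Let $U^C:\mathrm{Coalg}\,C\to \mathrm{Vec}^C$ be the functor that takes $\phi:D\to C$ to the space $D$ with the coaction $(\mathrm{id}_D\otimes\phi)\circ\Delta_D$ and a morphism to its underlying linear map. Then $\mathrm{Coalg}\,C$ has finite products; $(\mathrm{Vec}^C,\otimes^C,C)$,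 with the associativity, unit and symmetry isomorphisms induced by those of $\otimes$ and by the counit of $C$, is a closed symmetric monoidal category; and $U^C$ has a right adjoint $R^C$ such that $U^C\dashv R^C$ is an LNL adjunction with $U^C$ strong monoidal. That is, $U^C$ and $R^C$ carry structures of (lax) monoidal functors between $(\mathrm{Coalg}\,C,\times,\mathrm{id}_C)$ and $(\mathrm{Vec}^C,\otimes^C,C)$ for which the unit and the counit of the adjunction are monoidal natural transformations, and the structure morphisms of $U^C$ are isomorphisms. -/

import Mathlib

open CategoryTheory MonoidalCategory
open scoped TensorProduct

universe u

namespace ComodLNL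

section Linear

variable {k : Type u} [Field k] {C : Type u} [AddCommGroup C] [Module k C]
variable {M N P M' N' A B : Type u}
  [AddCommGroup M] [Module k M] [AddCommGroup N] [Module k N] [AddCommGroup P] [Module k P]
  [AddCommGroup M'] [Module k M'] [AddCommGroup N'] [Module k N']
  [AddCommGroup A] [Module k A] [AddCommGroup B] [Module k B]

/-- A map `a : M → M ⊗ C` acting on the first factor of `M ⊗ N`. -/
noncomputable def actL (a : M →ₗ[k] M ⊗[k] C) (N : Type u) [AddCommGroup N] [Module k N] :
    M ⊗[k] N →ₗ[k] (M ⊗[k] N) ⊗[k] C :=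
  (TensorProduct.rightComm k M C N).toLinearMap ∘ₗ a.rTensor N

/-- A map `b : N → N ⊗ C` acting on the second factor of `M ⊗ N`. -/
noncomputable def actR (M : Type u) [AddCommGroup M] [Module k M] (b : N →ₗ[k] N ⊗[k] C) :
    M ⊗[k] N →ₗ[k] (M ⊗[k] N) ⊗[k] C :=
  (TensorProduct.assoc k M N C).symm.toLinearMap ∘ₗ b.lTensor M

theorem actL_map (f : M →ₗ[k] M') (g : N →ₗ[k] N') {a : M →ₗ[k] M ⊗[k] C}
    {a' : M' →ₗ[k] M' ⊗[k] C} (h : f.rTensor C ∘ₗ a = a' ∘ₗ f) :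
    (TensorProduct.map f g).rTensor C ∘ₗ actL a N = actL a' N' ∘ₗ TensorProduct.map f g := by
  ext m n
  have h' := LinearMap.congr_fun h m
  simp only [LinearMap.comp_apply] at h'
  simp only [actL, TensorProduct.AlgebraTensorModule.curry_apply, LinearMap.restrictScalars_self,
    TensorProduct.curry_apply, LinearMap.comp_apply, LinearMap.rTensor_tmul,
    TensorProduct.map_tmul, ← h', LinearEquiv.coe_coe]
  induction a m using TensorProduct.induction_on with
  | zero => simp
  | tmul x c => simp
  | add x y hx hy => simp only [TensorProduct.add_tmul, map_add, hx, hy]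

theorem actR_map (f : M →ₗ[k] M') (g : N →ₗ[k] N') {b : N →ₗ[k] N ⊗[k] C}
    {b' : N' →ₗ[k] N' ⊗[k] C} (h : g.rTensor C ∘ₗ b = b' ∘ₗ g) :
    (TensorProduct.map f g).rTensor C ∘ₗ actR M b = actR M' b' ∘ₗ TensorProduct.map f g := by
  ext m n
  have h' := LinearMap.congr_fun h n
  simp only [LinearMap.comp_apply] at h'
  simp only [actR, TensorProduct.AlgebraTensorModule.curry_apply, LinearMap.restrictScalars_self,
    TensorProduct.curry_apply, LinearMap.comp_apply, LinearMap.lTensor_tmul,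
    TensorProduct.map_tmul, ← h', LinearEquiv.coe_coe]
  induction b n using TensorProduct.induction_on with
  | zero => simp
  | tmul x c => simp
  | add x y hx hy => simp only [TensorProduct.tmul_add, map_add, hx, hy]

theorem actL_comm (a : M →ₗ[k] M ⊗[k] C) :
    (TensorProduct.comm k M N).toLinearMap.rTensor C ∘ₗ actL a N =
      actR N a ∘ₗ (TensorProduct.comm k M N).toLinearMap := by
  ext m n
  simp only [actL, actR, TensorProduct.AlgebraTensorModule.curry_apply,
    LinearMap.restrictScalars_self, TensorProduct.curry_apply, LinearMap.comp_apply,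
    LinearMap.rTensor_tmul, LinearEquiv.coe_coe, TensorProduct.comm_tmul, LinearMap.lTensor_tmul]
  induction a m using TensorProduct.induction_on with
  | zero => simp
  | tmul x c => simp
  | add x y hx hy => simp only [TensorProduct.add_tmul, TensorProduct.tmul_add, map_add, hx, hy]

theorem actR_comm (b : N →ₗ[k] N ⊗[k] C) :
    (TensorProduct.comm k M N).toLinearMap.rTensor C ∘ₗ actR M b =
      actL b M ∘ₗ (TensorProduct.comm k M N).toLinearMap := by
  ext m n
  simp only [actL, actR, TensorProduct.AlgebraTensorModule.curry_apply,
    LinearMap.restrictScalars_self, TensorProduct.curry_apply, LinearMap.comp_apply,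
    LinearMap.rTensor_tmul, LinearEquiv.coe_coe, TensorProduct.comm_tmul, LinearMap.lTensor_tmul]
  induction b n using TensorProduct.induction_on with
  | zero => simp
  | tmul x c => simp
  | add x y hx hy => simp only [TensorProduct.add_tmul, TensorProduct.tmul_add, map_add, hx, hy]

theorem assoc_actL_actL (a : M →ₗ[k] M ⊗[k] C) :
    (TensorProduct.assoc k M N P).toLinearMap.rTensor C ∘ₗ actL (actL a N) P =
      actL a (N ⊗[k] P) ∘ₗ (TensorProduct.assoc k M N P).toLinearMap := by
  ext m n p
  simp only [actL, TensorProduct.AlgebraTensorModule.curry_apply,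
    LinearMap.restrictScalars_self, TensorProduct.curry_apply, LinearMap.comp_apply,
    LinearMap.rTensor_tmul, LinearEquiv.coe_coe, TensorProduct.assoc_tmul]
  induction a m using TensorProduct.induction_on with
  | zero => simp
  | tmul x c => simp
  | add x y hx hy => simp only [TensorProduct.add_tmul, map_add, hx, hy]

theorem assoc_actL_actR (b : N →ₗ[k] N ⊗[k] C) :
    (TensorProduct.assoc k M N P).toLinearMap.rTensor C ∘ₗ actL (actR M b) P =
      actR M (actL b P) ∘ₗ (TensorProduct.assoc k M N P).toLinearMap := by
  ext m n p
  simp only [actL, actR, TensorProduct.AlgebraTensorModule.curry_apply,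
    LinearMap.restrictScalars_self, TensorProduct.curry_apply, LinearMap.comp_apply,
    LinearMap.rTensor_tmul, LinearMap.lTensor_tmul, LinearEquiv.coe_coe, TensorProduct.assoc_tmul]
  induction b n using TensorProduct.induction_on with
  | zero => simp
  | tmul x c => simp
  | add x y hx hy => simp only [TensorProduct.add_tmul, TensorProduct.tmul_add, map_add, hx, hy]

theorem assoc_actR (c : P →ₗ[k] P ⊗[k] C) :
    (TensorProduct.assoc k M N P).toLinearMap.rTensor C ∘ₗ actR (M ⊗[k] N) c =
      actR M (actR N c) ∘ₗ (TensorProduct.assoc k M N P).toLinearMap := by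
  ext m n p
  simp only [actR, TensorProduct.AlgebraTensorModule.curry_apply,
    LinearMap.restrictScalars_self, TensorProduct.curry_apply, LinearMap.comp_apply,
    LinearMap.lTensor_tmul, LinearEquiv.coe_coe, TensorProduct.assoc_tmul]
  induction c p using TensorProduct.induction_on with
  | zero => simp
  | tmul x c => simp
  | add x y hx hy => simp only [TensorProduct.tmul_add, map_add, hx, hy]

theorem actL_actR_comm (a : M →ₗ[k] M ⊗[k] C) (b : N →ₗ[k] N ⊗[k] C) :
    (actL a N).rTensor C ∘ₗ actR M b =
      (TensorProduct.rightComm k (M ⊗[k] N) C C).toLinearMap ∘ₗ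
        (actR M b).rTensor C ∘ₗ actL a N := by
  ext m n
  simp only [actL, actR, TensorProduct.AlgebraTensorModule.curry_apply,
    LinearMap.restrictScalars_self, TensorProduct.curry_apply, LinearMap.comp_apply,
    LinearMap.rTensor_tmul, LinearMap.lTensor_tmul, LinearEquiv.coe_coe]
  have key : ∀ (s : M ⊗[k] C) (t : N ⊗[k] C), a m = s → b n = t →
      ((TensorProduct.rightComm k M C N).toLinearMap ∘ₗ a.rTensor N).rTensor C
        ((TensorProduct.assoc k M N C).symm (m ⊗ₜ t)) =
      (TensorProduct.rightComm k (M ⊗[k] N) C C)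
        (((TensorProduct.assoc k M N C).symm.toLinearMap ∘ₗ b.lTensor M).rTensor C
          (TensorProduct.rightComm k M C N (s ⊗ₜ n))) := by
    intro s t hs ht
    have h1 : ∀ t : N ⊗[k] C,
        ((TensorProduct.rightComm k M C N).toLinearMap ∘ₗ a.rTensor N).rTensor C
          ((TensorProduct.assoc k M N C).symm (m ⊗ₜ t)) =
        (TensorProduct.rightComm k M C N).toLinearMap.rTensor C
          ((TensorProduct.assoc k (M ⊗[k] C) N C).symm (s ⊗ₜ t)) := by
      intro t
      induction t using TensorProduct.induction_on with
      | zero => simp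
      | tmul x c => simp [hs]
      | add x y hx hy => simp only [TensorProduct.tmul_add, map_add, hx, hy]
    have h2 : ∀ s : M ⊗[k] C,
        (((TensorProduct.assoc k M N C).symm.toLinearMap ∘ₗ b.lTensor M).rTensor C
          (TensorProduct.rightComm k M C N (s ⊗ₜ n))) =
        (TensorProduct.assoc k M N C).symm.toLinearMap.rTensor C
          (TensorProduct.rightComm k M C (N ⊗[k] C) (s ⊗ₜ t)) := by
      intro s
      induction s using TensorProduct.induction_on with
      | zero => simp
      | tmul x c => simp [ht]
      | add x y hx hy => simp only [TensorProduct.add_tmul, map_add, hx, hy]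
    rw [h1, h2]
    clear h1 h2 hs ht
    induction s using TensorProduct.induction_on with
    | zero => simp
    | add x y hx hy => simp only [TensorProduct.add_tmul, map_add, hx, hy]
    | tmul x c =>
      induction t using TensorProduct.induction_on with
      | zero => simp
      | tmul x c => simp
      | add x y hx hy => simp only [TensorProduct.tmul_add, map_add, hx, hy]
  exact key _ _ rfl rfl

theorem rTensor_inj {j : A →ₗ[k] B} (hj : Function.Injective j) (P : Type u) [AddCommGroup P]
    [Module k P] : Function.Injective (j.rTensor P) :=
  Module.Flat.rTensor_preserves_injective_linearMap j hj

theorem lTensor_inj {j : A →ₗ[k] B} (hj : Function.Injective j) (P : Type u) [AddCommGroup P]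
    [Module k P] : Function.Injective (j.lTensor P) :=
  Module.Flat.lTensor_preserves_injective_linearMap j hj

theorem mem_range_lTensor {K : Submodule k M} {f g : M →ₗ[k] N} (hK : K = LinearMap.eqLocus f g)
    (z : P ⊗[k] M) (hz : f.lTensor P z = g.lTensor P z) :
    z ∈ LinearMap.range (K.subtype.lTensor P) := by
  subst hK
  have h := Module.Flat.eqLocus_lTensor_eq (R := k) (S := k) (M := P) f g
  have : z ∈ LinearMap.eqLocus (TensorProduct.AlgebraTensorModule.lTensor k P f)
      (TensorProduct.AlgebraTensorModule.lTensor k P g) := hz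
  rw [h] at this
  exact this

theorem comm_rTensor (f : M →ₗ[k] N) (z : M ⊗[k] P) :
    TensorProduct.comm k N P (f.rTensor P z) = f.lTensor P (TensorProduct.comm k M P z) := by
  induction z using TensorProduct.induction_on with
  | zero => simp
  | tmul x c => simp
  | add x y hx hy => simp only [map_add, hx, hy]

theorem mem_range_rTensor {K : Submodule k M} {f g : M →ₗ[k] N} (hK : K = LinearMap.eqLocus f g)
    (z : M ⊗[k] P) (hz : f.rTensor P z = g.rTensor P z) :
    z ∈ LinearMap.range (K.subtype.rTensor P) := by
  obtain ⟨y, hy⟩ := mem_range_lTensor (P := P) hK (TensorProduct.comm k M P z) (by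
    rw [← comm_rTensor, ← comm_rTensor, hz])
  refine ⟨(TensorProduct.comm k K P).symm y, ?_⟩
  apply (TensorProduct.comm k M P).injective
  rw [← hy, comm_rTensor, LinearEquiv.apply_symm_apply]

/-- Factor a linear map through an injective one. -/
noncomputable def liftInj {A B Z : Type u} [AddCommMonoid A] [Module k A] [AddCommMonoid B]
    [Module k B] [AddCommMonoid Z] [Module k Z] (j : A →ₗ[k] B) (hj : Function.Injective j)
    (f : Z →ₗ[k] B) (h : ∀ z, f z ∈ LinearMap.range j) : Z →ₗ[k] A :=
  (LinearEquiv.ofInjective j hj).symm.toLinearMap ∘ₗ f.codRestrict (LinearMap.range j) h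

theorem comp_liftInj {A B Z : Type u} [AddCommMonoid A] [Module k A] [AddCommMonoid B]
    [Module k B] [AddCommMonoid Z] [Module k Z] (j : A →ₗ[k] B) (hj : Function.Injective j)
    (f : Z →ₗ[k] B) (h : ∀ z, f z ∈ LinearMap.range j) : j ∘ₗ liftInj j hj f h = f := by
  ext z
  simp [liftInj]

end Linear

section Coalgebraic

variable {k : Type u} [Field k] {C : Type u} [AddCommGroup C] [Module k C] [Coalgebra k C]
variable {M N : Type u} [AddCommGroup M] [Module k M] [AddCommGroup N] [Module k N]

/-- The coassociativity law of a coaction. -/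
def IsCoassoc (a : M →ₗ[k] M ⊗[k] C) : Prop :=
  (TensorProduct.assoc k M C C).toLinearMap ∘ₗ a.rTensor C ∘ₗ a =
    (Coalgebra.comul (R := k) (A := C)).lTensor M ∘ₗ a

/-- The counit law of a coaction. -/
def IsCounital (a : M →ₗ[k] M ⊗[k] C) : Prop :=
  (Coalgebra.counit (R := k) (A := C)).lTensor M ∘ₗ a = (TensorProduct.mk k M k).flip 1

theorem isCoassoc_actR {b : N →ₗ[k] N ⊗[k] C} (hb : IsCoassoc b) : IsCoassoc (actR M b) := by
  ext m n
  have h := LinearMap.congr_fun hb n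
  simp only [LinearMap.comp_apply, LinearEquiv.coe_coe] at h
  simp only [actR, TensorProduct.AlgebraTensorModule.curry_apply,
    LinearMap.restrictScalars_self, TensorProduct.curry_apply, LinearMap.comp_apply,
    LinearMap.lTensor_tmul, LinearEquiv.coe_coe]
  have h1 : ∀ t : N ⊗[k] C, TensorProduct.assoc k (M ⊗[k] N) C C
      (((TensorProduct.assoc k M N C).symm.toLinearMap ∘ₗ b.lTensor M).rTensor C
        ((TensorProduct.assoc k M N C).symm (m ⊗ₜ t))) =
      (TensorProduct.assoc k M N (C ⊗[k] C)).symm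
        (m ⊗ₜ (TensorProduct.assoc k N C C (b.rTensor C t))) := by
    intro t
    induction t using TensorProduct.induction_on with
    | zero => simp
    | add x y hx hy => simp only [TensorProduct.tmul_add, map_add, hx, hy]
    | tmul x c =>
      simp only [TensorProduct.assoc_symm_tmul, LinearMap.rTensor_tmul, LinearMap.comp_apply,
        LinearMap.lTensor_tmul, LinearEquiv.coe_coe]
      induction b x using TensorProduct.induction_on with
      | zero => simp
      | add x y hx hy => simp only [TensorProduct.tmul_add, TensorProduct.add_tmul, map_add, hx, hy]
      | tmul x c => simp
  rw [h1, h]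
  induction b n using TensorProduct.induction_on with
  | zero => simp
  | add x y hx hy => simp only [TensorProduct.tmul_add, map_add, hx, hy]
  | tmul x c =>
    simp only [TensorProduct.assoc_symm_tmul, LinearMap.lTensor_tmul]

theorem isCounital_actR {b : N →ₗ[k] N ⊗[k] C} (hb : IsCounital b) : IsCounital (actR M b) := by
  ext m n
  have h := LinearMap.congr_fun hb n
  simp only [LinearMap.comp_apply, LinearMap.flip_apply, TensorProduct.mk_apply] at h
  simp only [actR, TensorProduct.AlgebraTensorModule.curry_apply,
    LinearMap.restrictScalars_self, TensorProduct.curry_apply, LinearMap.comp_apply,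
    LinearMap.lTensor_tmul, LinearEquiv.coe_coe, LinearMap.flip_apply, TensorProduct.mk_apply]
  have h1 : ∀ t : N ⊗[k] C, (Coalgebra.counit (R := k) (A := C)).lTensor (M ⊗[k] N)
        ((TensorProduct.assoc k M N C).symm (m ⊗ₜ t)) =
      (TensorProduct.assoc k M N k).symm
        (m ⊗ₜ ((Coalgebra.counit (R := k) (A := C)).lTensor N t)) := by
    intro t
    induction t using TensorProduct.induction_on with
    | zero => simp
    | add x y hx hy => simp only [TensorProduct.tmul_add, map_add, hx, hy]
    | tmul x c => simp
  rw [h1, h, TensorProduct.assoc_symm_tmul]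

/-- On a space with two commuting coactions of a cocommutative coalgebra, the second coaction
maps the equalizer `K` of both into `K ⊗ C`. -/
theorem act_mem_range [Coalgebra.IsCocomm k C] {a b : M →ₗ[k] M ⊗[k] C} (hb : IsCoassoc b)
    (hab : a.rTensor C ∘ₗ b =
      (TensorProduct.rightComm k M C C).toLinearMap ∘ₗ b.rTensor C ∘ₗ a)
    {K : Submodule k M} (hK : K = LinearMap.eqLocus a b) {t : M} (ht : t ∈ K) :
    b t ∈ LinearMap.range (K.subtype.rTensor C) := by
  apply mem_range_rTensor hK
  have h1 := LinearMap.congr_fun hab t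
  have h2 := LinearMap.congr_fun hb t
  have h3 : a t = b t := by rw [hK] at ht; exact ht
  simp only [LinearMap.comp_apply, LinearEquiv.coe_coe] at h1 h2
  rw [h1, h3]
  apply (TensorProduct.assoc k M C C).injective
  have h4 : ∀ z : (M ⊗[k] C) ⊗[k] C, TensorProduct.assoc k M C C
      (TensorProduct.rightComm k M C C z) =
      (TensorProduct.comm k C C).toLinearMap.lTensor M (TensorProduct.assoc k M C C z) := by
    intro z
    have : (TensorProduct.assoc k M C C).toLinearMap ∘ₗ
        (TensorProduct.rightComm k M C C).toLinearMap =
      (TensorProduct.comm k C C).toLinearMap.lTensor M ∘ₗ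
        (TensorProduct.assoc k M C C).toLinearMap := by
      ext; simp
    exact LinearMap.congr_fun this z
  rw [h4, h2, ← LinearMap.comp_apply, ← LinearMap.lTensor_comp]
  congr 2
  exact Coalgebra.comm_comp_comul k C

end Coalgebraic


/-- Comodules over the `k`-coalgebra `C`. -/
structure Comod (k : Type u) [Field k] (C : Type u) [AddCommGroup C] [Module k C]
    [Coalgebra k C] where
  /-- the underlying vector space -/
  carrier : Type u
  [addCommGroup : AddCommGroup carrier]
  [module : Module k carrier]
  /-- the coaction -/
  coact : carrier →ₗ[k] carrier ⊗[k] C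
  coassoc : IsCoassoc coact
  counital : IsCounital coact

attribute [instance] Comod.addCommGroup Comod.module

namespace Comod

variable {k : Type u} [Field k] {C : Type u} [AddCommGroup C] [Module k C] [Coalgebra k C]

instance : CoeSort (Comod k C) (Type u) := ⟨Comod.carrier⟩

/-- Morphisms of comodules. -/
@[ext]
structure Hom (V W : Comod k C) where
  /-- the underlying linear map -/
  lin : V →ₗ[k] W
  colinear : lin.rTensor C ∘ₗ V.coact = W.coact ∘ₗ lin

/-- The category `Vec^C` of `C`-comodules. -/
instance : Category (Comod k C) where
  Hom V W := Hom V W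
  id V := ⟨LinearMap.id, by simp⟩
  comp f g := ⟨g.lin ∘ₗ f.lin, by
    rw [LinearMap.rTensor_comp, LinearMap.comp_assoc, f.colinear, ← LinearMap.comp_assoc,
      g.colinear, LinearMap.comp_assoc]⟩

@[simp] theorem id_lin (V : Comod k C) : Hom.lin (𝟙 V) = LinearMap.id := rfl

@[simp] theorem comp_lin {V W X : Comod k C} (f : V ⟶ W) (g : W ⟶ X) :
    Hom.lin (f ≫ g) = g.lin ∘ₗ f.lin := rfl

@[ext] theorem hom_ext {V W : Comod k C} {f g : V ⟶ W} (h : f.lin = g.lin) : f = g := Hom.ext h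

/-- The underlying space of the cotensor product `V ⊗^C W`: the equalizer of
`v ⊗ id` and `id ⊗ τ w` from `V ⊗ W` to `V ⊗ C ⊗ W`. -/
noncomputable def cotensorSpace (V W : Comod k C) : Submodule k (V ⊗[k] W) :=
  LinearMap.eqLocus
    ((TensorProduct.assoc k V C W).toLinearMap ∘ₗ V.coact.rTensor W)
    (((TensorProduct.comm k W C).toLinearMap ∘ₗ W.coact).lTensor V)

theorem cotensorSpace_eq (V W : Comod k C) :
    cotensorSpace V W = LinearMap.eqLocus (actL V.coact W) (actR V W.coact) := by
  let e : V ⊗[k] (C ⊗[k] W) ≃ₗ[k] (V ⊗[k] W) ⊗[k] C :=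
    TensorProduct.congr (LinearEquiv.refl k V) (TensorProduct.comm k C W) ≪≫ₗ
      (TensorProduct.assoc k V W C).symm
  have h1 : e.toLinearMap ∘ₗ ((TensorProduct.assoc k V C W).toLinearMap ∘ₗ V.coact.rTensor W) =
      actL V.coact W := by
    rw [actL, ← LinearMap.comp_assoc]
    congr 1
    ext
    simp [e]
  have h2 : e.toLinearMap ∘ₗ (((TensorProduct.comm k W C).toLinearMap ∘ₗ W.coact).lTensor V) =
      actR V W.coact := by
    rw [actR, LinearMap.lTensor_comp, ← LinearMap.comp_assoc]
    congr 1
    ext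
    simp [e]
  rw [← h1, ← h2]
  ext t
  exact e.injective.eq_iff.symm

/-- The inclusion of `V ⊗^C W` in `V ⊗ W`. -/
noncomputable abbrev inc (V W : Comod k C) : cotensorSpace V W →ₗ[k] V ⊗[k] W :=
  (cotensorSpace V W).subtype

theorem inc_injective (V W : Comod k C) : Function.Injective (inc V W) :=
  Subtype.val_injective

theorem actL_inc (V W : Comod k C) :
    actL V.coact W ∘ₗ inc V W = actR V W.coact ∘ₗ inc V W := by
  ext t
  have : (t : V ⊗[k] W) ∈ LinearMap.eqLocus (actL V.coact W) (actR V W.coact) :=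
    cotensorSpace_eq V W ▸ t.2
  exact this

/-- A map which embeds in a coassociative, counital one is such. -/
theorem isCoassoc_of_inj {A B : Type u} [AddCommGroup A] [Module k A] [AddCommGroup B]
    [Module k B] {j : A →ₗ[k] B} (hj : Function.Injective j) {a : A →ₗ[k] A ⊗[k] C}
    {b : B →ₗ[k] B ⊗[k] C} (h : j.rTensor C ∘ₗ a = b ∘ₗ j) (hb : IsCoassoc b) : IsCoassoc a := by
  apply LinearMap.ext
  intro x
  apply rTensor_inj hj (C ⊗[k] C)
  have e0 : ∀ x, j.rTensor C (a x) = b (j x) := LinearMap.congr_fun h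
  have e1 : ∀ z : (A ⊗[k] C) ⊗[k] C, j.rTensor (C ⊗[k] C) (TensorProduct.assoc k A C C z) =
      TensorProduct.assoc k B C C ((j.rTensor C).rTensor C z) := by
    intro z
    have : j.rTensor (C ⊗[k] C) ∘ₗ (TensorProduct.assoc k A C C).toLinearMap =
      (TensorProduct.assoc k B C C).toLinearMap ∘ₗ (j.rTensor C).rTensor C := by
      ext; simp
    exact LinearMap.congr_fun this z
  have e2 : ∀ z : A ⊗[k] C, (j.rTensor C).rTensor C (a.rTensor C z) =
      b.rTensor C (j.rTensor C z) := by
    intro z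
    rw [← LinearMap.comp_apply, ← LinearMap.rTensor_comp, h, LinearMap.rTensor_comp,
      LinearMap.comp_apply]
  have e3 : ∀ z : A ⊗[k] C, j.rTensor (C ⊗[k] C)
      ((Coalgebra.comul (R := k) (A := C)).lTensor A z) =
      (Coalgebra.comul (R := k) (A := C)).lTensor B (j.rTensor C z) := by
    intro z
    rw [← LinearMap.comp_apply, ← LinearMap.comp_apply, LinearMap.rTensor_comp_lTensor,
      LinearMap.lTensor_comp_rTensor]
  simp only [LinearMap.comp_apply, LinearEquiv.coe_coe]
  rw [e1, e2, e3, e0]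
  exact LinearMap.congr_fun hb (j x)

theorem isCounital_of_inj {A B : Type u} [AddCommGroup A] [Module k A] [AddCommGroup B]
    [Module k B] {j : A →ₗ[k] B} (hj : Function.Injective j) {a : A →ₗ[k] A ⊗[k] C}
    {b : B →ₗ[k] B ⊗[k] C} (h : j.rTensor C ∘ₗ a = b ∘ₗ j) (hb : IsCounital b) :
    IsCounital a := by
  apply LinearMap.ext
  intro x
  apply rTensor_inj hj k
  have e0 : ∀ x, j.rTensor C (a x) = b (j x) := LinearMap.congr_fun h
  have e3 : ∀ z : A ⊗[k] C, j.rTensor k ((Coalgebra.counit (R := k) (A := C)).lTensor A z) =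
      (Coalgebra.counit (R := k) (A := C)).lTensor B (j.rTensor C z) := by
    intro z
    rw [← LinearMap.comp_apply, ← LinearMap.comp_apply, LinearMap.rTensor_comp_lTensor,
      LinearMap.lTensor_comp_rTensor]
  rw [LinearMap.comp_apply, e3, e0]
  simpa using LinearMap.congr_fun hb (j x)

variable (k C) in
/-- `C` as a comodule over itself. -/
noncomputable def unit : Comod k C where
  carrier := C
  coact := Coalgebra.comul
  coassoc := Coalgebra.coassoc
  counital := Coalgebra.lTensor_counit_comp_comul

/-- `id ⊗ ε : V ⊗ C → V`. -/
noncomputable def evC (V : Comod k C) : V ⊗[k] C →ₗ[k] V :=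
  (TensorProduct.rid k V).toLinearMap ∘ₗ (Coalgebra.counit (R := k) (A := C)).lTensor V

theorem evC_coact (V : Comod k C) : evC V ∘ₗ V.coact = LinearMap.id := by
  rw [evC, LinearMap.comp_assoc, V.counital]
  ext
  simp

theorem evC_actL (V : Comod k C) : (evC V).rTensor C ∘ₗ actL V.coact C = V.coact ∘ₗ evC V := by
  have h := actL_map (LinearMap.id (M := V)) (Coalgebra.counit (R := k) (A := C))
    (a := V.coact) (a' := V.coact) (by simp)
  have h' : (TensorProduct.rid k V).toLinearMap.rTensor C ∘ₗ actL V.coact k =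
      V.coact ∘ₗ (TensorProduct.rid k V).toLinearMap := by
    ext v
    simp only [actL, TensorProduct.AlgebraTensorModule.curry_apply,
      LinearMap.restrictScalars_self, TensorProduct.curry_apply, LinearMap.comp_apply,
      LinearMap.rTensor_tmul, LinearEquiv.coe_coe, TensorProduct.rid_tmul, one_smul]
    induction V.coact v using TensorProduct.induction_on with
    | zero => simp
    | tmul x c => simp
    | add x y hx hy => simp only [TensorProduct.add_tmul, map_add, hx, hy]
  rw [evC, LinearMap.rTensor_comp, LinearMap.comp_assoc]
  erw [h]
  rw [← LinearMap.comp_assoc, h', LinearMap.comp_assoc]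
  rfl

theorem evC_actR (V : Comod k C) :
    (evC V).rTensor C ∘ₗ actR V (Coalgebra.comul (R := k) (A := C)) = LinearMap.id := by
  ext v c
  have h := Coalgebra.rTensor_counit_comul (R := k) c
  simp only [actR, TensorProduct.AlgebraTensorModule.curry_apply,
      LinearMap.restrictScalars_self, TensorProduct.curry_apply, LinearMap.comp_apply,
      LinearMap.lTensor_tmul, LinearEquiv.coe_coe, LinearMap.id_apply]
  have h1 : ∀ z : C ⊗[k] C, (evC V).rTensor C ((TensorProduct.assoc k V C C).symm (v ⊗ₜ z)) =
      v ⊗ₜ[k] TensorProduct.lid k C ((Coalgebra.counit (R := k) (A := C)).rTensor C z) := by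
    intro z
    induction z using TensorProduct.induction_on with
    | zero => simp
    | tmul x c => simp [evC, TensorProduct.smul_tmul]
    | add x y hx hy => simp only [TensorProduct.tmul_add, map_add, hx, hy]
  rw [h1, h]
  simp

theorem coact_actR (V : Comod k C) : V.coact.rTensor C ∘ₗ V.coact =
    actR V (Coalgebra.comul (R := k) (A := C)) ∘ₗ V.coact := by
  rw [actR, LinearMap.comp_assoc, ← V.coassoc, ← LinearMap.comp_assoc,
    LinearEquiv.symm_comp, LinearMap.id_comp]

theorem comp_cancel {A B Z : Type u} [AddCommMonoid A] [Module k A] [AddCommMonoid B]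
    [Module k B] [AddCommMonoid Z] [Module k Z] {j : A →ₗ[k] B} (hj : Function.Injective j)
    {f g : Z →ₗ[k] A} (h : j ∘ₗ f = j ∘ₗ g) : f = g :=
  LinearMap.ext fun x => hj (LinearMap.congr_fun h x)

theorem comp_cancel_right {A B Z : Type u} [AddCommMonoid A] [Module k A] [AddCommMonoid B]
    [Module k B] [AddCommMonoid Z] [Module k Z] {p : A →ₗ[k] B} (hp : Function.Surjective p)
    {f g : B →ₗ[k] Z} (h : f ∘ₗ p = g ∘ₗ p) : f = g :=
  (LinearMap.cancel_right hp).1 h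

variable [Coalgebra.IsCocomm k C]

theorem actR_mem_range (V W : Comod k C) (t : cotensorSpace V W) :
    (actR V W.coact ∘ₗ inc V W) t ∈ LinearMap.range ((inc V W).rTensor C) :=
  act_mem_range (a := actL V.coact W) (b := actR V W.coact) (isCoassoc_actR W.coassoc)
    (actL_actR_comm _ _) (cotensorSpace_eq V W) t.2

/-- The coaction on `V ⊗^C W`, induced by `id ⊗ w`. -/
noncomputable def cotensorCoact (V W : Comod k C) :
    cotensorSpace V W →ₗ[k] cotensorSpace V W ⊗[k] C :=
  liftInj ((inc V W).rTensor C) (rTensor_inj (inc_injective V W) C)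
    (actR V W.coact ∘ₗ inc V W) (actR_mem_range V W)

theorem inc_cotensorCoact (V W : Comod k C) :
    (inc V W).rTensor C ∘ₗ cotensorCoact V W = actR V W.coact ∘ₗ inc V W :=
  comp_liftInj _ _ _ _

/-- The cotensor product `V ⊗^C W`. -/
noncomputable def cotensor (V W : Comod k C) : Comod k C where
  carrier := cotensorSpace V W
  coact := cotensorCoact V W
  coassoc := isCoassoc_of_inj (inc_injective V W) (inc_cotensorCoact V W)
    (isCoassoc_actR W.coassoc)
  counital := isCounital_of_inj (inc_injective V W) (inc_cotensorCoact V W)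
    (isCounital_actR W.counital)

/-- The inclusion of `V ⊗^C W` in `V ⊗ W`. -/
noncomputable def incl (V W : Comod k C) : cotensor V W →ₗ[k] V ⊗[k] W := inc V W

theorem incl_injective (V W : Comod k C) : Function.Injective (incl V W) :=
  Subtype.val_injective

theorem incl_coact (V W : Comod k C) :
    (incl V W).rTensor C ∘ₗ (cotensor V W).coact = actR V W.coact ∘ₗ incl V W :=
  inc_cotensorCoact V W

theorem incl_coact' (V W : Comod k C) :
    (incl V W).rTensor C ∘ₗ (cotensor V W).coact = actL V.coact W ∘ₗ incl V W :=
  (inc_cotensorCoact V W).trans (actL_inc V W).symm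

theorem hom_ext_incl {Z V W : Comod k C} {f g : Z ⟶ cotensor V W}
    (h : incl V W ∘ₗ f.lin = incl V W ∘ₗ g.lin) : f = g :=
  hom_ext (LinearMap.ext fun x => incl_injective V W (LinearMap.congr_fun h x))

/-- The linear map to `V ⊗^C W` induced by one to `V ⊗ W`. -/
noncomputable def liftLin {Z V W : Comod k C} (f : Z →ₗ[k] V ⊗[k] W)
    (h : actL V.coact W ∘ₗ f = actR V W.coact ∘ₗ f) : Z →ₗ[k] cotensor V W :=
  f.codRestrict (cotensorSpace V W) (fun z => by
    rw [cotensorSpace_eq, LinearMap.mem_eqLocus]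
    exact LinearMap.congr_fun h z)

theorem incl_liftLin {Z V W : Comod k C} (f : Z →ₗ[k] V ⊗[k] W)
    (h : actL V.coact W ∘ₗ f = actR V W.coact ∘ₗ f) : incl V W ∘ₗ liftLin f h = f := rfl

/-- A linear map to `V ⊗ W` which is colinear for both coactions gives a morphism to
`V ⊗^C W`. -/
noncomputable def lift {Z V W : Comod k C} (f : Z →ₗ[k] V ⊗[k] W)
    (hL : f.rTensor C ∘ₗ Z.coact = actL V.coact W ∘ₗ f)
    (hR : f.rTensor C ∘ₗ Z.coact = actR V W.coact ∘ₗ f) : Z ⟶ cotensor V W where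
  lin := liftLin f (hL.symm.trans hR)
  colinear := by
    apply LinearMap.ext
    intro z
    apply rTensor_inj (incl_injective V W) C
    have h1 : (incl V W).rTensor C ∘ₗ (liftLin f (hL.symm.trans hR)).rTensor C ∘ₗ Z.coact =
        (incl V W).rTensor C ∘ₗ (cotensor V W).coact ∘ₗ liftLin f (hL.symm.trans hR) := by
      rw [← LinearMap.comp_assoc, ← LinearMap.comp_assoc, ← LinearMap.rTensor_comp, incl_coact,
        LinearMap.comp_assoc, incl_liftLin, hR]
    exact LinearMap.congr_fun h1 z

theorem incl_lift {Z V W : Comod k C} (f : Z →ₗ[k] V ⊗[k] W)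
    (hL : f.rTensor C ∘ₗ Z.coact = actL V.coact W ∘ₗ f)
    (hR : f.rTensor C ∘ₗ Z.coact = actR V W.coact ∘ₗ f) :
    incl V W ∘ₗ (lift f hL hR).lin = f := rfl

/-- The cotensor product of morphisms, the restriction of `f ⊗ g`. -/
noncomputable def cotensorHom {V V' W W' : Comod k C} (f : V ⟶ V') (g : W ⟶ W') :
    cotensor V W ⟶ cotensor V' W' :=
  lift (TensorProduct.map f.lin g.lin ∘ₗ incl V W)
    (by rw [LinearMap.rTensor_comp, LinearMap.comp_assoc, incl_coact', ← LinearMap.comp_assoc,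
      actL_map _ _ f.colinear, LinearMap.comp_assoc])
    (by rw [LinearMap.rTensor_comp, LinearMap.comp_assoc, incl_coact, ← LinearMap.comp_assoc,
      actR_map _ _ g.colinear, LinearMap.comp_assoc])

theorem incl_cotensorHom {V V' W W' : Comod k C} (f : V ⟶ V') (g : W ⟶ W') :
    incl V' W' ∘ₗ (cotensorHom f g).lin = TensorProduct.map f.lin g.lin ∘ₗ incl V W := rfl

/-- The symmetry of the cotensor product, the restriction of `τ`. -/
noncomputable def braidHom (V W : Comod k C) : cotensor V W ⟶ cotensor W V :=
  lift ((TensorProduct.comm k V W).toLinearMap ∘ₗ incl V W)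
    (by rw [LinearMap.rTensor_comp, LinearMap.comp_assoc, incl_coact, ← LinearMap.comp_assoc,
      actR_comm, LinearMap.comp_assoc])
    (by rw [LinearMap.rTensor_comp, LinearMap.comp_assoc, incl_coact', ← LinearMap.comp_assoc,
      actL_comm, LinearMap.comp_assoc])

theorem incl_braidHom (V W : Comod k C) : incl W V ∘ₗ (braidHom V W).lin =
    (TensorProduct.comm k V W).toLinearMap ∘ₗ incl V W := rfl

theorem braidHom_braidHom (V W : Comod k C) : braidHom V W ≫ braidHom W V = 𝟙 _ := by
  apply hom_ext_incl
  rw [comp_lin, ← LinearMap.comp_assoc, incl_braidHom, LinearMap.comp_assoc, incl_braidHom,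
    ← LinearMap.comp_assoc]
  ext t
  simp

/-- The embedding of `(V ⊗^C W) ⊗^C X` in `V ⊗ (W ⊗ X)`. -/
noncomputable def embL (V W X : Comod k C) :
    cotensor (cotensor V W) X →ₗ[k] V ⊗[k] (W ⊗[k] X) :=
  (TensorProduct.assoc k V W X).toLinearMap ∘ₗ (incl V W).rTensor X ∘ₗ incl (cotensor V W) X

/-- The embedding of `V ⊗^C (W ⊗^C X)` in `V ⊗ (W ⊗ X)`. -/
noncomputable def embR (V W X : Comod k C) :
    cotensor V (cotensor W X) →ₗ[k] V ⊗[k] (W ⊗[k] X) :=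
  (incl W X).lTensor V ∘ₗ incl V (cotensor W X)

theorem embR_injective (V W X : Comod k C) : Function.Injective (embR V W X) :=
  (lTensor_inj (incl_injective W X) V).comp (incl_injective V (cotensor W X))

theorem embL_injective (V W X : Comod k C) : Function.Injective (embL V W X) :=
  (TensorProduct.assoc k V W X).injective.comp
    ((rTensor_inj (incl_injective V W) X).comp (incl_injective (cotensor V W) X))

theorem embL_coact₃ (V W X : Comod k C) :
    (embL V W X).rTensor C ∘ₗ (cotensor (cotensor V W) X).coact =
      actR V (actR W X.coact) ∘ₗ embL V W X := by
  have h := actR_map (incl V W) (LinearMap.id (M := X)) (b := X.coact) (b' := X.coact) (by simp)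
  simp only [embL, LinearMap.rTensor_comp, LinearMap.comp_assoc]
  rw [incl_coact, ← LinearMap.comp_assoc (incl (cotensor V W) X) _
    (((incl V W).rTensor X).rTensor C)]
  erw [h]
  rw [LinearMap.comp_assoc, ← LinearMap.comp_assoc _ (actR _ _), assoc_actR, LinearMap.comp_assoc]
  rfl

theorem embL_coact₂ (V W X : Comod k C) :
    (embL V W X).rTensor C ∘ₗ (cotensor (cotensor V W) X).coact =
      actR V (actL W.coact X) ∘ₗ embL V W X := by
  have h := actL_map (incl V W) (LinearMap.id (M := X)) (incl_coact V W)
  simp only [embL, LinearMap.rTensor_comp, LinearMap.comp_assoc]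
  rw [incl_coact', ← LinearMap.comp_assoc (incl (cotensor V W) X) _
    (((incl V W).rTensor X).rTensor C)]
  erw [h]
  rw [LinearMap.comp_assoc, ← LinearMap.comp_assoc _ (actL _ _), assoc_actL_actR,
    LinearMap.comp_assoc]
  rfl

theorem embL_coact₁ (V W X : Comod k C) :
    (embL V W X).rTensor C ∘ₗ (cotensor (cotensor V W) X).coact =
      actL V.coact (W ⊗[k] X) ∘ₗ embL V W X := by
  have h := actL_map (incl V W) (LinearMap.id (M := X)) (incl_coact' V W)
  simp only [embL, LinearMap.rTensor_comp, LinearMap.comp_assoc]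
  rw [incl_coact', ← LinearMap.comp_assoc (incl (cotensor V W) X) _
    (((incl V W).rTensor X).rTensor C)]
  erw [h]
  rw [LinearMap.comp_assoc, ← LinearMap.comp_assoc _ (actL _ _), assoc_actL_actL,
    LinearMap.comp_assoc]
  rfl

theorem embL_mem_range (V W X : Comod k C) (t : cotensor (cotensor V W) X) :
    embL V W X t ∈ LinearMap.range ((incl W X).lTensor V) := by
  apply mem_range_lTensor (cotensorSpace_eq W X)
  apply (TensorProduct.assoc k V (W ⊗[k] X) C).symm.injective
  exact LinearMap.congr_fun ((embL_coact₂ V W X).symm.trans (embL_coact₃ V W X)) t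

/-- `embL` with values in `V ⊗ (W ⊗^C X)`. -/
noncomputable def embM (V W X : Comod k C) :
    cotensor (cotensor V W) X →ₗ[k] V ⊗[k] cotensor W X :=
  liftInj ((incl W X).lTensor V) (lTensor_inj (incl_injective W X) V) (embL V W X)
    (embL_mem_range V W X)

theorem incl_embM (V W X : Comod k C) : (incl W X).lTensor V ∘ₗ embM V W X = embL V W X :=
  comp_liftInj _ _ _ _

/-- The associativity morphism, the restriction of that of `⊗`. -/
noncomputable def assocHom (V W X : Comod k C) :
    cotensor (cotensor V W) X ⟶ cotensor V (cotensor W X) :=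
  lift (embM V W X)
    (by
      apply comp_cancel (rTensor_inj (lTensor_inj (incl_injective W X) V) C)
      have h := actL_map (LinearMap.id (M := V)) (incl W X) (a := V.coact) (a' := V.coact) (by simp)
      rw [← LinearMap.comp_assoc, ← LinearMap.rTensor_comp, incl_embM, embL_coact₁,
        ← LinearMap.comp_assoc]
      erw [h]
      rw [LinearMap.comp_assoc]
      erw [incl_embM])
    (by
      apply comp_cancel (rTensor_inj (lTensor_inj (incl_injective W X) V) C)
      have h := actR_map (LinearMap.id (M := V)) (incl W X) (incl_coact W X)
      rw [← LinearMap.comp_assoc, ← LinearMap.rTensor_comp, incl_embM, embL_coact₃,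
        ← LinearMap.comp_assoc]
      erw [h]
      rw [LinearMap.comp_assoc]
      erw [incl_embM])

theorem embR_assocHom (V W X : Comod k C) :
    embR V W X ∘ₗ (assocHom V W X).lin = embL V W X := by
  rw [embR, LinearMap.comp_assoc, assocHom, incl_lift, incl_embM]

theorem embL_braidHom (V W X : Comod k C) :
    embL V W X ∘ₗ (braidHom X (cotensor V W)).lin =
      ((TensorProduct.assoc k V W X).toLinearMap ∘ₗ
        (TensorProduct.comm k X (V ⊗[k] W)).toLinearMap) ∘ₗ embR X V W := by
  have h : (incl V W).rTensor X ∘ₗ (TensorProduct.comm k X (cotensor V W)).toLinearMap =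
      (TensorProduct.comm k X (V ⊗[k] W)).toLinearMap ∘ₗ (incl V W).lTensor X := by
    ext; simp
  rw [embL, embR, LinearMap.comp_assoc, LinearMap.comp_assoc, incl_braidHom,
    ← LinearMap.comp_assoc (incl X (cotensor V W)), h]
  rfl

theorem embR_whisker {V V' W W' X X' : Comod k C} (f : V ⟶ V') (g : W ⟶ W') (h : X ⟶ X') :
    embR V' W' X' ∘ₗ (cotensorHom f (cotensorHom g h)).lin =
      TensorProduct.map f.lin (TensorProduct.map g.lin h.lin) ∘ₗ embR V W X := by
  rw [embR, embR, LinearMap.comp_assoc, incl_cotensorHom, ← LinearMap.comp_assoc,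
    LinearMap.lTensor_comp_map, incl_cotensorHom, ← LinearMap.comp_assoc,
    LinearMap.map_comp_lTensor]

theorem embL_whisker {V V' W W' X X' : Comod k C} (f : V ⟶ V') (g : W ⟶ W') (h : X ⟶ X') :
    embL V' W' X' ∘ₗ (cotensorHom (cotensorHom f g) h).lin =
      TensorProduct.map f.lin (TensorProduct.map g.lin h.lin) ∘ₗ embL V W X := by
  rw [embL, embL, LinearMap.comp_assoc, LinearMap.comp_assoc, incl_cotensorHom,
    ← LinearMap.comp_assoc (incl (cotensor V W) X), LinearMap.rTensor_comp_map, incl_cotensorHom,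
    ← LinearMap.map_comp_rTensor, LinearMap.comp_assoc, ← LinearMap.comp_assoc _ _
    (TensorProduct.assoc k V' W' X').toLinearMap, ← LinearMap.comp_assoc _ _
    (TensorProduct.map f.lin (TensorProduct.map g.lin h.lin)),
    TensorProduct.map_map_comp_assoc_eq]

theorem embR_braid (V W X : Comod k C) :
    embR X V W ∘ₗ (cotensorHom (𝟙 X) (braidHom W V)).lin =
      (TensorProduct.comm k W V).toLinearMap.lTensor X ∘ₗ embR X W V := by
  rw [embR, embR, LinearMap.comp_assoc, incl_cotensorHom, ← LinearMap.comp_assoc,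
    LinearMap.lTensor_comp_map, incl_braidHom, id_lin, ← LinearMap.comp_assoc,
    ← LinearMap.lTensor_comp]
  rfl

theorem embL_braid (V W X : Comod k C) :
    embL X W V ∘ₗ (cotensorHom (braidHom W X) (𝟙 V)).lin ∘ₗ (braidHom V (cotensor W X)).lin =
      ((TensorProduct.assoc k X W V).toLinearMap ∘ₗ
        (TensorProduct.comm k W X).toLinearMap.rTensor V ∘ₗ
          (TensorProduct.comm k V (W ⊗[k] X)).toLinearMap) ∘ₗ embR V W X := by
  have h : (incl W X).rTensor V ∘ₗ (TensorProduct.comm k V (cotensor W X)).toLinearMap =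
      (TensorProduct.comm k V (W ⊗[k] X)).toLinearMap ∘ₗ (incl W X).lTensor V := by
    ext; simp
  rw [embL, embR, LinearMap.comp_assoc, LinearMap.comp_assoc,
    ← LinearMap.comp_assoc _ _ (incl (cotensor X W) V), incl_cotensorHom,
    LinearMap.comp_assoc, incl_braidHom, ← LinearMap.comp_assoc _ _ ((incl X W).rTensor V),
    LinearMap.rTensor_comp_map, incl_braidHom, id_lin, ← LinearMap.rTensor_def,
    LinearMap.rTensor_comp, LinearMap.comp_assoc, ← LinearMap.comp_assoc _ _
    ((incl W X).rTensor V), h]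
  rfl

/-- The inverse of the associativity morphism. -/
noncomputable def assocInv (V W X : Comod k C) :
    cotensor V (cotensor W X) ⟶ cotensor (cotensor V W) X :=
  braidHom V (cotensor W X) ≫ cotensorHom (braidHom W X) (𝟙 V) ≫ assocHom X W V ≫
    cotensorHom (𝟙 X) (braidHom W V) ≫ braidHom X (cotensor V W)

theorem embL_assocInv (V W X : Comod k C) :
    embL V W X ∘ₗ (assocInv V W X).lin = embR V W X := by
  simp only [assocInv, comp_lin]
  rw [LinearMap.comp_assoc, LinearMap.comp_assoc, LinearMap.comp_assoc,
    ← LinearMap.comp_assoc _ _ (embL V W X), embL_braidHom, LinearMap.comp_assoc,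
    ← LinearMap.comp_assoc _ _ (embR X V W), embR_braid,
    LinearMap.comp_assoc _ (embR X W V), ← LinearMap.comp_assoc _ _ (embR X W V), embR_assocHom, embL_braid,
    ← LinearMap.comp_assoc, ← LinearMap.comp_assoc]
  conv_rhs => rw [← LinearMap.id_comp (embR V W X)]
  congr 1
  ext
  simp

/-- Associativity of the cotensor product. -/
noncomputable def assocIso (V W X : Comod k C) :
    cotensor (cotensor V W) X ≅ cotensor V (cotensor W X) where
  hom := assocHom V W X
  inv := assocInv V W X
  hom_inv_id := hom_ext <| comp_cancel (embL_injective V W X) <| by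
    rw [comp_lin, ← LinearMap.comp_assoc, embL_assocInv, embR_assocHom]; rfl
  inv_hom_id := hom_ext <| comp_cancel (embR_injective V W X) <| by
    rw [comp_lin, ← LinearMap.comp_assoc, embR_assocHom, embL_assocInv]; rfl

/-- The inclusion of `V ⊗^C C` in `V ⊗ C`. -/
noncomputable def inclU (V : Comod k C) : cotensor V (unit k C) →ₗ[k] V ⊗[k] C :=
  incl V (unit k C)

theorem inclU_coact' (V : Comod k C) :
    (inclU V).rTensor C ∘ₗ (cotensor V (unit k C)).coact = actL V.coact C ∘ₗ inclU V :=
  incl_coact' V (unit k C)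

theorem inclU_coact (V : Comod k C) :
    (inclU V).rTensor C ∘ₗ (cotensor V (unit k C)).coact =
      actR V (Coalgebra.comul (R := k) (A := C)) ∘ₗ inclU V :=
  incl_coact V (unit k C)

theorem coact_actL (V : Comod k C) : V.coact.rTensor C ∘ₗ V.coact =
    actL V.coact C ∘ₗ V.coact := by
  have h : (TensorProduct.rightComm k V C C).toLinearMap ∘ₗ
        (TensorProduct.assoc k V C C).symm.toLinearMap =
      (TensorProduct.assoc k V C C).symm.toLinearMap ∘ₗ
        (TensorProduct.comm k C C).toLinearMap.lTensor V := by
    ext; simp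
  have hc : (TensorProduct.comm k C C).toLinearMap ∘ₗ Coalgebra.comul =
    Coalgebra.comul (R := k) (A := C) := Coalgebra.comm_comp_comul k C
  rw [actL, LinearMap.comp_assoc, coact_actR, actR, LinearMap.comp_assoc,
    ← LinearMap.comp_assoc _ _ (TensorProduct.rightComm k V C C).toLinearMap, h,
    LinearMap.comp_assoc, ← LinearMap.comp_assoc _ (LinearMap.lTensor _ _) (LinearMap.lTensor _ _),
    ← LinearMap.lTensor_comp, hc]

/-- The right unit isomorphism, the restriction of `id ⊗ ε`; its inverse is the coaction. -/
noncomputable def rightUnitorIso (V : Comod k C) : cotensor V (unit k C) ≅ V where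
  hom :=
    { lin := evC V ∘ₗ inclU V
      colinear := by
        rw [LinearMap.rTensor_comp, LinearMap.comp_assoc, inclU_coact', ← LinearMap.comp_assoc,
          evC_actL, LinearMap.comp_assoc] }
  inv := lift (W := unit k C) V.coact (coact_actL V) (coact_actR V)
  hom_inv_id := hom_ext <| comp_cancel (j := inclU V) (incl_injective V (unit k C)) <| by
    change V.coact ∘ₗ evC V ∘ₗ inclU V = inclU V
    rw [← LinearMap.comp_assoc, ← evC_actL, LinearMap.comp_assoc, ← inclU_coact', inclU_coact,
      ← LinearMap.comp_assoc, evC_actR, LinearMap.id_comp]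
  inv_hom_id := hom_ext (evC_coact V)

/-- The symmetry as an isomorphism. -/
noncomputable def braidIso (V W : Comod k C) : cotensor V W ≅ cotensor W V where
  hom := braidHom V W
  inv := braidHom W V
  hom_inv_id := braidHom_braidHom V W
  inv_hom_id := braidHom_braidHom W V

/-- The left unit isomorphism, the restriction of `ε ⊗ id`. -/
noncomputable def leftUnitorIso (V : Comod k C) : cotensor (unit k C) V ≅ V :=
  braidIso (unit k C) V ≪≫ rightUnitorIso V

/-- The inclusion of `C ⊗^C V` in `C ⊗ V`. -/
noncomputable def inclU' (V : Comod k C) : cotensor (unit k C) V →ₗ[k] C ⊗[k] V :=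
  incl (unit k C) V

theorem rightUnitorIso_lin (V : Comod k C) :
    (rightUnitorIso V).hom.lin = evC V ∘ₗ inclU V := rfl

theorem leftUnitorIso_lin (V : Comod k C) :
    (leftUnitorIso V).hom.lin = ((TensorProduct.lid k V).toLinearMap ∘ₗ
      (Coalgebra.counit (R := k) (A := C)).rTensor V) ∘ₗ inclU' V := by
  have h : evC V ∘ₗ (TensorProduct.comm k C V).toLinearMap = (TensorProduct.lid k V).toLinearMap ∘ₗ
      (Coalgebra.counit (R := k) (A := C)).rTensor V := by
    ext; simp [evC]
  rw [← h]
  rfl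

noncomputable instance : MonoidalCategoryStruct (Comod k C) where
  tensorObj := cotensor
  whiskerLeft V _ _ f := cotensorHom (𝟙 V) f
  whiskerRight f V := cotensorHom f (𝟙 V)
  tensorHom := cotensorHom
  tensorUnit := unit k C
  associator := assocIso
  leftUnitor := leftUnitorIso
  rightUnitor := rightUnitorIso

theorem cotensorHom_comp {V V' V'' W W' W'' : Comod k C} (f : V ⟶ V') (f' : V' ⟶ V'')
    (g : W ⟶ W') (g' : W' ⟶ W'') :
    cotensorHom f g ≫ cotensorHom f' g' = cotensorHom (f ≫ f') (g ≫ g') := by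
  apply hom_ext_incl
  rw [comp_lin, ← LinearMap.comp_assoc, incl_cotensorHom, LinearMap.comp_assoc, incl_cotensorHom,
    incl_cotensorHom, ← LinearMap.comp_assoc, ← TensorProduct.map_comp]
  rfl

theorem cotensorHom_id (V W : Comod k C) : cotensorHom (𝟙 V) (𝟙 W) = 𝟙 (cotensor V W) := by
  apply hom_ext_incl
  rw [incl_cotensorHom, id_lin, id_lin, id_lin, TensorProduct.map_id]
  rfl

theorem assoc_natural {V V' W W' X X' : Comod k C} (f : V ⟶ V') (g : W ⟶ W') (h : X ⟶ X') :
    cotensorHom (cotensorHom f g) h ≫ assocHom V' W' X' =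
      assocHom V W X ≫ cotensorHom f (cotensorHom g h) :=
  hom_ext <| comp_cancel (embR_injective _ _ _) <| by
    rw [comp_lin, comp_lin, ← LinearMap.comp_assoc, ← LinearMap.comp_assoc, embR_assocHom,
      embL_whisker, embR_whisker, LinearMap.comp_assoc, embR_assocHom]

theorem embL_eq_apply (V W X : Comod k C) (t : cotensor (cotensor V W) X) :
    embL V W X t = TensorProduct.assoc k V W X ((incl V W).rTensor X
      (incl (cotensor V W) X t)) := rfl

theorem pentagon_aux (V W X Y : Comod k C) :
    cotensorHom (assocHom V W X) (𝟙 Y) ≫ assocHom V (cotensor W X) Y ≫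
        cotensorHom (𝟙 V) (assocHom W X Y) =
      assocHom (cotensor V W) X Y ≫ assocHom V W (cotensor X Y) := by
  apply hom_ext
  apply LinearMap.ext
  intro t
  apply incl_injective
  apply lTensor_inj (embR_injective W X Y) V
  have a1 : ∀ s : cotensor V (cotensor (cotensor W X) Y),
      (embR W X Y).lTensor V (incl _ _ ((cotensorHom (𝟙 V) (assocHom W X Y)).lin s)) =
      (TensorProduct.assoc k W X Y).toLinearMap.lTensor V
        (((incl W X).rTensor Y).lTensor V (embR V (cotensor W X) Y s)) := by
    intro s
    have e := LinearMap.congr_fun (incl_cotensorHom (𝟙 V) (assocHom W X Y)) s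
    simp only [LinearMap.comp_apply] at e
    rw [e, id_lin, ← LinearMap.lTensor_def, ← LinearMap.comp_apply (LinearMap.lTensor _ _),
      ← LinearMap.lTensor_comp, embR_assocHom]
    simp only [embL, embR, LinearMap.lTensor_comp, LinearMap.comp_apply]
  have a2 : ∀ s : cotensor (cotensor V (cotensor W X)) Y,
      ((incl W X).rTensor Y).lTensor V (embL V (cotensor W X) Y s) =
      TensorProduct.assoc k V (W ⊗[k] X) Y ((embR V W X).rTensor Y (incl _ _ s)) := by
    intro s
    have h : ((incl W X).rTensor Y).lTensor V ∘ₗ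
        (TensorProduct.assoc k V (cotensor W X) Y).toLinearMap =
      (TensorProduct.assoc k V (W ⊗[k] X) Y).toLinearMap ∘ₗ ((incl W X).lTensor V).rTensor Y := by
      ext; simp
    rw [embL_eq_apply, embR, LinearMap.rTensor_comp]
    exact LinearMap.congr_fun h _
  have a3 : ∀ s : cotensor (cotensor (cotensor V W) X) Y,
      (embR V W X).rTensor Y (incl _ _ ((cotensorHom (assocHom V W X) (𝟙 Y)).lin s)) =
      (TensorProduct.assoc k V W X).toLinearMap.rTensor Y
        (((incl V W).rTensor X).rTensor Y ((incl (cotensor V W) X).rTensor Y (incl _ _ s))) := by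
    intro s
    have e := LinearMap.congr_fun (incl_cotensorHom (assocHom V W X) (𝟙 Y)) s
    simp only [LinearMap.comp_apply] at e
    rw [e, id_lin, ← LinearMap.rTensor_def, ← LinearMap.comp_apply (LinearMap.rTensor _ _),
      ← LinearMap.rTensor_comp, embR_assocHom]
    simp only [embL, LinearMap.rTensor_comp, LinearMap.comp_apply]
  have a4 : ∀ s : cotensor V (cotensor W (cotensor X Y)),
      (embR W X Y).lTensor V (incl _ _ s) =
      ((incl X Y).lTensor W).lTensor V (embR V W (cotensor X Y) s) := by
    intro s
    simp only [embR, LinearMap.lTensor_comp, LinearMap.comp_apply]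
  have a5 : ∀ s : cotensor (cotensor V W) (cotensor X Y),
      ((incl X Y).lTensor W).lTensor V (embL V W (cotensor X Y) s) =
      TensorProduct.assoc k V W (X ⊗[k] Y) ((incl V W).rTensor (X ⊗[k] Y)
        (embR (cotensor V W) X Y s)) := by
    intro s
    have h : ((incl X Y).lTensor W).lTensor V ∘ₗ
        (TensorProduct.assoc k V W (cotensor X Y)).toLinearMap ∘ₗ
          (incl V W).rTensor (cotensor X Y) =
      (TensorProduct.assoc k V W (X ⊗[k] Y)).toLinearMap ∘ₗ (incl V W).rTensor (X ⊗[k] Y) ∘ₗ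
        (incl X Y).lTensor (cotensor V W) := by
      have h1 : ((incl X Y).lTensor W).lTensor V ∘ₗ
          (TensorProduct.assoc k V W (cotensor X Y)).toLinearMap =
        (TensorProduct.assoc k V W (X ⊗[k] Y)).toLinearMap ∘ₗ (incl X Y).lTensor (V ⊗[k] W) := by
        ext; simp
      rw [← LinearMap.comp_assoc, h1, LinearMap.comp_assoc, LinearMap.lTensor_comp_rTensor,
        LinearMap.rTensor_comp_lTensor]
    exact LinearMap.congr_fun h _
  have a6 : ∀ s : cotensor (cotensor (cotensor V W) X) Y,
      (incl V W).rTensor (X ⊗[k] Y) (embL (cotensor V W) X Y s) =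
      TensorProduct.assoc k (V ⊗[k] W) X Y
        (((incl V W).rTensor X).rTensor Y ((incl (cotensor V W) X).rTensor Y (incl _ _ s))) := by
    intro s
    have h : (incl V W).rTensor (X ⊗[k] Y) ∘ₗ
        (TensorProduct.assoc k (cotensor V W) X Y).toLinearMap =
      (TensorProduct.assoc k (V ⊗[k] W) X Y).toLinearMap ∘ₗ
        ((incl V W).rTensor X).rTensor Y := by
      ext; simp
    exact LinearMap.congr_fun h _
  have b : ∀ (V W X : Comod k C) s, embR V W X ((assocHom V W X).lin s) = embL V W X s :=
    fun V W X s => LinearMap.congr_fun (embR_assocHom V W X) s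
  simp only [comp_lin, LinearMap.comp_apply]
  rw [a1, b, a2, a3, a4, b, a5, b, a6]
  have p : (TensorProduct.assoc k W X Y).toLinearMap.lTensor V ∘ₗ
      (TensorProduct.assoc k V (W ⊗[k] X) Y).toLinearMap ∘ₗ
        (TensorProduct.assoc k V W X).toLinearMap.rTensor Y =
      (TensorProduct.assoc k V W (X ⊗[k] Y)).toLinearMap ∘ₗ
        (TensorProduct.assoc k (V ⊗[k] W) X Y).toLinearMap := by
    ext; simp
  exact LinearMap.congr_fun p _

theorem triangle_aux (V W : Comod k C) :
    assocHom V (unit k C) W ≫ cotensorHom (𝟙 V) (leftUnitorIso W).hom =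
      cotensorHom (rightUnitorIso V).hom (𝟙 W) := by
  apply hom_ext_incl
  have h1 : incl V W ∘ₗ (cotensorHom (𝟙 V) (leftUnitorIso W).hom).lin =
      ((TensorProduct.lid k W).toLinearMap ∘ₗ
        (Coalgebra.counit (R := k) (A := C)).rTensor W).lTensor V ∘ₗ embR V (unit k C) W := by
    rw [incl_cotensorHom, leftUnitorIso_lin, id_lin, ← LinearMap.lTensor_def,
      LinearMap.lTensor_comp, LinearMap.comp_assoc]
    rfl
  have h2 : incl V W ∘ₗ (cotensorHom (rightUnitorIso V).hom (𝟙 W)).lin =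
      (evC V).rTensor W ∘ₗ (inclU V).rTensor W ∘ₗ incl (cotensor V (unit k C)) W := by
    rw [incl_cotensorHom, rightUnitorIso_lin, id_lin, ← LinearMap.rTensor_def,
      LinearMap.rTensor_comp, LinearMap.comp_assoc]
  have h3 : ((TensorProduct.lid k W).toLinearMap ∘ₗ
      (Coalgebra.counit (R := k) (A := C)).rTensor W).lTensor V ∘ₗ
        (TensorProduct.assoc k V C W).toLinearMap = (evC V).rTensor W := by
    ext
    simp [evC, TensorProduct.smul_tmul]
  rw [comp_lin, ← LinearMap.comp_assoc, h1, h2, ← h3]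
  apply LinearMap.ext
  intro t
  exact congrArg (((TensorProduct.lid k W).toLinearMap ∘ₗ
    (Coalgebra.counit (R := k) (A := C)).rTensor W).lTensor V)
    (LinearMap.congr_fun (embR_assocHom V (unit k C) W) t)

theorem rightUnitor_natural {V W : Comod k C} (f : V ⟶ W) :
    cotensorHom f (𝟙 (unit k C)) ≫ (rightUnitorIso W).hom = (rightUnitorIso V).hom ≫ f := by
  apply hom_ext
  have h1 : inclU W ∘ₗ (cotensorHom f (𝟙 (unit k C))).lin = f.lin.rTensor C ∘ₗ inclU V := rfl
  have h2 : evC W ∘ₗ f.lin.rTensor C = f.lin ∘ₗ evC V := by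
    ext; simp [evC]
  rw [comp_lin, comp_lin, rightUnitorIso_lin, rightUnitorIso_lin, LinearMap.comp_assoc, h1,
    ← LinearMap.comp_assoc, h2, LinearMap.comp_assoc]

theorem braid_natural {V V' W W' : Comod k C} (f : V ⟶ V') (g : W ⟶ W') :
    cotensorHom f g ≫ braidHom V' W' = braidHom V W ≫ cotensorHom g f := by
  apply hom_ext_incl
  have h : (TensorProduct.comm k V' W').toLinearMap ∘ₗ TensorProduct.map f.lin g.lin =
      TensorProduct.map g.lin f.lin ∘ₗ (TensorProduct.comm k V W).toLinearMap := by
    ext; simp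
  rw [comp_lin, comp_lin, ← LinearMap.comp_assoc, ← LinearMap.comp_assoc, incl_braidHom,
    incl_cotensorHom, LinearMap.comp_assoc, incl_cotensorHom, ← LinearMap.comp_assoc, h,
    LinearMap.comp_assoc, LinearMap.comp_assoc, incl_braidHom]

theorem leftUnitor_natural {V W : Comod k C} (f : V ⟶ W) :
    cotensorHom (𝟙 (unit k C)) f ≫ (leftUnitorIso W).hom = (leftUnitorIso V).hom ≫ f := by
  change cotensorHom (𝟙 (unit k C)) f ≫ braidHom _ _ ≫ (rightUnitorIso W).hom =
    (braidHom _ _ ≫ (rightUnitorIso V).hom) ≫ f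
  rw [← Category.assoc, braid_natural, Category.assoc, rightUnitor_natural, Category.assoc]

/-- The monoidal category `(Vec^C, ⊗^C, C)`. -/
noncomputable instance : MonoidalCategory (Comod k C) where
  tensorHom_def f g := by
    refine Eq.trans ?_ (cotensorHom_comp f (𝟙 _) (𝟙 _) g).symm
    rw [Category.id_comp, Category.comp_id]
    rfl
  id_tensorHom_id := cotensorHom_id
  tensorHom_comp_tensorHom f₁ f₂ g₁ g₂ := cotensorHom_comp f₁ g₁ f₂ g₂
  whiskerLeft_id := cotensorHom_id
  id_whiskerRight := cotensorHom_id
  associator_naturality := assoc_natural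
  leftUnitor_naturality := leftUnitor_natural
  rightUnitor_naturality := rightUnitor_natural
  pentagon := pentagon_aux
  triangle := triangle_aux

theorem embL_whisker_braid (X Y Z : Comod k C) :
    embL Y X Z ∘ₗ (cotensorHom (braidHom X Y) (𝟙 Z)).lin =
      ((TensorProduct.assoc k Y X Z).toLinearMap ∘ₗ
        (TensorProduct.comm k X Y).toLinearMap.rTensor Z ∘ₗ
          (TensorProduct.assoc k X Y Z).symm.toLinearMap) ∘ₗ embL X Y Z := by
  apply LinearMap.ext
  intro t
  have e := LinearMap.congr_fun (incl_cotensorHom (braidHom X Y) (𝟙 Z)) t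
  simp only [LinearMap.comp_apply] at e
  simp only [LinearMap.comp_apply, embL_eq_apply, LinearEquiv.coe_coe,
    LinearEquiv.symm_apply_apply]
  rw [e, id_lin, ← LinearMap.rTensor_def, ← LinearMap.comp_apply (LinearMap.rTensor _ _),
    ← LinearMap.rTensor_comp, incl_braidHom, LinearMap.rTensor_comp, LinearMap.comp_apply]

theorem embR_braidHom (X Y Z : Comod k C) :
    embR Z X Y ∘ₗ (braidHom (cotensor X Y) Z).lin =
      ((TensorProduct.comm k (X ⊗[k] Y) Z).toLinearMap ∘ₗ
        (TensorProduct.assoc k X Y Z).symm.toLinearMap) ∘ₗ embL X Y Z := by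
  apply LinearMap.ext
  intro t
  have e := LinearMap.congr_fun (incl_braidHom (cotensor X Y) Z) t
  simp only [LinearMap.comp_apply] at e
  simp only [LinearMap.comp_apply, embR, embL_eq_apply, LinearEquiv.coe_coe,
    LinearEquiv.symm_apply_apply]
  rw [e, comm_rTensor]
  rfl

theorem hexagon_forward_aux (X Y Z : Comod k C) :
    assocHom X Y Z ≫ braidHom X (cotensor Y Z) ≫ assocHom Y Z X =
      cotensorHom (braidHom X Y) (𝟙 Z) ≫ assocHom Y X Z ≫
        cotensorHom (𝟙 Y) (braidHom X Z) := by
  apply hom_ext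
  apply comp_cancel (embR_injective Y Z X)
  simp only [comp_lin]
  rw [← LinearMap.comp_assoc, ← LinearMap.comp_assoc, embR_assocHom, embL_braidHom,
    LinearMap.comp_assoc, embR_assocHom, ← LinearMap.comp_assoc, ← LinearMap.comp_assoc,
    embR_braid, LinearMap.comp_assoc _ (embR Y X Z), embR_assocHom,
    LinearMap.comp_assoc _ (embL Y X Z), embL_whisker_braid, ← LinearMap.comp_assoc,
    ← LinearMap.comp_assoc]
  congr 1
  apply comp_cancel_right (TensorProduct.assoc k X Y Z).surjective
  ext
  simp

theorem hexagon_reverse_aux (X Y Z : Comod k C) :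
    assocInv X Y Z ≫ braidHom (cotensor X Y) Z ≫ assocInv Z X Y =
      cotensorHom (𝟙 X) (braidHom Y Z) ≫ assocInv X Z Y ≫
        cotensorHom (braidHom X Z) (𝟙 Y) := by
  apply hom_ext
  apply comp_cancel (embL_injective Z X Y)
  simp only [comp_lin]
  rw [← LinearMap.comp_assoc, ← LinearMap.comp_assoc, embL_assocInv, embR_braidHom,
    LinearMap.comp_assoc, embL_assocInv, ← LinearMap.comp_assoc, ← LinearMap.comp_assoc,
    embL_whisker_braid, LinearMap.comp_assoc _ (embL X Z Y), embL_assocInv,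
    LinearMap.comp_assoc _ (embR X Z Y), embR_braid, ← LinearMap.comp_assoc,
    ← LinearMap.comp_assoc]
  congr 1
  apply comp_cancel_right (TensorProduct.assoc k X Y Z).surjective
  ext
  simp

/-- The symmetric monoidal category `(Vec^C, ⊗^C, C)`. -/
noncomputable instance : SymmetricCategory (Comod k C) where
  braiding := braidIso
  braiding_naturality_right X _ _ f := braid_natural (𝟙 X) f
  braiding_naturality_left f Z := braid_natural f (𝟙 Z)
  hexagon_forward := hexagon_forward_aux
  hexagon_reverse := hexagon_reverse_aux
  symmetry := braidHom_braidHom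

end Comod

section Cosemisimple

variable (k : Type u) [Field k] (C : Type u) [AddCommGroup C] [Module k C] [Coalgebra k C]

variable {C} in
/-- A subspace `D` of `C` is a subcoalgebra if `Δ(D) ⊆ D ⊗ D`. -/
def IsSubcoalgebra (D : Submodule k C) : Prop :=
  ∀ x ∈ D, Coalgebra.comul (R := k) x ∈
    LinearMap.range (TensorProduct.map D.subtype D.subtype)

variable {C} in
/-- A nonzero subcoalgebra which has no subcoalgebras but `0` and itself. -/
structure IsSimpleSubcoalgebra (D : Submodule k C) : Prop where
  isSubcoalgebra : IsSubcoalgebra k D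
  ne_bot : D ≠ ⊥
  eq_bot_or_eq : ∀ E : Submodule k C, E ≤ D → IsSubcoalgebra k E → E = ⊥ ∨ E = D

/-- A coalgebra is cosemisimple if it is the direct sum of simple (sub)coalgebras. -/
def IsCosemisimple : Prop :=
  ∃ (ι : Type u) (D : ι → Submodule k C),
    (∀ i, IsSimpleSubcoalgebra k (D i)) ∧ iSupIndep D ∧ ⨆ i, D i = ⊤

end Cosemisimple

section CoalgOver

variable (k : Type u) [Field k]

/-- The category `Coalg` of cocommutative `k`-coalgebras and morphisms of coalgebras. -/
abbrev Coalg : Type (u + 1) :=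
  ObjectProperty.FullSubcategory (fun D : CoalgCat.{u} k => Coalgebra.IsCocomm k D)

variable (C : Type u) [AddCommGroup C] [Module k C] [Coalgebra k C] [Coalgebra.IsCocomm k C]

/-- A cocommutative coalgebra as an object of `Coalg`. -/
def Coalg.of : Coalg k := ⟨CoalgCat.of k C, ‹Coalgebra.IsCocomm k C›⟩

/-- The category `Coalg C` of cocommutative coalgebras over `C`. -/
abbrev CoalgOver : Type (u + 1) := Over (Coalg.of k C)

variable {k C}

/-- The structure morphism `φ : D → C` of an object of `Coalg C`. -/
def CoalgOver.str (φ : CoalgOver k C) : φ.left.obj →ₗc[k] C :=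
  CoalgCat.Hom.toCoalgHom φ.hom.hom

/-- The coalgebra morphism `D → E` underlying a morphism in `Coalg C`. -/
def CoalgOver.toCoalgHom {φ ψ : CoalgOver k C} (f : φ ⟶ ψ) : φ.left.obj →ₗc[k] ψ.left.obj :=
  CoalgCat.Hom.toCoalgHom f.left.hom

theorem CoalgOver.w {φ ψ : CoalgOver k C} (f : φ ⟶ ψ) :
    ψ.str.toLinearMap ∘ₗ (toCoalgHom f).toLinearMap = φ.str.toLinearMap := by
  have h := congrArg (fun g => (CoalgCat.Hom.toCoalgHom g.hom).toLinearMap) (Over.w f)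
  exact h

theorem isCoassoc_str (φ : CoalgOver k C) :
    IsCoassoc (φ.str.toLinearMap.lTensor φ.left.obj ∘ₗ Coalgebra.comul) := by
  set D := φ.left.obj
  set f : D →ₗ[k] C := φ.str.toLinearMap with hf
  have h1 : (TensorProduct.assoc k D C C).toLinearMap ∘ₗ
      (f.lTensor D ∘ₗ Coalgebra.comul).rTensor C ∘ₗ f.lTensor D =
      (TensorProduct.map f f).lTensor D ∘ₗ (TensorProduct.assoc k D D D).toLinearMap ∘ₗ
        (Coalgebra.comul (R := k) (A := D)).rTensor D := by
    have h2 : (TensorProduct.assoc k D C C).toLinearMap ∘ₗ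
        (f.lTensor D).rTensor C ∘ₗ f.lTensor (D ⊗[k] D) =
      (TensorProduct.map f f).lTensor D ∘ₗ (TensorProduct.assoc k D D D).toLinearMap := by
      ext; simp
    rw [← LinearMap.comp_assoc, ← LinearMap.comp_assoc, ← h2, LinearMap.rTensor_comp]
    simp only [LinearMap.comp_assoc]
    rw [LinearMap.rTensor_comp_lTensor, LinearMap.lTensor_comp_rTensor]
  have h3 : TensorProduct.map f f ∘ₗ Coalgebra.comul = Coalgebra.comul ∘ₗ f :=
    φ.str.map_comp_comul
  unfold IsCoassoc
  rw [← LinearMap.comp_assoc _ (f.lTensor D), ← LinearMap.comp_assoc, h1, LinearMap.comp_assoc,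
    LinearMap.comp_assoc, Coalgebra.coassoc, ← LinearMap.comp_assoc, ← LinearMap.lTensor_comp, h3,
    LinearMap.lTensor_comp, LinearMap.comp_assoc]

theorem isCounital_str (φ : CoalgOver k C) :
    IsCounital (φ.str.toLinearMap.lTensor φ.left.obj ∘ₗ Coalgebra.comul) := by
  have h3 : Coalgebra.counit ∘ₗ φ.str.toLinearMap = Coalgebra.counit := φ.str.counit_comp
  unfold IsCounital
  rw [← LinearMap.comp_assoc, ← LinearMap.lTensor_comp, h3, Coalgebra.lTensor_counit_comp_comul]

theorem colinear_toCoalgHom {φ ψ : CoalgOver k C} (f : φ ⟶ ψ) :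
    (CoalgOver.toCoalgHom f).toLinearMap.rTensor C ∘ₗ
        (φ.str.toLinearMap.lTensor φ.left.obj ∘ₗ Coalgebra.comul) =
      (ψ.str.toLinearMap.lTensor ψ.left.obj ∘ₗ Coalgebra.comul) ∘ₗ
        (CoalgOver.toCoalgHom f).toLinearMap := by
  have h3 := (CoalgOver.toCoalgHom f).map_comp_comul
  rw [LinearMap.comp_assoc, ← h3, ← LinearMap.comp_assoc, ← LinearMap.comp_assoc,
    LinearMap.rTensor_comp_lTensor, LinearMap.lTensor_comp_map, CoalgOver.w]

variable (k C) in
/-- The functor `U^C : Coalg C ⥤ Vec^C`, which takes `φ : D → C` to the space `D` with the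
coaction `(id ⊗ φ) ∘ Δ_D`. -/
noncomputable def U : CoalgOver k C ⥤ Comod k C where
  obj φ :=
    { carrier := φ.left.obj
      coact := φ.str.toLinearMap.lTensor φ.left.obj ∘ₗ Coalgebra.comul
      coassoc := isCoassoc_str φ
      counital := isCounital_str φ }
  map f := ⟨(CoalgOver.toCoalgHom f).toLinearMap, colinear_toCoalgHom f⟩

end CoalgOver

section LNL

universe v₁ v₂ u₁ u₂

/-- `U ⊣ R` as an LNL adjunction: a cartesian structure on `𝒞`, closedness of the symmetric
monoidal category `ℳ`, and an adjunction between (lax) monoidal functors `U` and `R` whose unit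
and counit are monoidal natural transformations. -/
structure LNLAdjunction {𝒞 : Type u₁} [Category.{v₁} 𝒞] {ℳ : Type u₂} [Category.{v₂} ℳ]
    [MonoidalCategory ℳ] [SymmetricCategory ℳ] (U : 𝒞 ⥤ ℳ) (R : ℳ ⥤ 𝒞) where
  /-- finite products on `𝒞` -/
  cartesian : CartesianMonoidalCategory 𝒞
  /-- internal homs on `ℳ` -/
  closed : MonoidalClosed ℳ
  /-- the adjunction -/
  adj : U ⊣ R
  /-- the monoidal structure of `U` -/
  laxU : U.LaxMonoidal
  /-- the monoidal structure of `R` -/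
  laxR : R.LaxMonoidal
  unit_isMonoidal : NatTrans.IsMonoidal adj.unit
  counit_isMonoidal : NatTrans.IsMonoidal adj.counit

/-- The left adjoint is strong monoidal: its structure morphisms are invertible. -/
def LNLAdjunction.IsStrong {𝒞 : Type u₁} [Category.{v₁} 𝒞] {ℳ : Type u₂} [Category.{v₂} ℳ]
    [MonoidalCategory ℳ] [SymmetricCategory ℳ] {U : 𝒞 ⥤ ℳ} {R : ℳ ⥤ 𝒞}
    (L : LNLAdjunction U R) : Prop :=
  letI := L.cartesian
  letI := L.laxU
  IsIso (Functor.LaxMonoidal.ε U) ∧ ∀ X Y : 𝒞, IsIso (Functor.LaxMonoidal.μ U X Y)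

end LNL

end ComodLNL

/-! Contracting the `C`-factor of a coaction with a functional on `C` gives operators on a comodule.
Over a field these operators detect everything: an element of a tensor product vanishes when all its
contractions do. Subcomodules are therefore the stable subspaces and colinear maps are the commuting
linear maps. Over a cocommutative coalgebra the stable subspaces of the coalgebra itself are its
subcoalgebras.

Products and strong monoidality. The tensor product of cocommutative coalgebras is their product,
and the equalizer of two linear maps `α`, `β` out of a coalgebra is cut out by `(id ⊗ α) ∘ Δ = (id ⊗
β) ∘ Δ`. Hence the product of `D → C` and `E → C` is a subcoalgebra of `D ⊗ E`, and as a subspace it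
is exactly the cotensor product (`cotensorSpace_U`). The comultiplication makes each `U D` a
comonoid for the cotensor product. This gives the oplax structure on `U`, whose binary part is the
identity on that common subspace (`incl_δ_apply`).

Right adjoint. It suffices to find a terminal object among the pairs of some `D → C` and a colinear
map `U D → W`. The cofree cocommutative coalgebra on `C × W` classifies pairs of linear maps, and
its largest subcoalgebra on which these maps satisfy the required identities is terminal. The cofree
coalgebra (`exists_cofree`) is a direct sum of all finite-dimensional coalgebras equipped with a map
to the given space, divided by the largest coideal in the kernel. Uniqueness holds because the
difference of two morphisms has a coideal as image; existence is local, since every element lies in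
a finite-dimensional subcoalgebra.

Closedness. This is where cosemisimplicity enters: `C`, and with it every cofree comodule `M ⊗ C`,
is a semisimple module over the contraction operators, so each coaction `V → V ⊗ C` has a colinear
retraction (`exists_retraction`). The retraction makes `V ⊗^C X` a direct summand of `V ⊗ X`,
naturally in `X`. Morphisms `V ⊗^C X → W` thus become linear maps `X → Hom(V, W)` subject to two
conditions, and these conditions define a subcomodule of the cofree comodule `Hom(V, W) ⊗ C`, the
internal hom.

Finally, the right adjoint of a strong monoidal functor is lax monoidal, with monoidal unit and
counit. -/

namespace ComodLNL

/-! ### Contractions with functionals -/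

section Slice

variable {k : Type u} [Field k]
variable {M N P M' P' : Type u} [AddCommGroup M] [Module k M] [AddCommGroup N] [Module k N]
  [AddCommGroup M'] [Module k M'] [AddCommGroup P'] [Module k P'] [AddCommGroup P] [Module k P]

/-- Contraction of the second factor of `M ⊗ P` with a functional on `P`. -/
noncomputable def slice (M : Type u) [AddCommGroup M] [Module k M] (ξ : Module.Dual k P) :
    M ⊗[k] P →ₗ[k] M :=
  (TensorProduct.rid k M).toLinearMap ∘ₗ ξ.lTensor M

@[simp] theorem slice_tmul (ξ : Module.Dual k P) (m : M) (p : P) :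
    slice M ξ (m ⊗ₜ p) = ξ p • m := by
  simp [slice]

theorem slice_rTensor (ξ : Module.Dual k P) (f : M →ₗ[k] N) (z : M ⊗[k] P) :
    slice N ξ (f.rTensor P z) = f (slice M ξ z) := by
  have : slice N ξ ∘ₗ f.rTensor P = f ∘ₗ slice M ξ := by ext; simp
  exact LinearMap.congr_fun this z

theorem slice_lTensor (ξ : Module.Dual k P') (f : P →ₗ[k] P') (z : M ⊗[k] P) :
    slice M ξ (f.lTensor M z) = slice M (ξ ∘ₗ f) z := by
  have : slice M ξ ∘ₗ f.lTensor M = slice M (ξ ∘ₗ f) := by ext; simp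
  exact LinearMap.congr_fun this z

/-- An element of `M ⊗ P` whose contractions with all functionals on `P` vanish is zero. -/
theorem eq_zero_of_slice {z : M ⊗[k] P} (h : ∀ ξ : Module.Dual k P, slice M ξ z = 0) : z = 0 := by
  let b := Module.Free.chooseBasis k P
  apply (TensorProduct.equivFinsuppOfBasisRight (M := M) b).injective
  rw [map_zero]
  ext i
  have : Finsupp.lapply (R := k) i ∘ₗ
      (TensorProduct.equivFinsuppOfBasisRight (M := M) b).toLinearMap = slice M (b.coord i) := by
    ext; simp
  exact (LinearMap.congr_fun this z).trans (h _)

theorem eq_of_slice {z w : M ⊗[k] P} (h : ∀ ξ : Module.Dual k P, slice M ξ z = slice M ξ w) :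
    z = w :=
  sub_eq_zero.1 (eq_zero_of_slice fun ξ => by rw [map_sub, h, sub_self])

theorem mem_range_rTensor_of_mkQ {K : Submodule k M} {z : M ⊗[k] P}
    (h : K.mkQ.rTensor P z = 0) : z ∈ LinearMap.range (K.subtype.rTensor P) :=
  mem_range_rTensor (f := K.mkQ) (g := 0)
    (by rw [LinearMap.eqLocus_eq_ker_sub, sub_zero, Submodule.ker_mkQ]) z
    (by rw [h, LinearMap.rTensor_zero, LinearMap.zero_apply])

/-- Pass to `M ⧸ K`: the image of `z` in `(M ⧸ K) ⊗ P` is zero as soon as its contractions are. This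
reduces containments such as `Δ(N) ⊆ N ⊗ X` to stability of `N` under linear operators. -/
theorem mem_range_rTensor_iff_slice {K : Submodule k M} {z : M ⊗[k] P} :
    z ∈ LinearMap.range (K.subtype.rTensor P) ↔ ∀ ξ : Module.Dual k P, slice M ξ z ∈ K := by
  constructor
  · rintro ⟨y, rfl⟩ ξ
    rw [slice_rTensor]
    exact (slice K ξ y).2
  · intro h
    refine mem_range_rTensor_of_mkQ (eq_zero_of_slice fun ξ => ?_)
    rw [slice_rTensor]
    exact (Submodule.Quotient.mk_eq_zero K).2 (h ξ)

theorem exists_finiteDimensional_slice (z : M ⊗[k] P) : ∃ K : Submodule k M,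
    FiniteDimensional k K ∧ ∀ ξ : Module.Dual k P, slice M ξ z ∈ K := by
  induction z using TensorProduct.induction_on with
  | zero => exact ⟨⊥, inferInstance, fun ξ => by simp⟩
  | tmul m p =>
    refine ⟨Submodule.span k {m}, inferInstance, fun ξ => ?_⟩
    rw [slice_tmul]
    exact Submodule.smul_mem _ _ (Submodule.mem_span_singleton_self m)
  | add x y hx hy =>
    obtain ⟨K, _, hK⟩ := hx
    obtain ⟨L, _, hL⟩ := hy
    exact ⟨K ⊔ L, inferInstance, fun ξ => by
      rw [map_add]; exact Submodule.add_mem_sup (hK ξ) (hL ξ)⟩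

/-- The contractions of an element of `M ⊗ P`, as a subspace of `M`. -/
noncomputable def slices (z : M ⊗[k] P) : Submodule k M :=
  LinearMap.range ((TensorProduct.rid k M).toLinearMap ∘ₗ (LinearMap.lTensorHom M).flip z :
    Module.Dual k P →ₗ[k] M)

theorem mem_slices {z : M ⊗[k] P} {m : M} :
    m ∈ slices z ↔ ∃ ξ : Module.Dual k P, slice M ξ z = m := Iff.rfl

theorem finiteDimensional_slices (z : M ⊗[k] P) : FiniteDimensional k (slices z) := by
  obtain ⟨K, hf, hK⟩ := exists_finiteDimensional_slice z
  refine Submodule.finiteDimensional_of_le (S₂ := K) ?_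
  rintro _ ⟨ξ, rfl⟩
  exact hK ξ

end Slice

/-! ### Subcoalgebras and local finiteness -/

section Subcoalgebra

variable {k : Type u} [Field k]
variable {X Y : Type u} [AddCommGroup X] [Module k X] [AddCommGroup Y] [Module k Y]

theorem map_injective {M N P Q : Type u} [AddCommGroup M] [Module k M] [AddCommGroup N]
    [Module k N] [AddCommGroup P] [Module k P] [AddCommGroup Q] [Module k Q]
    {f : M →ₗ[k] N} {g : P →ₗ[k] Q} (hf : Function.Injective f) (hg : Function.Injective g) :
    Function.Injective (TensorProduct.map f g) := by
  rw [← LinearMap.rTensor_comp_lTensor]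
  exact (rTensor_inj hf Q).comp (lTensor_inj hg M)

variable [Coalgebra k X] [Coalgebra k Y]

/-- A space which embeds in a coalgebra compatibly with a comultiplication is a coalgebra. -/
noncomputable abbrev coalgebraOfInjective {A : Type u} [AddCommGroup A] [Module k A]
    (j : A →ₗ[k] X) (hj : Function.Injective j) (Δ : A →ₗ[k] A ⊗[k] A)
    (h : TensorProduct.map j j ∘ₗ Δ = Coalgebra.comul ∘ₗ j) : Coalgebra k A where
  comul := Δ
  counit := Coalgebra.counit ∘ₗ j
  coassoc := by
    apply Comod.comp_cancel (map_injective hj (map_injective hj hj))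
    rw [← LinearMap.comp_assoc, TensorProduct.map_map_comp_assoc_eq, LinearMap.comp_assoc,
      ← LinearMap.comp_assoc _ (LinearMap.rTensor _ _), LinearMap.map_comp_rTensor, h,
      ← LinearMap.comp_assoc _ (LinearMap.lTensor _ _), LinearMap.map_comp_lTensor, h,
      ← LinearMap.rTensor_comp_map, ← LinearMap.lTensor_comp_map, LinearMap.comp_assoc,
      LinearMap.comp_assoc, h, ← LinearMap.comp_assoc, ← LinearMap.comp_assoc,
      ← LinearMap.comp_assoc, ← Coalgebra.coassoc, LinearMap.comp_assoc]
    rfl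
  rTensor_counit_comp_comul := by
    apply Comod.comp_cancel (lTensor_inj hj k)
    rw [← LinearMap.comp_assoc, LinearMap.lTensor_comp_rTensor, ← LinearMap.rTensor_comp_map,
      LinearMap.comp_assoc, h, ← LinearMap.comp_assoc, Coalgebra.rTensor_counit_comp_comul]
    ext
    simp
  lTensor_counit_comp_comul := by
    apply Comod.comp_cancel (rTensor_inj hj k)
    rw [← LinearMap.comp_assoc, LinearMap.rTensor_comp_lTensor, ← LinearMap.lTensor_comp_map,
      LinearMap.comp_assoc, h, ← LinearMap.comp_assoc, Coalgebra.lTensor_counit_comp_comul]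
    ext
    simp

theorem isCocomm_of_injective {A : Type u} [AddCommGroup A] [Module k A] [Coalgebra k A]
    [Coalgebra.IsCocomm k X] (j : A →ₗc[k] X) (hj : Function.Injective j) :
    Coalgebra.IsCocomm k A := by
  have hj' : Function.Injective j.toLinearMap := hj
  refine ⟨Comod.comp_cancel (map_injective hj' hj') ?_⟩
  have h : TensorProduct.map j.toLinearMap j.toLinearMap ∘ₗ
        (TensorProduct.comm k A A).toLinearMap =
      (TensorProduct.comm k X X).toLinearMap ∘ₗ
        TensorProduct.map j.toLinearMap j.toLinearMap := by
    ext; simp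
  have hcomp : (TensorProduct.comm k X X).toLinearMap ∘ₗ Coalgebra.comul = Coalgebra.comul :=
    Coalgebra.comm_comp_comul k X
  change TensorProduct.map j.toLinearMap j.toLinearMap ∘ₗ
    (TensorProduct.comm k A A).toLinearMap ∘ₗ Coalgebra.comul = _
  rw [← LinearMap.comp_assoc, h, LinearMap.comp_assoc, j.map_comp_comul, ← LinearMap.comp_assoc,
    hcomp]

/-- The comultiplication of a subcoalgebra. -/
noncomputable def subComul {N : Submodule k X} (hN : IsSubcoalgebra k N) : N →ₗ[k] N ⊗[k] N :=
  liftInj (TensorProduct.map N.subtype N.subtype)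
    (map_injective N.injective_subtype N.injective_subtype)
    (Coalgebra.comul ∘ₗ N.subtype) (fun x => hN x x.2)

theorem map_subComul {N : Submodule k X} (hN : IsSubcoalgebra k N) :
    TensorProduct.map N.subtype N.subtype ∘ₗ subComul hN = Coalgebra.comul ∘ₗ N.subtype :=
  comp_liftInj _ _ _ _

/-- A subcoalgebra as a coalgebra. -/
noncomputable abbrev subCoalgebra {N : Submodule k X} (hN : IsSubcoalgebra k N) :
    Coalgebra k N :=
  coalgebraOfInjective N.subtype N.injective_subtype (subComul hN) (map_subComul hN)

/-- The inclusion of a subcoalgebra. -/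
noncomputable def subCoalgHom {N : Submodule k X} (hN : IsSubcoalgebra k N) :
    letI := subCoalgebra hN
    N →ₗc[k] X :=
  letI := subCoalgebra hN
  { N.subtype with
    counit_comp := rfl
    map_comp_comul := map_subComul hN }

theorem subCoalgebra_isCocomm [Coalgebra.IsCocomm k X] {N : Submodule k X}
    (hN : IsSubcoalgebra k N) :
    letI := subCoalgebra hN
    Coalgebra.IsCocomm k N :=
  letI := subCoalgebra hN
  isCocomm_of_injective (subCoalgHom hN) N.injective_subtype

/-- A coalgebra morphism with values in a subcoalgebra. -/
noncomputable def subCoalgLift {N : Submodule k X} (hN : IsSubcoalgebra k N) (f : Y →ₗc[k] X)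
    (hf : ∀ y, f y ∈ N) :
    letI := subCoalgebra hN
    Y →ₗc[k] N :=
  letI := subCoalgebra hN
  { f.toLinearMap.codRestrict N hf with
    counit_comp := f.counit_comp
    map_comp_comul := by
      apply Comod.comp_cancel (map_injective N.injective_subtype N.injective_subtype)
      have h : N.subtype ∘ₗ f.toLinearMap.codRestrict N hf = f.toLinearMap := rfl
      change _ = TensorProduct.map N.subtype N.subtype ∘ₗ
        subComul hN ∘ₗ f.toLinearMap.codRestrict N hf
      rw [← LinearMap.comp_assoc, ← TensorProduct.map_comp, ← LinearMap.comp_assoc,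
        map_subComul hN, LinearMap.comp_assoc, h]
      exact f.map_comp_comul }

/-- In a cocommutative coalgebra, a subspace stable under the contractions of the
comultiplication is a subcoalgebra. -/
theorem isSubcoalgebra_of_mem_range_rTensor [Coalgebra.IsCocomm k X] {N : Submodule k X}
    (h : ∀ x ∈ N, Coalgebra.comul (R := k) x ∈ LinearMap.range (N.subtype.rTensor X)) :
    IsSubcoalgebra k N := by
  intro x hx
  obtain ⟨y, hy⟩ := h x hx
  -- By cocommutativity `Δ x` lies in `X ⊗ N` as well as in `N ⊗ X`; over a field the intersection
  -- of the two is `N ⊗ N`.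
  have h1 : N.mkQ.lTensor X (Coalgebra.comul (R := k) x) = 0 := by
    rw [← Coalgebra.comm_comul k x, ← comm_rTensor, ← hy, ← LinearMap.comp_apply,
      ← LinearMap.rTensor_comp, (LinearMap.exact_subtype_mkQ N).linearMap_comp_eq_zero,
      LinearMap.rTensor_zero, LinearMap.zero_apply, map_zero]
  have h2 : N.mkQ.lTensor N y = 0 := by
    apply rTensor_inj N.injective_subtype
    rw [← LinearMap.comp_apply, LinearMap.rTensor_comp_lTensor, ← LinearMap.lTensor_comp_rTensor,
      LinearMap.comp_apply, hy, h1, map_zero]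
  obtain ⟨w, hw⟩ := mem_range_lTensor (K := N) (f := N.mkQ) (g := 0)
    (by rw [LinearMap.eqLocus_eq_ker_sub, sub_zero, Submodule.ker_mkQ]) y
    (by rw [h2, LinearMap.lTensor_zero, LinearMap.zero_apply])
  exact ⟨w, by rw [← LinearMap.rTensor_comp_lTensor, LinearMap.comp_apply, hw, hy]⟩

theorem isSubcoalgebra_of_slice [Coalgebra.IsCocomm k X] {N : Submodule k X}
    (h : ∀ x ∈ N, ∀ ξ : Module.Dual k X, slice X ξ (Coalgebra.comul (R := k) x) ∈ N) :
    IsSubcoalgebra k N :=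
  isSubcoalgebra_of_mem_range_rTensor fun x hx => mem_range_rTensor_iff_slice.2 (h x hx)

theorem slice_mem_of_isSubcoalgebra {N : Submodule k X} (hN : IsSubcoalgebra k N) {x : X}
    (hx : x ∈ N) (ξ : Module.Dual k X) : slice X ξ (Coalgebra.comul (R := k) x) ∈ N := by
  obtain ⟨y, hy⟩ := hN x hx
  refine mem_range_rTensor_iff_slice.1 ⟨N.subtype.lTensor N y, ?_⟩ ξ
  rw [← hy, ← LinearMap.comp_apply, LinearMap.rTensor_comp_lTensor]

/-- Stability under a linear operator passes to sums of subspaces. Consequently every subspace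
contains a largest subcoalgebra. -/
theorem isSubcoalgebra_sSup [Coalgebra.IsCocomm k X] {S : Set (Submodule k X)}
    (hS : ∀ N ∈ S, IsSubcoalgebra k N) : IsSubcoalgebra k (sSup S) := by
  refine isSubcoalgebra_of_slice fun x hx ξ => ?_
  have : sSup S ≤ (sSup S).comap (slice X ξ ∘ₗ Coalgebra.comul) :=
    sSup_le fun N hN y hy =>
      le_sSup hN (slice_mem_of_isSubcoalgebra (hS N hN) hy ξ)
  exact this hx

theorem isSubcoalgebra_range (f : Y →ₗc[k] X) :
    IsSubcoalgebra k (LinearMap.range f.toLinearMap) := by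
  rintro _ ⟨y, rfl⟩
  refine ⟨TensorProduct.map f.toLinearMap.rangeRestrict f.toLinearMap.rangeRestrict
    (Coalgebra.comul y), ?_⟩
  rw [← LinearMap.comp_apply, ← TensorProduct.map_comp, LinearMap.subtype_comp_codRestrict]
  exact LinearMap.congr_fun f.map_comp_comul y

/-- The iterated contraction of a coassociative coaction. -/
theorem slice_slice_of_isCoassoc {M : Type u} [AddCommGroup M] [Module k M]
    {a : M →ₗ[k] M ⊗[k] X} (ha : IsCoassoc a) (ξ η : Module.Dual k X) (m : M) :
    slice M η (a (slice M ξ (a m))) =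
      slice M (LinearMap.mul' k k ∘ₗ TensorProduct.map η ξ ∘ₗ Coalgebra.comul) (a m) := by
  have h := LinearMap.congr_fun ha m
  simp only [LinearMap.comp_apply, LinearEquiv.coe_coe] at h
  rw [← LinearMap.comp_assoc, ← slice_lTensor, ← h, ← slice_rTensor]
  have hcomp : slice M η ∘ₗ slice (M ⊗[k] X) ξ =
      slice M (LinearMap.mul' k k ∘ₗ TensorProduct.map η ξ) ∘ₗ
        (TensorProduct.assoc k M X X).toLinearMap := by
    ext; simp [smul_smul, mul_comm]
  exact LinearMap.congr_fun hcomp _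

/-- Every element of a cocommutative coalgebra lies in a finite-dimensional subcoalgebra. -/
theorem exists_finiteDimensional_subcoalgebra [Coalgebra.IsCocomm k X] (x : X) :
    ∃ N : Submodule k X, IsSubcoalgebra k N ∧ FiniteDimensional k N ∧ x ∈ N := by
  -- The contractions of `Δ x` form a finite-dimensional space, because `Δ x` is a finite sum of
  -- tensors. It is stable because two successive contractions are one contraction with a
  -- convolution, and it contains `x`, the contraction with the counit.
  refine ⟨slices (Coalgebra.comul (R := k) x), isSubcoalgebra_of_slice ?_,
    finiteDimensional_slices _, mem_slices.2 ⟨Coalgebra.counit, ?_⟩⟩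
  · rintro _ ⟨ξ, rfl⟩ η
    exact mem_slices.2 ⟨_, (slice_slice_of_isCoassoc Coalgebra.coassoc ξ η x).symm⟩
  · rw [slice, LinearMap.comp_apply, Coalgebra.lTensor_counit_comul]
    simp

end Subcoalgebra

/-! ### Coideals and gluing of coalgebra morphisms -/

section Coideal

variable {k : Type u} [Field k]
variable {X Y V : Type u} [AddCommGroup X] [Module k X] [Coalgebra k X]
  [AddCommGroup Y] [Module k Y] [Coalgebra k Y] [AddCommGroup V] [Module k V]

/-- The quotient map by the sum factors through the quotient map by each summand, so the coideal
condition need only be checked on one summand at a time. This makes the largest coideal inside a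
kernel available. -/
theorem isCoideal_sSup {S : Set (Submodule k X)} (hS : ∀ J ∈ S, J.IsCoideal) :
    (sSup S).IsCoideal where
  counit_eq_zero := by
    have : sSup S ≤ LinearMap.ker (Coalgebra.counit (R := k) (A := X)) :=
      sSup_le fun J hJ x hx => (hS J hJ).counit_eq_zero hx
    exact fun x hx => this hx
  map_mkQ_comul_eq_zero := by
    have : sSup S ≤ LinearMap.ker
        (TensorProduct.map (sSup S).mkQ (sSup S).mkQ ∘ₗ Coalgebra.comul) := by
      refine sSup_le fun J hJ x hx => ?_
      rw [LinearMap.mem_ker, LinearMap.comp_apply, ← Submodule.factor_comp_mk (le_sSup hJ),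
        TensorProduct.map_comp, LinearMap.comp_apply, (hS J hJ).map_mkQ_comul_eq_zero hx, map_zero]
    exact fun x hx => this hx

/-- The quotient by the kernel embeds in `Y`, and over a field the tensor square of this embedding
is still injective, so the vanishing can be tested in `Y ⊗ Y`. -/
theorem isCoideal_ker (f : X →ₗc[k] Y) : (LinearMap.ker f.toLinearMap).IsCoideal where
  counit_eq_zero x hx := by
    rw [← f.counit_comp, LinearMap.comp_apply, LinearMap.mem_ker.1 hx, map_zero]
  map_mkQ_comul_eq_zero x hx := by
    set I := LinearMap.ker f.toLinearMap
    have hj : Function.Injective (I.liftQ f.toLinearMap le_rfl) :=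
      LinearMap.ker_eq_bot.1 (Submodule.ker_liftQ_eq_bot _ _ _ le_rfl)
    apply map_injective hj hj
    rw [map_zero, ← LinearMap.comp_apply, ← TensorProduct.map_comp, Submodule.liftQ_mkQ,
      ← LinearMap.comp_apply, f.map_comp_comul, LinearMap.comp_apply, LinearMap.mem_ker.1 hx,
      map_zero]

/-- The image of the difference of two coalgebra morphisms is a coideal. -/
theorem isCoideal_range_sub (f g : Y →ₗc[k] X) :
    (LinearMap.range (f.toLinearMap - g.toLinearMap)).IsCoideal where
  counit_eq_zero := by
    rintro _ ⟨y, rfl⟩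
    rw [LinearMap.sub_apply, map_sub, ← LinearMap.comp_apply, ← LinearMap.comp_apply,
      f.counit_comp, g.counit_comp, sub_self]
  map_mkQ_comul_eq_zero := by
    rintro _ ⟨y, rfl⟩
    set F := f.toLinearMap
    set G := g.toLinearMap
    set I := LinearMap.range (F - G)
    -- After division by the image of `F - G` the two morphisms coincide, and so do their tensor
    -- squares applied to `Δ y`.
    have h0 : I.mkQ ∘ₗ (F - G) = 0 := LinearMap.range_le_ker_iff.1 (by rw [Submodule.ker_mkQ])
    have h1 : I.mkQ ∘ₗ F = I.mkQ ∘ₗ G := by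
      rwa [LinearMap.comp_sub, sub_eq_zero] at h0
    rw [LinearMap.sub_apply, map_sub, map_sub, ← LinearMap.comp_apply Coalgebra.comul,
      ← LinearMap.comp_apply Coalgebra.comul, ← f.map_comp_comul, ← g.map_comp_comul,
      LinearMap.comp_apply, LinearMap.comp_apply, ← LinearMap.comp_apply (TensorProduct.map _ _),
      ← LinearMap.comp_apply (TensorProduct.map I.mkQ I.mkQ) (TensorProduct.map G G),
      ← TensorProduct.map_comp, ← TensorProduct.map_comp, h1, sub_self]

theorem isCocomm_quotient [Coalgebra.IsCocomm k X] (I : Submodule k X) [I.IsCoideal] :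
    Coalgebra.IsCocomm k (X ⧸ I) := by
  refine ⟨Comod.comp_cancel_right I.mkQ_surjective ?_⟩
  have h : (TensorProduct.comm k (X ⧸ I) (X ⧸ I)).toLinearMap ∘ₗ TensorProduct.map I.mkQ I.mkQ =
      TensorProduct.map I.mkQ I.mkQ ∘ₗ (TensorProduct.comm k X X).toLinearMap := by
    ext; simp
  have hcomp : (TensorProduct.comm k X X).toLinearMap ∘ₗ Coalgebra.comul = Coalgebra.comul :=
    Coalgebra.comm_comp_comul k X
  change ((TensorProduct.comm k (X ⧸ I) (X ⧸ I)).toLinearMap ∘ₗ Coalgebra.comul) ∘ₗ I.mkQ = _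
  rw [LinearMap.comp_assoc, Coalgebra.Quotient.comul_comp_mkQ, ← LinearMap.comp_assoc, h,
    LinearMap.comp_assoc, hcomp]

/-- The largest coideal on which a linear map vanishes. -/
def maxCoideal (q : X →ₗ[k] V) : Submodule k X :=
  sSup {J | J.IsCoideal ∧ J ≤ LinearMap.ker q}

instance (q : X →ₗ[k] V) : (maxCoideal q).IsCoideal :=
  isCoideal_sSup fun _ hJ => hJ.1

theorem maxCoideal_le_ker (q : X →ₗ[k] V) : maxCoideal q ≤ LinearMap.ker q :=
  sSup_le fun _ hJ => hJ.2

theorem le_maxCoideal {q : X →ₗ[k] V} {J : Submodule k X} (hJ : J.IsCoideal)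
    (h : J ≤ LinearMap.ker q) : J ≤ maxCoideal q :=
  le_sSup ⟨hJ, h⟩

/-- If no nonzero coideal lies in the kernel of `q`, coalgebra morphisms are determined by their
composite with `q`. -/
theorem coalgHom_ext_of_maxCoideal {q : X →ₗ[k] V} (hq : maxCoideal q = ⊥) {f g : Y →ₗc[k] X}
    (h : q ∘ₗ f.toLinearMap = q ∘ₗ g.toLinearMap) : f = g := by
  have h1 : LinearMap.range (f.toLinearMap - g.toLinearMap) ≤ maxCoideal q :=
    le_maxCoideal (isCoideal_range_sub f g) <| by
      rw [LinearMap.range_le_ker_iff, LinearMap.comp_sub, h, sub_self]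
  rw [hq, le_bot_iff, LinearMap.range_eq_bot, sub_eq_zero] at h1
  exact CoalgHom.ext fun y => LinearMap.congr_fun h1 y

/-- The linear map induced by `q` on the quotient by `maxCoideal q`. -/
noncomputable def maxQuotMap (q : X →ₗ[k] V) : X ⧸ maxCoideal q →ₗ[k] V :=
  (maxCoideal q).liftQ q (maxCoideal_le_ker q)

/-- A coideal of the quotient pulls back to the kernel of a composite of coalgebra morphisms, hence
to a coideal of `X`. If it lies in the kernel of the induced map, its preimage lies in the kernel of
`q` and so in `maxCoideal q`. -/
theorem maxCoideal_maxQuotMap (q : X →ₗ[k] V) : maxCoideal (maxQuotMap q) = ⊥ := by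
  set I := maxCoideal q
  set J := maxCoideal (maxQuotMap q)
  let π := (Coalgebra.Quotient.mkQCoalgHom (R := k) J).comp
    (Coalgebra.Quotient.mkQCoalgHom (R := k) I)
  have hπ : LinearMap.ker π.toLinearMap = J.comap I.mkQ := by
    change LinearMap.ker (J.mkQ ∘ₗ I.mkQ) = _
    rw [LinearMap.ker_comp, Submodule.ker_mkQ]
  have h1 : J.comap I.mkQ ≤ I := by
    rw [← hπ]
    refine le_maxCoideal (isCoideal_ker π) ?_
    rw [hπ]
    intro x hx
    exact maxCoideal_le_ker (maxQuotMap q) hx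
  rw [eq_bot_iff]
  intro x hx
  obtain ⟨x, rfl⟩ := I.mkQ_surjective x
  exact (Submodule.Quotient.mk_eq_zero I).2 (h1 hx)

/-- The inclusion of the first summand as a coalgebra morphism. -/
def inlCoalgHom (X Y : Type u) [AddCommGroup X] [Module k X] [Coalgebra k X]
    [AddCommGroup Y] [Module k Y] [Coalgebra k Y] : X →ₗc[k] X × Y :=
  { LinearMap.inl k X Y with
    counit_comp := Prod.counit_comp_inl k X Y
    map_comp_comul := (Prod.comul_comp_inl k X Y).symm }

/-- The inclusion of the second summand as a coalgebra morphism. -/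
def inrCoalgHom (X Y : Type u) [AddCommGroup X] [Module k X] [Coalgebra k X]
    [AddCommGroup Y] [Module k Y] [Coalgebra k Y] : Y →ₗc[k] X × Y :=
  { LinearMap.inr k X Y with
    counit_comp := Prod.counit_comp_inr k X Y
    map_comp_comul := (Prod.comul_comp_inr k X Y).symm }

/-- If `X` has no nonzero coideals in the kernel of `q`, coalgebra morphisms to `X` can be
constructed locally. -/
theorem exists_coalgHom_of_local {q : X →ₗ[k] V} (hq : maxCoideal q = ⊥) {p : Y →ₗ[k] V}
    (h : ∀ y : Y, ∃ (E : Submodule k Y) (hE : IsSubcoalgebra k E),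
      letI := subCoalgebra hE
      y ∈ E ∧ ∃ g : E →ₗc[k] X, q ∘ₗ g.toLinearMap = p ∘ₗ E.subtype) :
    ∃ g : Y →ₗc[k] X, q ∘ₗ g.toLinearMap = p := by
  -- Gluing without choosing compatible local morphisms: in the direct sum coalgebra `Y × X`, divide
  -- by the largest coideal killed by `p + q`. The copy of `X` maps isomorphically onto the
  -- quotient, and the copy of `Y` then maps to `X`.
  let Q : Y × X →ₗ[k] V := p.coprod q
  let J := maxCoideal Q
  let π := Coalgebra.Quotient.mkQCoalgHom (R := k) J
  let s : X →ₗc[k] (Y × X) ⧸ J := π.comp (inrCoalgHom Y X)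
  have hQ : maxQuotMap Q ∘ₗ s.toLinearMap = q := by
    ext x
    change p 0 + q x = q x
    rw [map_zero, zero_add]
  have hinj : Function.Injective s.toLinearMap := by
    rw [← LinearMap.ker_eq_bot, ← le_bot_iff, ← hq]
    refine le_maxCoideal (isCoideal_ker s) fun x hx => ?_
    rw [LinearMap.mem_ker, ← hQ, LinearMap.comp_apply, LinearMap.mem_ker.1 hx, map_zero]
  have hloc : ∀ y : Y, ∃ x : X, (y, -x) ∈ J := by
    intro y
    obtain ⟨E, hE, hy, g, hg⟩ := h y
    let _ := subCoalgebra hE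
    -- On `E` the inclusion into `Y` and the local morphism `g` into `X` have the same composite to
    -- `V`. The image of their difference is a coideal in the kernel of `Q`, so `y` and `g y` are
    -- identified in the quotient.
    have h1 := le_maxCoideal (q := Q) (isCoideal_range_sub
      ((inlCoalgHom Y X).comp (subCoalgHom hE)) ((inrCoalgHom Y X).comp g)) (by
        rw [LinearMap.range_le_ker_iff]
        ext e
        have := LinearMap.congr_fun hg e
        change p ((e : Y) - 0) + q (0 - g e) = 0
        rw [sub_zero, zero_sub, map_neg]
        exact add_neg_eq_zero.2 this.symm)
    refine ⟨g ⟨y, hy⟩, h1 ⟨⟨y, hy⟩, ?_⟩⟩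
    change ((y : Y) - 0, 0 - g ⟨y, hy⟩) = _
    rw [sub_zero, zero_sub]
  have hsurj : Function.Surjective s.toLinearMap := by
    intro z
    obtain ⟨⟨y, x⟩, rfl⟩ := J.mkQ_surjective z
    obtain ⟨x', hx'⟩ := hloc y
    refine ⟨x + x', ?_⟩
    change J.mkQ (0, x + x') = J.mkQ (y, x)
    rw [eq_comm, ← sub_eq_zero, ← map_sub]
    refine (Submodule.Quotient.mk_eq_zero J).2 ?_
    simpa using hx'
  let e := CoalgEquiv.ofBijective (f := s) ⟨hinj, hsurj⟩
  refine ⟨(e.symm : _ →ₗc[k] X).comp (π.comp (inlCoalgHom Y X)), ?_⟩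
  ext y
  have h1 : q (e.symm (π (y, 0))) = maxQuotMap Q (s (e.symm (π (y, 0)))) :=
    (LinearMap.congr_fun hQ _).symm
  have h2 : s (e.symm (π (y, 0))) = π (y, 0) := e.apply_symm_apply _
  change q (e.symm (π (y, 0))) = p y
  rw [h1, h2]
  change p y + q 0 = p y
  rw [map_zero, add_zero]

end Coideal

/-! ### Cofree cocommutative coalgebras -/

section Cofree

variable (k : Type u) [Field k] (V : Type u) [AddCommGroup V] [Module k V]

/-- A cocommutative coalgebra structure on `k ^ n`, with a linear map to `V`. -/
structure FinCoalg where
  /-- the dimension -/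
  n : ℕ
  /-- the coalgebra structure -/
  coalgebra : Coalgebra k (Fin n → k)
  cocomm : Coalgebra.IsCocomm k (Fin n → k)
  /-- the linear map to `V` -/
  lin : (Fin n → k) →ₗ[k] V

variable {k V}

/-- The underlying space of a `FinCoalg`. -/
def FinCoalg.carrier (s : FinCoalg k V) : Type u := Fin s.n → k

noncomputable instance (s : FinCoalg k V) : AddCommGroup s.carrier :=
  inferInstanceAs (AddCommGroup (Fin s.n → k))

noncomputable instance (s : FinCoalg k V) : Module k s.carrier :=
  inferInstanceAs (Module k (Fin s.n → k))

noncomputable instance (s : FinCoalg k V) : Coalgebra k s.carrier := s.coalgebra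

instance (s : FinCoalg k V) : Coalgebra.IsCocomm k s.carrier := s.cocomm

/-- The linear map to `V` of a `FinCoalg`. -/
def FinCoalg.toMap (s : FinCoalg k V) : s.carrier →ₗ[k] V := s.lin

/-- Transport of structure along a basis. Restricting to the spaces `k ^ n` makes the family of
finite-dimensional coalgebras over `V` indexed by a type in the universe `u`, so that its direct sum
stays in `Type u`. -/
theorem exists_finCoalg (E : Type u) [AddCommGroup E] [Module k E] [Coalgebra k E]
    [Coalgebra.IsCocomm k E] [FiniteDimensional k E] (p : E →ₗ[k] V) :
    ∃ (s : FinCoalg k V) (g : E →ₗc[k] s.carrier), s.toMap ∘ₗ g.toLinearMap = p := by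
  let e : E ≃ₗ[k] (Fin (Module.finrank k E) → k) := (Module.finBasis k E).equivFun
  let Δ := TensorProduct.map e.toLinearMap e.toLinearMap ∘ₗ Coalgebra.comul ∘ₗ e.symm.toLinearMap
  have h : TensorProduct.map e.symm.toLinearMap e.symm.toLinearMap ∘ₗ Δ =
      Coalgebra.comul ∘ₗ e.symm.toLinearMap := by
    rw [← LinearMap.comp_assoc, ← TensorProduct.map_comp, LinearEquiv.symm_comp,
      TensorProduct.map_id, LinearMap.id_comp]
  let c : Coalgebra k (Fin (Module.finrank k E) → k) :=
    coalgebraOfInjective e.symm.toLinearMap e.symm.injective Δ h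
  let j : @CoalgHom k (Fin (Module.finrank k E) → k) E _ _ _ _ _ c.toCoalgebraStruct _ :=
    @CoalgHom.mk k _ E _ _ _ _ _ c.toCoalgebraStruct _ e.symm.toLinearMap rfl h
  have hc := @isCocomm_of_injective k _ E _ _ _ (Fin (Module.finrank k E) → k) _ _ c _ j
    e.symm.injective
  let s : FinCoalg k V := ⟨_, c, hc, p ∘ₗ e.symm.toLinearMap⟩
  refine ⟨s, @CoalgHom.mk k E s.carrier _ _ _ _ _ _ _ e.toLinearMap ?_ ?_, ?_⟩
  · change (Coalgebra.counit ∘ₗ e.symm.toLinearMap) ∘ₗ e.toLinearMap = _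
    rw [LinearMap.comp_assoc, LinearEquiv.symm_comp, LinearMap.comp_id]
  · change _ = Δ ∘ₗ e.toLinearMap
    rw [LinearMap.comp_assoc, LinearMap.comp_assoc, LinearEquiv.symm_comp, LinearMap.comp_id]
    rfl
  · change (p ∘ₗ e.symm.toLinearMap) ∘ₗ e.toLinearMap = _
    rw [LinearMap.comp_assoc, LinearEquiv.symm_comp, LinearMap.comp_id]

/-- The cofree cocommutative coalgebra on a vector space. -/
theorem exists_cofree (k : Type u) [Field k] (V : Type u) [AddCommGroup V] [Module k V] :
    ∃ (F : Type u) (_ : AddCommGroup F) (_ : Module k F) (_ : Coalgebra k F)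
      (_ : Coalgebra.IsCocomm k F) (q : F →ₗ[k] V),
      (∀ (D : Type u) [AddCommGroup D] [Module k D] [Coalgebra k D] [Coalgebra.IsCocomm k D]
        (p : D →ₗ[k] V), ∃ g : D →ₗc[k] F, q ∘ₗ g.toLinearMap = p) ∧
      (∀ (D : Type u) [AddCommGroup D] [Module k D] [Coalgebra k D]
        (f g : D →ₗc[k] F), q ∘ₗ f.toLinearMap = q ∘ₗ g.toLinearMap → f = g) := by
  classical
  -- This sum receives a morphism over `V` from every finite-dimensional cocommutative coalgebra
  -- over `V`, but such morphisms are not unique. Division by `maxCoideal q` enforces uniqueness.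
  let X := Π₀ s : FinCoalg k V, s.carrier
  let q : X →ₗ[k] V := DFinsupp.lsum k fun s => s.toMap
  let F := X ⧸ maxCoideal q
  have hF : maxCoideal (maxQuotMap q) = ⊥ := maxCoideal_maxQuotMap q
  refine ⟨F, inferInstance, inferInstance, inferInstance, isCocomm_quotient _, maxQuotMap q,
    ?_, ?_⟩
  · intro D _ _ _ _ p
    refine exists_coalgHom_of_local hF fun y => ?_
    -- Since morphisms into `F` can be built locally, a finite-dimensional subcoalgebra around each
    -- `y` is enough, and it is isomorphic to one of the summands.
    obtain ⟨E, hE, _, hy⟩ := exists_finiteDimensional_subcoalgebra (k := k) y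
    let _ := subCoalgebra hE
    have := subCoalgebra_isCocomm hE
    obtain ⟨s, g, hg⟩ := exists_finCoalg (k := k) E (p ∘ₗ E.subtype)
    let i : s.carrier →ₗc[k] X :=
      { DFinsupp.lsingle s with
        counit_comp := DFinsupp.counit_comp_lsingle k _ _ s
        map_comp_comul := (DFinsupp.comul_comp_lsingle k _ _ s).symm }
    refine ⟨E, hE, hy, ((Coalgebra.Quotient.mkQCoalgHom (R := k) (maxCoideal q)).comp i).comp g, ?_⟩
    rw [← hg]
    ext x
    change DFinsupp.lsum k (fun s : FinCoalg k V => s.toMap) (DFinsupp.single s (g x)) =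
      s.toMap (g x)
    rw [DFinsupp.lsum_apply_apply, DFinsupp.sumAddHom_single]
    rfl
  · intro D _ _ _ f g h
    exact coalgHom_ext_of_maxCoideal hF h

end Cofree

/-! ### Equalizers of linear maps on a cocommutative coalgebra -/

section Equalizer

variable {k : Type u} [Field k]
variable {X Y Z : Type u} [AddCommGroup X] [Module k X] [Coalgebra k X]
  [AddCommGroup Y] [Module k Y] [AddCommGroup Z] [Module k Z] [Coalgebra k Z]

theorem lTensor_rTensor_apply {M M' P P' : Type u} [AddCommGroup M] [Module k M] [AddCommGroup M']
    [Module k M'] [AddCommGroup P] [Module k P] [AddCommGroup P'] [Module k P']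
    (f : M →ₗ[k] M') (g : P →ₗ[k] P') (z : M ⊗[k] P) :
    g.lTensor M' (f.rTensor P z) = f.rTensor P' (g.lTensor M z) := by
  rw [← LinearMap.comp_apply, ← LinearMap.comp_apply, LinearMap.lTensor_comp_rTensor,
    LinearMap.rTensor_comp_lTensor]

theorem convolution_comm [Coalgebra.IsCocomm k X] (ξ η : Module.Dual k X) :
    LinearMap.mul' k k ∘ₗ TensorProduct.map ξ η ∘ₗ Coalgebra.comul =
      LinearMap.mul' k k ∘ₗ TensorProduct.map η ξ ∘ₗ Coalgebra.comul := by
  have h : LinearMap.mul' k k ∘ₗ TensorProduct.map ξ η =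
      (LinearMap.mul' k k ∘ₗ TensorProduct.map η ξ) ∘ₗ
        (TensorProduct.comm k X X).toLinearMap := by
    ext; simp [mul_comm]
  have h' : (TensorProduct.comm k X X).toLinearMap ∘ₗ Coalgebra.comul = Coalgebra.comul :=
    Coalgebra.comm_comp_comul k X
  rw [← LinearMap.comp_assoc, h, LinearMap.comp_assoc, h', LinearMap.comp_assoc]

/-- Over a cocommutative coalgebra, the contractions of a coaction are colinear. -/
theorem rTensor_slice_comp [Coalgebra.IsCocomm k X] {a : Y →ₗ[k] Y ⊗[k] X} (ha : IsCoassoc a)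
    (ξ : Module.Dual k X) (y : Y) :
    (slice Y ξ ∘ₗ a).rTensor X (a y) = a (slice Y ξ (a y)) := by
  refine eq_of_slice fun η => ?_
  rw [slice_rTensor, LinearMap.comp_apply, slice_slice_of_isCoassoc ha,
    slice_slice_of_isCoassoc ha, convolution_comm]

/-- The equalizer of two maps of coalgebras, as a subspace. -/
noncomputable def coeq (α β : X →ₗ[k] Y) : Submodule k X :=
  LinearMap.eqLocus (α.lTensor X ∘ₗ Coalgebra.comul) (β.lTensor X ∘ₗ Coalgebra.comul)

theorem mem_coeq {α β : X →ₗ[k] Y} {x : X} : x ∈ coeq α β ↔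
    α.lTensor X (Coalgebra.comul x) = β.lTensor X (Coalgebra.comul x) := Iff.rfl

/-- The contraction operators are colinear by cocommutativity, so under `Δ` they act on the left
tensor factor alone and commute with `α` and `β` on the right factor. The defining equation is
therefore preserved. -/
theorem isSubcoalgebra_coeq [Coalgebra.IsCocomm k X] (α β : X →ₗ[k] Y) :
    IsSubcoalgebra k (coeq α β) := by
  refine isSubcoalgebra_of_slice fun x hx ξ => ?_
  rw [mem_coeq] at hx ⊢
  rw [← rTensor_slice_comp Coalgebra.coassoc, lTensor_rTensor_apply, lTensor_rTensor_apply, hx]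

/-- Apply the counit to the left factor of the defining equation. -/
theorem eq_of_mem_coeq {α β : X →ₗ[k] Y} {x : X} (hx : x ∈ coeq α β) : α x = β x := by
  have h := congrArg (fun z => TensorProduct.lid k Y ((Coalgebra.counit (R := k)).rTensor Y z))
    (mem_coeq.1 hx)
  simpa only [← lTensor_rTensor_apply, Coalgebra.rTensor_counit_comul, LinearMap.lTensor_tmul,
    TensorProduct.lid_tmul, one_smul] using h

/-- With the two preceding results this makes `coeq α β` the largest subcoalgebra on which `α` and
`β` agree; it is the universal property used for products. -/
theorem mem_coeq_of_comp {α β : X →ₗ[k] Y} (f : Z →ₗc[k] X)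
    (h : α ∘ₗ f.toLinearMap = β ∘ₗ f.toLinearMap) (z : Z) : f z ∈ coeq α β := by
  have hf : Coalgebra.comul (f z) = TensorProduct.map f.toLinearMap f.toLinearMap
      (Coalgebra.comul z) := (LinearMap.congr_fun f.map_comp_comul z).symm
  rw [mem_coeq, hf, ← LinearMap.comp_apply, LinearMap.lTensor_comp_map, h,
    ← LinearMap.lTensor_comp_map, LinearMap.comp_apply]

end Equalizer

/-! ### The tensor product as a product of coalgebras -/

section TensorCoalgebra

variable (k : Type u) [Field k] (D E : Type u) [AddCommGroup D] [Module k D] [Coalgebra k D]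
  [AddCommGroup E] [Module k E] [Coalgebra k E]

/-- The projection of the tensor product of coalgebras to the first factor. -/
noncomputable def tensorFst : D ⊗[k] E →ₗc[k] D :=
  (Coalgebra.TensorProduct.rid k k D : D ⊗[k] k →ₗc[k] D).comp
    (Coalgebra.TensorProduct.map (CoalgHom.id k D) (Coalgebra.counitCoalgHom k E))

/-- The projection of the tensor product of coalgebras to the second factor. -/
noncomputable def tensorSnd : D ⊗[k] E →ₗc[k] E :=
  (Coalgebra.TensorProduct.lid k E : k ⊗[k] E →ₗc[k] E).comp
    (Coalgebra.TensorProduct.map (Coalgebra.counitCoalgHom k D) (CoalgHom.id k E))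

variable {k D E}

@[simp] theorem tensorFst_tmul (d : D) (e : E) :
    tensorFst k D E (d ⊗ₜ e) = Coalgebra.counit (R := k) e • d := rfl

@[simp] theorem tensorSnd_tmul (d : D) (e : E) :
    tensorSnd k D E (d ⊗ₜ e) = Coalgebra.counit (R := k) d • e := rfl

/-- The second component of `Δ_E` is absorbed by the counit. Together with its counterpart for
`tensorSnd`, this turns the equation defining a product in `Coalg C` into the one defining the
cotensor product. -/
theorem lTensor_tensorFst_comul :
    (tensorFst k D E).toLinearMap.lTensor (D ⊗[k] E) ∘ₗ Coalgebra.comul =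
      actL (Coalgebra.comul (R := k) (A := D)) E := by
  ext d e
  have h : ∀ (z : D ⊗[k] D) (w : E ⊗[k] E), (tensorFst k D E).toLinearMap.lTensor (D ⊗[k] E)
      (TensorProduct.AlgebraTensorModule.tensorTensorTensorComm k k k k D D E E (z ⊗ₜ w)) =
      TensorProduct.rightComm k D D E (z ⊗ₜ slice E Coalgebra.counit w) := by
    intro z w
    induction z using TensorProduct.induction_on with
    | zero => simp
    | add x y hx hy => simp only [TensorProduct.add_tmul, map_add, hx, hy]
    | tmul d d' =>
      induction w using TensorProduct.induction_on with
      | zero => simp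
      | add x y hx hy => simp only [TensorProduct.tmul_add, map_add, hx, hy]
      | tmul e e' =>
        change (d ⊗ₜ e) ⊗ₜ (Coalgebra.counit (R := k) e' • d') =
          TensorProduct.rightComm k D D E ((d ⊗ₜ d') ⊗ₜ slice E Coalgebra.counit (e ⊗ₜ e'))
        rw [slice_tmul]
        simp
  refine (h _ _).trans ?_
  have h' : slice E Coalgebra.counit (Coalgebra.comul (R := k) e) = e := by
    rw [slice, LinearMap.comp_apply, Coalgebra.lTensor_counit_comul]
    simp
  rw [h']
  rfl

theorem lTensor_tensorSnd_comul :
    (tensorSnd k D E).toLinearMap.lTensor (D ⊗[k] E) ∘ₗ Coalgebra.comul =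
      actR D (Coalgebra.comul (R := k) (A := E)) := by
  ext d e
  have h : ∀ (z : D ⊗[k] D) (w : E ⊗[k] E), (tensorSnd k D E).toLinearMap.lTensor (D ⊗[k] E)
      (TensorProduct.AlgebraTensorModule.tensorTensorTensorComm k k k k D D E E (z ⊗ₜ w)) =
      (TensorProduct.assoc k D E E).symm (slice D Coalgebra.counit z ⊗ₜ w) := by
    intro z w
    induction z using TensorProduct.induction_on with
    | zero => simp
    | add x y hx hy => simp only [TensorProduct.add_tmul, map_add, hx, hy]
    | tmul d d' =>
      induction w using TensorProduct.induction_on with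
      | zero => simp
      | add x y hx hy => simp only [TensorProduct.tmul_add, map_add, hx, hy]
      | tmul e e' =>
        change (d ⊗ₜ e) ⊗ₜ (Coalgebra.counit (R := k) d' • e') =
          (TensorProduct.assoc k D E E).symm (slice D Coalgebra.counit (d ⊗ₜ d') ⊗ₜ (e ⊗ₜ e'))
        rw [slice_tmul]
        rw [TensorProduct.assoc_symm_tmul, TensorProduct.tmul_smul, TensorProduct.smul_tmul',
          TensorProduct.smul_tmul']
  refine (h _ _).trans ?_
  have h' : slice D Coalgebra.counit (Coalgebra.comul (R := k) d) = d := by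
    rw [slice, LinearMap.comp_apply, Coalgebra.lTensor_counit_comul]
    simp
  rw [h']
  rfl

/-- An element of `D ⊗ E` is recovered from its two projections via `Δ`. This yields uniqueness of
morphisms into the product and also shows that the comparison map of `U` is the identity on
underlying spaces. -/
theorem map_tensorFst_tensorSnd_comul :
    TensorProduct.map (tensorFst k D E).toLinearMap (tensorSnd k D E).toLinearMap ∘ₗ
      Coalgebra.comul = LinearMap.id := by
  rw [← LinearMap.rTensor_comp_lTensor, LinearMap.comp_assoc, lTensor_tensorSnd_comul]
  ext d e
  have h : ∀ w : E ⊗[k] E, (tensorFst k D E).toLinearMap.rTensor E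
      ((TensorProduct.assoc k D E E).symm (d ⊗ₜ w)) =
      d ⊗ₜ TensorProduct.lid k E ((Coalgebra.counit (R := k)).rTensor E w) := by
    intro w
    induction w using TensorProduct.induction_on with
    | zero => simp
    | add x y hx hy => simp only [TensorProduct.tmul_add, map_add, hx, hy]
    | tmul e e' =>
      change (Coalgebra.counit (R := k) e • d) ⊗ₜ e' = _
      simp [TensorProduct.smul_tmul]
  refine (h _).trans ?_
  rw [Coalgebra.rTensor_counit_comul]
  simp

variable {X : Type u} [AddCommGroup X] [Module k X] [Coalgebra k X]

/-- The coalgebra morphism to a tensor product induced by morphisms to both factors. -/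
noncomputable def tensorPair [Coalgebra.IsCocomm k X] (f : X →ₗc[k] D) (g : X →ₗc[k] E) :
    X →ₗc[k] D ⊗[k] E :=
  (Coalgebra.TensorProduct.map f g).comp (Coalgebra.comulCoalgHom k X)

theorem tensorPair_toLinearMap [Coalgebra.IsCocomm k X] (f : X →ₗc[k] D) (g : X →ₗc[k] E) :
    (tensorPair f g).toLinearMap =
      TensorProduct.map f.toLinearMap g.toLinearMap ∘ₗ Coalgebra.comul := rfl

theorem tensorFst_tensorPair [Coalgebra.IsCocomm k X] (f : X →ₗc[k] D) (g : X →ₗc[k] E) :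
    (tensorFst k D E).toLinearMap ∘ₗ (tensorPair f g).toLinearMap = f.toLinearMap := by
  have h : (tensorFst k D E).toLinearMap ∘ₗ TensorProduct.map f.toLinearMap g.toLinearMap =
      f.toLinearMap ∘ₗ slice X Coalgebra.counit := by
    ext; simp
  rw [tensorPair_toLinearMap, ← LinearMap.comp_assoc, h]
  ext x
  simp [slice]

theorem tensorSnd_tensorPair [Coalgebra.IsCocomm k X] (f : X →ₗc[k] D) (g : X →ₗc[k] E) :
    (tensorSnd k D E).toLinearMap ∘ₗ (tensorPair f g).toLinearMap = g.toLinearMap := by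
  have h : (tensorSnd k D E).toLinearMap ∘ₗ TensorProduct.map f.toLinearMap g.toLinearMap =
      g.toLinearMap ∘ₗ (TensorProduct.lid k X).toLinearMap ∘ₗ
        (Coalgebra.counit (R := k)).rTensor X := by
    ext; simp
  rw [tensorPair_toLinearMap, ← LinearMap.comp_assoc, h]
  ext x
  simp

theorem tensor_hom_ext {f g : X →ₗc[k] D ⊗[k] E}
    (h₁ : (tensorFst k D E).toLinearMap ∘ₗ f.toLinearMap =
      (tensorFst k D E).toLinearMap ∘ₗ g.toLinearMap)
    (h₂ : (tensorSnd k D E).toLinearMap ∘ₗ f.toLinearMap =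
      (tensorSnd k D E).toLinearMap ∘ₗ g.toLinearMap) : f.toLinearMap = g.toLinearMap := by
  rw [← LinearMap.id_comp f.toLinearMap, ← LinearMap.id_comp g.toLinearMap,
    ← map_tensorFst_tensorSnd_comul, LinearMap.comp_assoc, LinearMap.comp_assoc,
    ← f.map_comp_comul, ← g.map_comp_comul, ← LinearMap.comp_assoc, ← LinearMap.comp_assoc,
    ← TensorProduct.map_comp, ← TensorProduct.map_comp, h₁, h₂]

end TensorCoalgebra

/-! ### Change of coefficients in coactions; isomorphisms of comodules -/

section Act

variable {k : Type u} [Field k]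

theorem lTensor_comp_actL {M N C C' : Type u} [AddCommGroup M] [Module k M] [AddCommGroup N]
    [Module k N] [AddCommGroup C] [Module k C] [AddCommGroup C'] [Module k C'] (f : C' →ₗ[k] C)
    (a : M →ₗ[k] M ⊗[k] C') :
    f.lTensor (M ⊗[k] N) ∘ₗ actL a N = actL (f.lTensor M ∘ₗ a) N := by
  have h : f.lTensor (M ⊗[k] N) ∘ₗ (TensorProduct.rightComm k M C' N).toLinearMap =
      (TensorProduct.rightComm k M C N).toLinearMap ∘ₗ (f.lTensor M).rTensor N := by
    ext; simp
  rw [actL, actL, LinearMap.rTensor_comp, ← LinearMap.comp_assoc, h, LinearMap.comp_assoc]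

theorem lTensor_comp_actR {M N C C' : Type u} [AddCommGroup M] [Module k M] [AddCommGroup N]
    [Module k N] [AddCommGroup C] [Module k C] [AddCommGroup C'] [Module k C'] (f : C' →ₗ[k] C)
    (a : N →ₗ[k] N ⊗[k] C') :
    f.lTensor (M ⊗[k] N) ∘ₗ actR M a = actR M (f.lTensor N ∘ₗ a) := by
  have h : f.lTensor (M ⊗[k] N) ∘ₗ (TensorProduct.assoc k M N C').symm.toLinearMap =
      (TensorProduct.assoc k M N C).symm.toLinearMap ∘ₗ (f.lTensor N).lTensor M := by
    apply Comod.comp_cancel_right (TensorProduct.assoc k M N C').surjective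
    ext; simp
  rw [actR, actR, LinearMap.lTensor_comp, ← LinearMap.comp_assoc, h, LinearMap.comp_assoc]

theorem Comod.isIso_of_bijective {k : Type u} [Field k] {C : Type u} [AddCommGroup C]
    [Module k C] [Coalgebra k C] {V W : Comod k C} (f : V ⟶ W) (hf : Function.Bijective f.lin) :
    IsIso f := by
  let e := LinearEquiv.ofBijective f.lin hf
  have he : e.toLinearMap = f.lin := rfl
  refine ⟨⟨e.symm.toLinearMap, ?_⟩, ?_, ?_⟩
  · apply comp_cancel_right e.surjective
    rw [he, LinearMap.comp_assoc, LinearMap.comp_assoc, ← f.colinear, ← LinearMap.comp_assoc,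
      ← LinearMap.rTensor_comp, ← he, LinearEquiv.symm_comp, LinearMap.rTensor_id,
      LinearMap.id_comp, LinearMap.comp_id]
  · exact Comod.hom_ext (LinearEquiv.symm_comp e)
  · exact Comod.hom_ext (LinearEquiv.comp_symm e)

end Act

/-! ### Finite products in `Coalg C` -/

section Products

variable {k : Type u} [Field k] {C : Type u} [AddCommGroup C] [Module k C] [Coalgebra k C]
  [Coalgebra.IsCocomm k C]

namespace CoalgOver

instance (φ : CoalgOver k C) : Coalgebra.IsCocomm k φ.left.obj := φ.left.property

/-- The object of `Coalg C` given by a coalgebra morphism. -/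
def ofCoalgHom {D : Type u} [AddCommGroup D] [Module k D] [Coalgebra k D]
    [Coalgebra.IsCocomm k D] (f : D →ₗc[k] C) : CoalgOver k C :=
  Over.mk (Y := Coalg.of k D) (ObjectProperty.homMk (CoalgCat.ofHom f))

/-- The morphism of `Coalg C` given by a coalgebra morphism over `C`. -/
def homMk {φ ψ : CoalgOver k C} (f : φ.left.obj →ₗc[k] ψ.left.obj)
    (h : ψ.str.toLinearMap ∘ₗ f.toLinearMap = φ.str.toLinearMap) : φ ⟶ ψ :=
  Over.homMk (ObjectProperty.homMk (CoalgCat.ofHom f)) <| by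
    apply ObjectProperty.hom_ext
    apply CoalgCat.hom_ext
    exact CoalgHom.ext fun x => LinearMap.congr_fun h x

theorem hom_ext {φ ψ : CoalgOver k C} {f g : φ ⟶ ψ}
    (h : (toCoalgHom f).toLinearMap = (toCoalgHom g).toLinearMap) : f = g := by
  apply Over.OverMorphism.ext
  apply ObjectProperty.hom_ext
  apply CoalgCat.hom_ext
  exact CoalgHom.ext fun x => LinearMap.congr_fun h x

/-- The underlying subspace of a product in `Coalg C`. -/
noncomputable def prodSpace (φ ψ : CoalgOver k C) :
    Submodule k (φ.left.obj ⊗[k] ψ.left.obj) :=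
  coeq (φ.str.toLinearMap ∘ₗ (tensorFst k φ.left.obj ψ.left.obj).toLinearMap)
    (ψ.str.toLinearMap ∘ₗ (tensorSnd k φ.left.obj ψ.left.obj).toLinearMap)

theorem isSubcoalgebra_prodSpace (φ ψ : CoalgOver k C) : IsSubcoalgebra k (prodSpace φ ψ) :=
  isSubcoalgebra_coeq _ _

noncomputable instance (φ ψ : CoalgOver k C) : Coalgebra k (prodSpace φ ψ) :=
  subCoalgebra (isSubcoalgebra_prodSpace φ ψ)

instance (φ ψ : CoalgOver k C) : Coalgebra.IsCocomm k (prodSpace φ ψ) :=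
  subCoalgebra_isCocomm (isSubcoalgebra_prodSpace φ ψ)

/-- The inclusion of the product in the tensor product. -/
noncomputable def prodIncl (φ ψ : CoalgOver k C) :
    prodSpace φ ψ →ₗc[k] φ.left.obj ⊗[k] ψ.left.obj :=
  subCoalgHom (isSubcoalgebra_prodSpace φ ψ)

/-- The product in `Coalg C`. -/
noncomputable def prod (φ ψ : CoalgOver k C) : CoalgOver k C :=
  ofCoalgHom (φ.str.comp ((tensorFst k φ.left.obj ψ.left.obj).comp (prodIncl φ ψ)))

/-- The first projection. -/
noncomputable def prodFst (φ ψ : CoalgOver k C) : prod φ ψ ⟶ φ :=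
  homMk ((tensorFst k φ.left.obj ψ.left.obj).comp (prodIncl φ ψ)) rfl

/-- The second projection. -/
noncomputable def prodSnd (φ ψ : CoalgOver k C) : prod φ ψ ⟶ ψ :=
  homMk ((tensorSnd k φ.left.obj ψ.left.obj).comp (prodIncl φ ψ)) <|
    LinearMap.ext fun x => (eq_of_mem_coeq x.2).symm

/-- The morphism to a product induced by two morphisms. -/
noncomputable def prodLift {χ φ ψ : CoalgOver k C} (f : χ ⟶ φ) (g : χ ⟶ ψ) : χ ⟶ prod φ ψ :=
  homMk (subCoalgLift (isSubcoalgebra_prodSpace φ ψ)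
    (tensorPair (toCoalgHom f) (toCoalgHom g)) <| mem_coeq_of_comp _ <| by
      rw [LinearMap.comp_assoc, LinearMap.comp_assoc, tensorFst_tensorPair, tensorSnd_tensorPair,
        CoalgOver.w, CoalgOver.w]) <| by
    refine Eq.trans ?_ (CoalgOver.w f)
    exact congrArg (φ.str.toLinearMap ∘ₗ ·) (tensorFst_tensorPair (toCoalgHom f) (toCoalgHom g))

/-- `prod φ ψ` is the product of `φ` and `ψ` in `Coalg C`. -/
noncomputable def prodIsLimit (φ ψ : CoalgOver k C) :
    Limits.IsLimit (Limits.BinaryFan.mk (prodFst φ ψ) (prodSnd φ ψ)) :=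
  Limits.BinaryFan.IsLimit.mk _ (fun f g => prodLift f g)
    (fun f g => hom_ext (tensorFst_tensorPair (toCoalgHom f) (toCoalgHom g)))
    (fun f g => hom_ext (tensorSnd_tensorPair (toCoalgHom f) (toCoalgHom g)))
    (fun f g m hf hg => by
      apply hom_ext
      apply Comod.comp_cancel (prodSpace φ ψ).injective_subtype
      refine tensor_hom_ext (f := (prodIncl φ ψ).comp (toCoalgHom m))
        (g := tensorPair (toCoalgHom f) (toCoalgHom g)) ?_ ?_
      · rw [tensorFst_tensorPair, ← hf]
        rfl
      · rw [tensorSnd_tensorPair, ← hg]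
        rfl)

noncomputable instance : CartesianMonoidalCategory (CoalgOver k C) :=
  .ofChosenFiniteProducts ⟨_, Over.mkIdTerminal⟩ fun φ ψ => ⟨_, prodIsLimit φ ψ⟩

end CoalgOver

end Products

/-! ### Strong monoidality of `U` -/

section Oplax

variable {k : Type u} [Field k] {C : Type u} [AddCommGroup C] [Module k C] [Coalgebra k C]
  [Coalgebra.IsCocomm k C]

open Comod CoalgOver SemiCartesianMonoidalCategory CartesianMonoidalCategory

/-- Composing the comultiplication of `D ⊗ E` with either projection gives the comultiplication of
one factor. Following it by the structure map to `C` gives one of the two coactions whose equalizer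
is the cotensor product. -/
theorem cotensorSpace_U (φ ψ : CoalgOver k C) :
    cotensorSpace ((U k C).obj φ) ((U k C).obj ψ) = prodSpace φ ψ := by
  rw [cotensorSpace_eq, prodSpace, coeq, LinearMap.lTensor_comp, LinearMap.lTensor_comp,
    LinearMap.comp_assoc, LinearMap.comp_assoc, lTensor_tensorFst_comul, lTensor_tensorSnd_comul,
    lTensor_comp_actL, lTensor_comp_actR]
  rfl

section Diagonal

variable {D : Type u} [AddCommGroup D] [Module k D] [Coalgebra k D]

theorem comul_rTensor_comul :
    (Coalgebra.comul (R := k) (A := D)).rTensor D ∘ₗ Coalgebra.comul =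
      actR D (Coalgebra.comul (R := k) (A := D)) ∘ₗ Coalgebra.comul := by
  rw [actR, LinearMap.comp_assoc, ← Coalgebra.coassoc, ← LinearMap.comp_assoc,
    LinearEquiv.symm_comp, LinearMap.id_comp]

theorem comul_rTensor_comul' [Coalgebra.IsCocomm k D] :
    (Coalgebra.comul (R := k) (A := D)).rTensor D ∘ₗ Coalgebra.comul =
      actL (Coalgebra.comul (R := k) (A := D)) D ∘ₗ Coalgebra.comul :=
  coact_actL (Comod.unit k D)

end Diagonal

/-- The comultiplication of `D` as a morphism `U D ⟶ U D ⊗^C U D`. -/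
noncomputable def diagU (φ : CoalgOver k C) :
    (U k C).obj φ ⟶ (U k C).obj φ ⊗ (U k C).obj φ :=
  Comod.lift (Coalgebra.comul (R := k) (A := φ.left.obj))
    (by
      change (Coalgebra.comul (R := k) (A := φ.left.obj)).rTensor C ∘ₗ
          (φ.str.toLinearMap.lTensor φ.left.obj ∘ₗ Coalgebra.comul) =
        actL (φ.str.toLinearMap.lTensor φ.left.obj ∘ₗ Coalgebra.comul) φ.left.obj ∘ₗ Coalgebra.comul
      rw [← LinearMap.comp_assoc, LinearMap.rTensor_comp_lTensor,
        ← LinearMap.lTensor_comp_rTensor, LinearMap.comp_assoc, comul_rTensor_comul',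
        ← LinearMap.comp_assoc, lTensor_comp_actL])
    (by
      change (Coalgebra.comul (R := k) (A := φ.left.obj)).rTensor C ∘ₗ
          (φ.str.toLinearMap.lTensor φ.left.obj ∘ₗ Coalgebra.comul) =
        actR φ.left.obj (φ.str.toLinearMap.lTensor φ.left.obj ∘ₗ Coalgebra.comul) ∘ₗ Coalgebra.comul
      rw [← LinearMap.comp_assoc, LinearMap.rTensor_comp_lTensor,
        ← LinearMap.lTensor_comp_rTensor, LinearMap.comp_assoc, comul_rTensor_comul,
        ← LinearMap.comp_assoc, lTensor_comp_actR])

theorem diagU_natural {φ ψ : CoalgOver k C} (f : φ ⟶ ψ) :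
    (U k C).map f ≫ diagU ψ = diagU φ ≫ ((U k C).map f ⊗ₘ (U k C).map f) :=
  hom_ext_incl (toCoalgHom f).map_comp_comul.symm

/-- Inside the full triple tensor product both sides are iterated comultiplications of `D`, so the
identity is coassociativity. -/
theorem diagU_assoc (φ : CoalgOver k C) :
    diagU φ ≫ (diagU φ ▷ (U k C).obj φ) ≫ (α_ _ _ _).hom =
      diagU φ ≫ ((U k C).obj φ ◁ diagU φ) := by
  apply Comod.hom_ext
  apply comp_cancel (embR_injective _ _ _)
  set Δ := Coalgebra.comul (R := k) (A := φ.left.obj)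
  have h1 : embR _ _ _ ∘ₗ (diagU φ ≫ (diagU φ ▷ (U k C).obj φ) ≫ (α_ _ _ _).hom).lin =
      (TensorProduct.assoc k φ.left.obj φ.left.obj φ.left.obj).toLinearMap ∘ₗ
        Δ.rTensor φ.left.obj ∘ₗ Δ := by
    apply LinearMap.ext
    intro x
    refine (LinearMap.congr_fun (embR_assocHom _ _ _) _).trans ?_
    rw [embL_eq_apply]
    refine congrArg (TensorProduct.assoc k φ.left.obj φ.left.obj φ.left.obj) ?_
    have e : ∀ z : (U k C).obj φ ⊗[k] (U k C).obj φ,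
        (incl ((U k C).obj φ) ((U k C).obj φ)).rTensor ((U k C).obj φ)
          (TensorProduct.map (diagU φ).lin LinearMap.id z) = Δ.rTensor φ.left.obj z := by
      intro z
      rw [← LinearMap.comp_apply, LinearMap.rTensor_comp_map]
      rfl
    exact e _
  have h2 : embR _ _ _ ∘ₗ (diagU φ ≫ ((U k C).obj φ ◁ diagU φ)).lin =
      Δ.lTensor φ.left.obj ∘ₗ Δ := by
    apply LinearMap.ext
    intro x
    have e : ∀ z : (U k C).obj φ ⊗[k] (U k C).obj φ,
        (incl ((U k C).obj φ) ((U k C).obj φ)).lTensor ((U k C).obj φ)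
          (TensorProduct.map LinearMap.id (diagU φ).lin z) = Δ.lTensor φ.left.obj z := by
      intro z
      rw [← LinearMap.comp_apply, LinearMap.lTensor_comp_map]
      rfl
    exact e _
  exact h1.trans (Coalgebra.coassoc.trans h2.symm)

/-- The structure morphism of `φ` as a morphism from `U φ` to the unit. -/
noncomputable def counitU (φ : CoalgOver k C) : (U k C).obj φ ⟶ 𝟙_ (Comod k C) where
  lin := φ.str.toLinearMap
  colinear := by
    change φ.str.toLinearMap.rTensor C ∘ₗ (φ.str.toLinearMap.lTensor φ.left.obj ∘ₗ Coalgebra.comul)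
      = Coalgebra.comul ∘ₗ φ.str.toLinearMap
    rw [← LinearMap.comp_assoc, LinearMap.rTensor_comp_lTensor]
    exact φ.str.map_comp_comul

theorem map_counitU {φ ψ : CoalgOver k C} (f : φ ⟶ ψ) : (U k C).map f ≫ counitU ψ = counitU φ :=
  Comod.hom_ext (CoalgOver.w f)

/-- The inverse right unitor is the coaction, which on `U φ` is by definition `(id ⊗ φ) ∘ Δ`. -/
theorem diagU_counitU_right (φ : CoalgOver k C) :
    diagU φ ≫ ((U k C).obj φ ◁ counitU φ) = (ρ_ ((U k C).obj φ)).inv := by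
  apply hom_ext_incl
  rfl

theorem diagU_braiding (φ : CoalgOver k C) : diagU φ ≫ (β_ _ _).hom = diagU φ :=
  hom_ext_incl (Coalgebra.comm_comp_comul k φ.left.obj)

/-- Cocommutativity, in the form `diagU_braiding`, reduces this to the right-hand version. -/
theorem diagU_counitU_left (φ : CoalgOver k C) :
    diagU φ ≫ (counitU φ ▷ (U k C).obj φ) = (λ_ ((U k C).obj φ)).inv := by
  rw [← diagU_braiding, Category.assoc, ← BraidedCategory.braiding_naturality_right,
    ← Category.assoc,
    diagU_counitU_right]
  rfl

/-- The morphism `U χ ⟶ U φ ⊗^C U ψ` induced by a pair of morphisms. -/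
noncomputable def pairU {χ φ ψ : CoalgOver k C} (f : χ ⟶ φ) (g : χ ⟶ ψ) :
    (U k C).obj χ ⟶ (U k C).obj φ ⊗ (U k C).obj ψ :=
  diagU χ ≫ ((U k C).map f ⊗ₘ (U k C).map g)

theorem map_pairU {ω χ φ ψ : CoalgOver k C} (h : ω ⟶ χ) (f : χ ⟶ φ) (g : χ ⟶ ψ) :
    (U k C).map h ≫ pairU f g = pairU (h ≫ f) (h ≫ g) := by
  rw [pairU, ← Category.assoc, diagU_natural, Category.assoc, tensorHom_comp_tensorHom, pairU,
    Functor.map_comp, Functor.map_comp]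

theorem pairU_tensorHom {χ φ ψ : CoalgOver k C} (f : χ ⟶ φ) (g : χ ⟶ ψ) {V W : Comod k C}
    (a : (U k C).obj φ ⟶ V) (b : (U k C).obj ψ ⟶ W) :
    pairU f g ≫ (a ⊗ₘ b) = diagU χ ≫ ((U k C).map f ≫ a ⊗ₘ (U k C).map g ≫ b) := by
  rw [pairU, Category.assoc, tensorHom_comp_tensorHom]

theorem pairU_assoc {χ φ ψ ω : CoalgOver k C} (f : χ ⟶ φ) (g : χ ⟶ ψ) (h : χ ⟶ ω) :
    diagU χ ≫ (pairU f g ⊗ₘ (U k C).map h) ≫ (α_ _ _ _).hom =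
      diagU χ ≫ ((U k C).map f ⊗ₘ pairU g h) := by
  have h1 : pairU f g ⊗ₘ (U k C).map h = (diagU χ ▷ _) ≫
      (((U k C).map f ⊗ₘ (U k C).map g) ⊗ₘ (U k C).map h) := by
    rw [← tensorHom_id, tensorHom_comp_tensorHom, Category.id_comp, pairU]
  have h2 : (U k C).map f ⊗ₘ pairU g h = (_ ◁ diagU χ) ≫
      ((U k C).map f ⊗ₘ ((U k C).map g ⊗ₘ (U k C).map h)) := by
    rw [← id_tensorHom, tensorHom_comp_tensorHom, Category.id_comp, pairU]
  rw [h1, h2, Category.assoc, associator_naturality, ← Category.assoc, ← Category.assoc,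
    Category.assoc (diagU χ), diagU_assoc, Category.assoc]

/-- The comonoid structures `diagU`, `counitU` are natural in the object, so every composite in the
axioms can be rewritten as a diagonal followed by a tensor product of images under `U`. The axioms
then follow from coassociativity and counitality of the diagonal. -/
noncomputable instance : (U k C).OplaxMonoidal where
  η := counitU _
  δ φ ψ := pairU (fst φ ψ) (snd φ ψ)
  δ_natural_left f ψ := by
    rw [map_pairU, pairU, Category.assoc, ← tensorHom_id, tensorHom_comp_tensorHom, pairU,
      ← Functor.map_comp, ← CategoryTheory.Functor.map_id, ← Functor.map_comp]
    simp
  δ_natural_right φ f := by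
    rw [map_pairU, pairU, Category.assoc, ← id_tensorHom, tensorHom_comp_tensorHom, pairU,
      ← Functor.map_comp, ← CategoryTheory.Functor.map_id, ← Functor.map_comp]
    simp
  oplax_associativity φ ψ χ := by
    rw [← Category.assoc ((U k C).map _), map_pairU, ← tensorHom_id, ← id_tensorHom,
      ← Category.assoc, pairU_tensorHom, pairU_tensorHom, map_pairU, map_pairU, Category.comp_id,
      Category.comp_id, Category.assoc, pairU_assoc]
    simp
  oplax_left_unitality φ := by
    rw [← Category.assoc, map_pairU, pairU, Category.assoc, ← tensorHom_id,
      tensorHom_comp_tensorHom, map_counitU, leftUnitor_inv_snd, CategoryTheory.Functor.map_id,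
      Category.comp_id, tensorHom_id, diagU_counitU_left]
  oplax_right_unitality φ := by
    rw [← Category.assoc, map_pairU, pairU, Category.assoc, ← id_tensorHom,
      tensorHom_comp_tensorHom, map_counitU, rightUnitor_inv_fst, CategoryTheory.Functor.map_id,
      Category.comp_id, id_tensorHom, diagU_counitU_right]

/-- The terminal object of `Coalg C` is the identity of `C`, so the underlying map of `η` is the
identity. -/
instance : IsIso (Functor.OplaxMonoidal.η (U k C)) :=
  isIso_of_bijective _ (Function.bijective_id : Function.Bijective (id : C → C))

theorem incl_δ_apply (φ ψ : CoalgOver k C) (t : prodSpace φ ψ) :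
    incl _ _ ((Functor.OplaxMonoidal.δ (U k C) φ ψ).lin t) = (t : φ.left.obj ⊗[k] ψ.left.obj) := by
  have h1 : TensorProduct.map ((tensorFst k _ _).comp (prodIncl φ ψ)).toLinearMap
      ((tensorSnd k _ _).comp (prodIncl φ ψ)).toLinearMap (Coalgebra.comul t) =
      TensorProduct.map (tensorFst k _ _).toLinearMap (tensorSnd k _ _).toLinearMap
        (TensorProduct.map (prodIncl φ ψ).toLinearMap (prodIncl φ ψ).toLinearMap
          (Coalgebra.comul t)) :=
    LinearMap.congr_fun (TensorProduct.map_comp _ _ _ _) _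
  refine Eq.trans h1 ?_
  rw [← LinearMap.comp_apply (TensorProduct.map (prodIncl φ ψ).toLinearMap _),
    (prodIncl φ ψ).map_comp_comul]
  exact LinearMap.congr_fun map_tensorFst_tensorSnd_comul _

instance (φ ψ : CoalgOver k C) : IsIso (Functor.OplaxMonoidal.δ (U k C) φ ψ) := by
  refine isIso_of_bijective _ ⟨fun s t h => ?_, fun t => ?_⟩
  · apply Subtype.ext
    rw [← incl_δ_apply φ ψ s, ← incl_δ_apply φ ψ t]
    exact congrArg _ h
  · refine ⟨⟨t.1, ?_⟩, incl_injective _ _ (incl_δ_apply φ ψ _)⟩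
    rw [← cotensorSpace_U]
    exact t.2

noncomputable instance : (U k C).Monoidal := .ofOplaxMonoidal _

end Oplax

/-! ### The right adjoint of `U` -/

section RightAdjoint

variable {k : Type u} [Field k] {C : Type u} [AddCommGroup C] [Module k C] [Coalgebra k C]
  [Coalgebra.IsCocomm k C]

open CoalgOver

/-- An object of this comma category is a coalgebra `D` with a pair of linear maps to `C` and `W`
satisfying identities. The cofree coalgebra on `C × W` classifies the pairs, and its largest
subcoalgebra satisfying the identities is terminal. -/
instance hasTerminal_costructuredArrow_U (W : Comod k C) :
    Limits.HasTerminal (CostructuredArrow (U k C) W) := by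
  obtain ⟨F, _, _, _, _, q, hex, huniq⟩ := exists_cofree k (C × W)
  let φ : F →ₗ[k] C := LinearMap.fst k C W ∘ₗ q
  let f : F →ₗ[k] W := LinearMap.snd k C W ∘ₗ q
  -- The elements at which `φ` respects comultiplication and counit and at which `f` is colinear
  -- with respect to `φ`.
  let K : Submodule k F :=
    LinearMap.eqLocus (TensorProduct.map φ φ ∘ₗ Coalgebra.comul) (Coalgebra.comul ∘ₗ φ) ⊓
      (LinearMap.eqLocus (Coalgebra.counit ∘ₗ φ) Coalgebra.counit ⊓
        LinearMap.eqLocus (TensorProduct.map f φ ∘ₗ Coalgebra.comul) (W.coact ∘ₗ f))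
  let N : Submodule k F := sSup {N | IsSubcoalgebra k N ∧ N ≤ K}
  have hN : IsSubcoalgebra k N := isSubcoalgebra_sSup fun _ h => h.1
  have hNK : N ≤ K := sSup_le fun _ h => h.2
  let _ := subCoalgebra hN
  have := subCoalgebra_isCocomm hN
  have hmap : ∀ {A B : Type u} [AddCommGroup A] [Module k A] [AddCommGroup B] [Module k B]
      (a : F →ₗ[k] A) (b : F →ₗ[k] B), TensorProduct.map (a ∘ₗ N.subtype) (b ∘ₗ N.subtype) ∘ₗ
        Coalgebra.comul = (TensorProduct.map a b ∘ₗ Coalgebra.comul) ∘ₗ N.subtype := by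
    intro A B _ _ _ _ a b
    rw [TensorProduct.map_comp, LinearMap.comp_assoc, LinearMap.comp_assoc]
    exact congrArg _ (map_subComul hN)
  let φN : N →ₗc[k] C :=
    { φ ∘ₗ N.subtype with
      counit_comp := LinearMap.ext fun x => (hNK x.2).2.1
      map_comp_comul := (hmap φ φ).trans (LinearMap.ext fun x => (hNK x.2).1) }
  let fN : (U k C).obj (ofCoalgHom φN) ⟶ W :=
    { lin := f ∘ₗ N.subtype
      colinear := by
        change (f ∘ₗ N.subtype).rTensor C ∘ₗ (φN.toLinearMap.lTensor N ∘ₗ Coalgebra.comul) = _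
        rw [← LinearMap.comp_assoc, LinearMap.rTensor_comp_lTensor]
        exact (hmap f φ).trans (LinearMap.ext fun x => (hNK x.2).2.2) }
  let T : CostructuredArrow (U k C) W := CostructuredArrow.mk fN
  have hT : ∀ A : CostructuredArrow (U k C) W, Nonempty (Unique (A ⟶ T)) := by
    intro A
    let p : A.left.left.obj →ₗ[k] C × W := A.left.str.toLinearMap.prod A.hom.lin
    obtain ⟨g, hg⟩ := hex A.left.left.obj p
    have hφ : φ ∘ₗ g.toLinearMap = A.left.str.toLinearMap := by
      rw [LinearMap.comp_assoc, hg]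
      rfl
    have hf : f ∘ₗ g.toLinearMap = A.hom.lin := by
      rw [LinearMap.comp_assoc, hg]
      rfl
    have hgmap : ∀ {A' B' : Type u} [AddCommGroup A'] [Module k A'] [AddCommGroup B'] [Module k B']
        (a : F →ₗ[k] A') (b : F →ₗ[k] B'),
        (TensorProduct.map a b ∘ₗ Coalgebra.comul) ∘ₗ g.toLinearMap =
          TensorProduct.map (a ∘ₗ g.toLinearMap) (b ∘ₗ g.toLinearMap) ∘ₗ Coalgebra.comul := by
      intro A' B' _ _ _ _ a b
      rw [TensorProduct.map_comp, LinearMap.comp_assoc, LinearMap.comp_assoc, g.map_comp_comul]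
    have h1 : (TensorProduct.map φ φ ∘ₗ Coalgebra.comul) ∘ₗ g.toLinearMap =
        (Coalgebra.comul ∘ₗ φ) ∘ₗ g.toLinearMap := by
      rw [hgmap, hφ, LinearMap.comp_assoc, hφ]
      exact A.left.str.map_comp_comul
    have h2 : (Coalgebra.counit ∘ₗ φ) ∘ₗ g.toLinearMap = Coalgebra.counit ∘ₗ g.toLinearMap := by
      rw [LinearMap.comp_assoc, hφ, g.counit_comp]
      exact A.left.str.counit_comp
    have h3 : (TensorProduct.map f φ ∘ₗ Coalgebra.comul) ∘ₗ g.toLinearMap =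
        (W.coact ∘ₗ f) ∘ₗ g.toLinearMap := by
      rw [hgmap, hφ, hf, LinearMap.comp_assoc, hf]
      let a : A.left.left.obj →ₗ[k] W := A.hom.lin
      have h : a.rTensor C ∘ₗ
          (A.left.str.toLinearMap.lTensor A.left.left.obj ∘ₗ Coalgebra.comul) =
          TensorProduct.map a A.left.str.toLinearMap ∘ₗ Coalgebra.comul := by
        rw [← LinearMap.comp_assoc, LinearMap.rTensor_comp_lTensor]
      exact h.symm.trans A.hom.colinear
    have hgK : LinearMap.range g.toLinearMap ≤ K := by
      rintro _ ⟨x, rfl⟩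
      exact ⟨LinearMap.congr_fun h1 x, LinearMap.congr_fun h2 x, LinearMap.congr_fun h3 x⟩
    -- The image of `g` is itself a subcoalgebra contained in `K`, hence in the largest one.
    have hgN : ∀ x, g x ∈ N := fun x =>
      (le_sSup (show LinearMap.range g.toLinearMap ∈ {N | IsSubcoalgebra k N ∧ N ≤ K} from
        ⟨isSubcoalgebra_range g, hgK⟩)) ⟨x, rfl⟩
    refine ⟨⟨⟨CostructuredArrow.homMk (homMk (subCoalgLift hN g hgN) hφ) (Comod.hom_ext hf)⟩,
      fun m => ?_⟩⟩
    apply CostructuredArrow.hom_ext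
    apply CoalgOver.hom_ext
    apply Comod.comp_cancel N.injective_subtype
    -- A competing morphism has the same two components in `C × W`: one because it lies over `C`,
    -- the other because it lies over `W`. Cofreeness then forces equality.
    refine congrArg CoalgHom.toLinearMap
      (huniq _ ((subCoalgHom hN).comp (toCoalgHom m.left)) g ?_)
    rw [hg]
    apply LinearMap.ext
    intro x
    refine Prod.ext ?_ ?_
    · exact LinearMap.congr_fun (CoalgOver.w m.left) x
    · exact LinearMap.congr_fun (congrArg Comod.Hom.lin (CostructuredArrow.w m)) x
  have := fun A => (hT A).some
  exact Limits.hasTerminal_of_unique T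

end RightAdjoint

/-! ### Comodules as modules; splitting of coactions -/

section Semisimple

variable {k : Type u} [Field k] {C : Type u} [AddCommGroup C] [Module k C] [Coalgebra k C]

namespace Comod

/-- A linear map compatible with all contractions of the coactions is colinear. -/
def homOfSlice {V W : Comod k C} (f : V →ₗ[k] W)
    (h : ∀ (ξ : Module.Dual k C) (x : V), f (slice V ξ (V.coact x)) = slice W ξ (W.coact (f x))) :
    V ⟶ W where
  lin := f
  colinear := LinearMap.ext fun x => eq_of_slice fun ξ => by
    rw [LinearMap.comp_apply, slice_rTensor, h, LinearMap.comp_apply]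

theorem hom_slice {V W : Comod k C} (f : V ⟶ W) (ξ : Module.Dual k C) (x : V) :
    f.lin (slice V ξ (V.coact x)) = slice W ξ (W.coact (f.lin x)) := by
  rw [← slice_rTensor]
  exact congrArg _ (LinearMap.congr_fun f.colinear x)

theorem slice_counit_coact (V : Comod k C) (x : V) :
    slice V Coalgebra.counit (V.coact x) = x :=
  LinearMap.congr_fun (evC_coact V) x

/-- The space `M ⊗ V` with the coaction of `V`. -/
noncomputable def free (M : Type u) [AddCommGroup M] [Module k M] (V : Comod k C) :
    Comod k C where
  carrier := M ⊗[k] V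
  coact := actR M V.coact
  coassoc := isCoassoc_actR V.coassoc
  counital := isCounital_actR V.counital

/-- The coaction of `V` as a morphism to the cofree comodule `V ⊗ C`. -/
noncomputable def coactHom (V : Comod k C) : V ⟶ free V (unit k C) where
  lin := V.coact
  colinear := coact_actR V

/-- The map `x ↦ m ⊗ x` as a morphism `V ⟶ M ⊗ V`. -/
noncomputable def freeMk {M : Type u} [AddCommGroup M] [Module k M] (m : M) (V : Comod k C) :
    V ⟶ free M V where
  lin := TensorProduct.mk k M V m
  colinear := by
    apply LinearMap.ext
    intro x
    change (TensorProduct.mk k M V m).rTensor C (V.coact x) =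
      (TensorProduct.assoc k M V C).symm (m ⊗ₜ V.coact x)
    induction V.coact x using TensorProduct.induction_on with
    | zero => simp
    | tmul y c => simp
    | add y z hy hz => simp only [TensorProduct.tmul_add, map_add, hy, hz]

/-- The free algebra on the functionals on `C`, which acts on all comodules. -/
abbrev DualAlg (k : Type u) [Field k] (C : Type u) [AddCommGroup C] [Module k C] : Type u :=
  FreeAlgebra k (Module.Dual k C)

/-- The action of `DualAlg k C` on a comodule, by contraction of the coaction. -/
noncomputable def dualAct (V : Comod k C) : DualAlg k C →ₐ[k] Module.End k V :=
  FreeAlgebra.lift k fun ξ => slice V ξ ∘ₗ V.coact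

/-- Colinearity and stability of subspaces are conditions on single contractions, that is, on
generators. The free algebra therefore has the right submodules and homomorphisms without any
convolution relations. -/
noncomputable instance (V : Comod k C) : Module (DualAlg k C) V :=
  Module.compHom V.carrier V.dualAct.toRingHom

theorem smul_def (V : Comod k C) (a : DualAlg k C) (x : V) : a • x = V.dualAct a x := rfl

theorem ι_smul (V : Comod k C) (ξ : Module.Dual k C) (x : V) :
    FreeAlgebra.ι k ξ • x = slice V.carrier ξ (V.coact x) := by
  rw [smul_def, dualAct, FreeAlgebra.lift_ι_apply]
  rfl

theorem algebraMap_smul (V : Comod k C) (r : k) (x : V.carrier) :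
    (algebraMap k (DualAlg k C) r • x) = r • x := by
  rw [smul_def, AlgHom.commutes]
  rfl

/-- A morphism of comodules as a map of modules over `DualAlg k C`. -/
def Hom.toMod {V W : Comod k C} (f : V ⟶ W) : V →ₗ[DualAlg k C] W where
  toFun x := f.lin x
  map_add' x y := map_add f.lin x y
  map_smul' a x := by
    change f.lin (V.dualAct a x) = W.dualAct a (f.lin x)
    induction a using FreeAlgebra.induction generalizing x with
    | grade0 r => rw [AlgHom.commutes, AlgHom.commutes]; exact map_smul f.lin r x
    | grade1 ξ =>
      rw [dualAct, dualAct, FreeAlgebra.lift_ι_apply, FreeAlgebra.lift_ι_apply]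
      exact hom_slice f ξ x
    | mul a b ha hb =>
      rw [map_mul, map_mul, Module.End.mul_apply, Module.End.mul_apply, ha, hb]
    | add a b ha hb =>
      rw [map_add, map_add, LinearMap.add_apply, LinearMap.add_apply, map_add, ha, hb]

/-- A map of modules over `DualAlg k C` as a morphism of comodules. -/
noncomputable def homOfMod {V W : Comod k C} (f : V →ₗ[DualAlg k C] W) : V ⟶ W :=
  homOfSlice
    { toFun := fun x => f x
      map_add' := fun x y => map_add f x y
      map_smul' := fun r x => by
        have h := map_smul f (algebraMap k (DualAlg k C) r) x
        rwa [algebraMap_smul, algebraMap_smul] at h }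
    fun ξ x => by
      have h := map_smul f (FreeAlgebra.ι k ξ) x
      rwa [ι_smul, ι_smul] at h

/-- A subspace stable under contractions as a submodule over `DualAlg k C`. -/
def submoduleMod {V : Comod k C} (N : Submodule k V)
    (hN : ∀ x ∈ N, ∀ ξ : Module.Dual k C, slice V ξ (V.coact x) ∈ N) :
    Submodule (DualAlg k C) V where
  carrier := N
  add_mem' := N.add_mem
  zero_mem' := N.zero_mem
  smul_mem' a x hx := by
    change V.dualAct a x ∈ N
    induction a using FreeAlgebra.induction generalizing x with
    | grade0 r => rw [AlgHom.commutes]; exact N.smul_mem r hx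
    | grade1 ξ => rw [dualAct, FreeAlgebra.lift_ι_apply]; exact hN x hx ξ
    | mul a b ha hb => rw [map_mul]; exact ha _ (hb _ hx)
    | add a b ha hb => rw [map_add]; exact N.add_mem (ha _ hx) (hb _ hx)

/-- The subspace underlying a submodule over `DualAlg k C`. -/
def submoduleLin {V : Comod k C} (N : Submodule (DualAlg k C) V) : Submodule k V where
  carrier := N
  add_mem' := N.add_mem
  zero_mem' := N.zero_mem
  smul_mem' r x hx := by
    have h := N.smul_mem (algebraMap k (DualAlg k C) r) hx
    rwa [algebraMap_smul] at h

theorem submoduleLin_slice {V : Comod k C} (N : Submodule (DualAlg k C) V) {x : V}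
    (hx : x ∈ submoduleLin N) (ξ : Module.Dual k C) :
    slice V ξ (V.coact x) ∈ submoduleLin N := by
  have h := N.smul_mem (FreeAlgebra.ι k ξ) hx
  rwa [ι_smul] at h

/-- The submodules of `C` are its subcoalgebras, so the simple subcoalgebras are simple submodules,
and they span `C`. -/
theorem isSemisimpleModule_unit [Coalgebra.IsCocomm k C] (hC : IsCosemisimple k C) :
    IsSemisimpleModule (DualAlg k C) (unit k C) := by
  obtain ⟨ι, D, hD, -, htop⟩ := hC
  let p : ι → Submodule (DualAlg k C) (unit k C) := fun i =>
    submoduleMod (V := unit k C) (D i)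
      fun x hx ξ => slice_mem_of_isSubcoalgebra (hD i).isSubcoalgebra hx ξ
  refine isSemisimpleModule_of_isSemisimpleModule_submodule' (p := p) (fun i => ?_) ?_
  · have : IsSimpleModule (DualAlg k C) (p i) := by
      rw [isSimpleModule_iff_isAtom]
      refine ⟨fun h => (hD i).ne_bot ?_, fun N hN => ?_⟩
      · rw [eq_bot_iff]
        intro x hx
        have hx' : x ∈ p i := hx
        rwa [h] at hx'
      · let N' : Submodule k C := submoduleLin N
        have h1 : IsSubcoalgebra k N' :=
          isSubcoalgebra_of_slice fun x hx ξ => submoduleLin_slice N hx ξ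
        rcases (hD i).eq_bot_or_eq N' hN.le h1 with h | h
        · rw [eq_bot_iff]
          intro x hx
          have hx' : x ∈ N' := hx
          rwa [h] at hx'
        · refine absurd ?_ hN.not_ge
          intro x hx
          have hx' : x ∈ N' := h ▸ hx
          exact hx'
    infer_instance
  · rw [eq_top_iff]
    have h : ⨆ i, D i ≤ submoduleLin (⨆ i, p i) :=
      iSup_le fun i x hx => (le_iSup p i : p i ≤ _) hx
    rw [htop] at h
    exact fun x _ => h (Submodule.mem_top (x := (x : C)))

/-- `M ⊗ C` is the sum of the images `m ⊗ C`, each a quotient of the semisimple module `C`. -/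
theorem isSemisimpleModule_free [Coalgebra.IsCocomm k C] (hC : IsCosemisimple k C)
    (M : Type u) [AddCommGroup M] [Module k M] :
    IsSemisimpleModule (DualAlg k C) (free M (unit k C)) := by
  have := isSemisimpleModule_unit hC
  refine isSemisimpleModule_of_isSemisimpleModule_submodule'
    (p := fun m : M => LinearMap.range (Hom.toMod (freeMk m (unit k C))))
    (fun m => IsSemisimpleModule.range _) ?_
  rw [eq_top_iff]
  intro x _
  change (x : M ⊗[k] C) ∈ submoduleLin (V := free M (unit k C))
    (⨆ m : M, LinearMap.range (Hom.toMod (freeMk m (unit k C))))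
  induction (show M ⊗[k] C from x) using TensorProduct.induction_on with
  | zero => exact Submodule.zero_mem _
  | add y z hy hz => exact Submodule.add_mem _ hy hz
  | tmul m c => exact Submodule.mem_iSup_of_mem m ⟨(c : (unit k C)), rfl⟩

/-- Over a cosemisimple coalgebra, the coaction of a comodule splits. -/
theorem exists_retraction [Coalgebra.IsCocomm k C] (hC : IsCosemisimple k C) (V : Comod k C) :
    ∃ r : free V (unit k C) ⟶ V, coactHom V ≫ r = 𝟙 V := by
  have := isSemisimpleModule_free hC V
  -- The coaction is injective, since `id ⊗ ε` is a linear left inverse. Semisimplicity of `V ⊗ C`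
  -- extends the identity of `V` along it to a colinear retraction.
  obtain ⟨h, hh⟩ := IsSemisimpleModule.extension_property (Hom.toMod (coactHom V))
    (Function.LeftInverse.injective (g := evC V) (LinearMap.congr_fun (evC_coact V))) LinearMap.id
  exact ⟨homOfMod h, Comod.hom_ext (LinearMap.ext fun x => LinearMap.congr_fun hh x)⟩

end Comod

end Semisimple

/-! ### Internal homs of comodules -/

section Closed

variable {k : Type u} [Field k] {C : Type u} [AddCommGroup C] [Module k C] [Coalgebra k C]

namespace Comod

/-- A subspace stable under contractions, as a comodule. -/
noncomputable def sub (V : Comod k C) (N : Submodule k V)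
    (hN : ∀ x ∈ N, ∀ ξ : Module.Dual k C, slice V ξ (V.coact x) ∈ N) : Comod k C :=
  have h : ∀ x : N, (V.coact ∘ₗ N.subtype) x ∈ LinearMap.range (N.subtype.rTensor C) :=
    fun x => mem_range_rTensor_iff_slice.2 fun ξ => hN x x.2 ξ
  have hinj := rTensor_inj N.injective_subtype C
  { carrier := N
    coact := liftInj (N.subtype.rTensor C) hinj (V.coact ∘ₗ N.subtype) h
    coassoc := isCoassoc_of_inj N.injective_subtype (comp_liftInj _ hinj _ h) V.coassoc
    counital := isCounital_of_inj N.injective_subtype (comp_liftInj _ hinj _ h) V.counital }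

/-- The inclusion of a subcomodule. -/
noncomputable def subHom (V : Comod k C) (N : Submodule k V)
    (hN : ∀ x ∈ N, ∀ ξ : Module.Dual k C, slice V ξ (V.coact x) ∈ N) : sub V N hN ⟶ V where
  lin := N.subtype
  colinear := comp_liftInj _ _ _ _

/-- The morphism to a subcomodule induced by one to the comodule. -/
noncomputable def subLift {V X : Comod k C} (N : Submodule k V)
    (hN : ∀ x ∈ N, ∀ ξ : Module.Dual k C, slice V ξ (V.coact x) ∈ N) (f : X ⟶ V)
    (hf : ∀ x, f.lin x ∈ N) : X ⟶ sub V N hN where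
  lin := f.lin.codRestrict N hf
  colinear := by
    apply comp_cancel (rTensor_inj N.injective_subtype C)
    have h : N.subtype.rTensor C ∘ₗ (sub V N hN).coact = V.coact ∘ₗ N.subtype :=
      (subHom V N hN).colinear
    have h' : N.subtype.rTensor C ∘ₗ (f.lin.codRestrict N hf).rTensor C ∘ₗ X.coact =
        V.coact ∘ₗ f.lin := by
      rw [← LinearMap.comp_assoc, ← LinearMap.rTensor_comp, LinearMap.subtype_comp_codRestrict,
        f.colinear]
    exact h'.trans (congrArg (· ∘ₗ f.lin.codRestrict N hf) h).symm

/-- The largest subspace of `K` stable under contractions. -/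
noncomputable def core (V : Comod k C) (K : Submodule k V) : Submodule k V :=
  ⨅ ξ : Module.Dual k C, K.comap (slice V ξ ∘ₗ V.coact)

theorem mem_core {V : Comod k C} {K : Submodule k V} {x : V} :
    x ∈ core V K ↔ ∀ ξ : Module.Dual k C, slice V ξ (V.coact x) ∈ K := by
  simp [core, Submodule.mem_iInf]

/-- Two successive contractions are a single contraction with a convolution, so contracting once
already reaches a stable subspace. -/
theorem slice_mem_core (V : Comod k C) (K : Submodule k V) :
    ∀ x ∈ core V K, ∀ ξ : Module.Dual k C, slice V ξ (V.coact x) ∈ core V K := by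
  intro x hx ξ
  rw [mem_core] at hx ⊢
  intro η
  rw [slice_slice_of_isCoassoc V.coassoc]
  exact hx _

theorem core_le (V : Comod k C) (K : Submodule k V) : core V K ≤ K := by
  intro x hx
  have h := mem_core.1 hx Coalgebra.counit
  rwa [slice_counit_coact] at h

theorem hom_mem_core {V X : Comod k C} {K : Submodule k V} (f : X ⟶ V)
    (hf : ∀ x, f.lin x ∈ K) (x : X) : f.lin x ∈ core V K := by
  rw [mem_core]
  intro ξ
  rw [← hom_slice]
  exact hf _

/-- The counit law on the cofree comodule. It recovers an element of `L ⊗ C` from its coaction,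
which is why a morphism into `L ⊗ C` is determined by its `L`-component. -/
theorem rTensor_slice_actR {L : Type u} [AddCommGroup L] [Module k L] (z : L ⊗[k] C) :
    (slice L Coalgebra.counit).rTensor C
      (actR L (Coalgebra.comul (R := k) (A := C)) z) = z := by
  suffices h : (slice L Coalgebra.counit).rTensor C ∘ₗ
      actR L (Coalgebra.comul (R := k) (A := C)) = LinearMap.id from LinearMap.congr_fun h z
  ext v c
  have h1 : ∀ z : C ⊗[k] C, (slice L Coalgebra.counit).rTensor C
      ((TensorProduct.assoc k L C C).symm (v ⊗ₜ z)) =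
      v ⊗ₜ[k] TensorProduct.lid k C ((Coalgebra.counit (R := k) (A := C)).rTensor C z) := by
    intro z
    induction z using TensorProduct.induction_on with
    | zero => simp
    | tmul x c => simp [TensorProduct.smul_tmul]
    | add x y hx hy => simp only [TensorProduct.tmul_add, map_add, hx, hy]
  refine (h1 _).trans ?_
  rw [Coalgebra.rTensor_counit_comul]
  simp

/-- A morphism to a cofree comodule is determined by its contraction with the counit. -/
theorem cofree_lin_apply {L : Type u} [AddCommGroup L] [Module k L] {X : Comod k C}
    (m : X ⟶ free L (unit k C)) (h : X →ₗ[k] L)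
    (hm : ∀ x, slice L (Coalgebra.counit (R := k) (A := C)) (m.lin x) = h x) (x : X) :
    m.lin x = h.rTensor C (X.coact x) := by
  let m' : X →ₗ[k] L ⊗[k] C := m.lin
  have h1 : m'.rTensor C (X.coact x) = actR L (Coalgebra.comul (R := k) (A := C)) (m' x) :=
    LinearMap.congr_fun m.colinear x
  have h2 : slice L Coalgebra.counit ∘ₗ m' = h := LinearMap.ext hm
  rw [← h2, LinearMap.rTensor_comp, LinearMap.comp_apply, h1, rTensor_slice_actR]
  rfl

/-- The morphism to a cofree comodule induced by a linear map. -/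
noncomputable def cofreeLift {L : Type u} [AddCommGroup L] [Module k L] {X : Comod k C}
    (h : X →ₗ[k] L) : X ⟶ free L (unit k C) where
  lin := h.rTensor C ∘ₗ X.coact
  colinear := by
    have h1 := actR_map h (LinearMap.id (M := C)) (b := Coalgebra.comul (R := k))
      (b' := Coalgebra.comul) (by simp)
    have h2 : (h.rTensor C).rTensor C ∘ₗ actR X (Coalgebra.comul (R := k) (A := C)) =
        actR L (Coalgebra.comul (R := k) (A := C)) ∘ₗ h.rTensor C := h1
    change (h.rTensor C ∘ₗ X.coact).rTensor C ∘ₗ X.coact =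
      actR L (Coalgebra.comul (R := k) (A := C)) ∘ₗ h.rTensor C ∘ₗ X.coact
    rw [LinearMap.rTensor_comp, LinearMap.comp_assoc, coact_actR, ← LinearMap.comp_assoc, h2,
      LinearMap.comp_assoc]

theorem slice_cofreeLift {L : Type u} [AddCommGroup L] [Module k L] {X : Comod k C}
    (h : X →ₗ[k] L) (x : X) :
    slice L Coalgebra.counit (h.rTensor C (X.coact x)) = h x := by
  rw [slice_rTensor, slice_counit_coact]

theorem rTensor_actR_tmul {V X W : Comod k C} (g : V ⊗[k] X →ₗ[k] W) (v : V) (x : X) :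
    g.rTensor C (actR V X.coact (v ⊗ₜ x)) = (TensorProduct.curry g v).rTensor C (X.coact x) := by
  change g.rTensor C ((TensorProduct.assoc k V X C).symm (v ⊗ₜ X.coact x)) = _
  induction X.coact x using TensorProduct.induction_on with
  | zero => simp
  | tmul y c => simp
  | add y z hy hz => simp only [TensorProduct.tmul_add, map_add, hy, hz]

/-- The coaction of `X` with its factors interchanged. -/
noncomputable def coact' (X : Comod k C) : X →ₗ[k] C ⊗[k] X :=
  (TensorProduct.comm k X C).toLinearMap ∘ₗ X.coact

theorem coact'_actL (X : Comod k C) :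
    X.coact'.rTensor C ∘ₗ X.coact = actL Coalgebra.comul X ∘ₗ X.coact' := by
  rw [coact', LinearMap.rTensor_comp, LinearMap.comp_assoc, coact_actR, ← LinearMap.comp_assoc,
    actR_comm, LinearMap.comp_assoc]

/-- The embedding `id ⊗ τ w` of `V ⊗ X` in `(V ⊗ C) ⊗ X`. -/
noncomputable def spread (V X : Comod k C) : V ⊗[k] X →ₗ[k] (V ⊗[k] C) ⊗[k] X :=
  (TensorProduct.assoc k V C X).symm.toLinearMap ∘ₗ X.coact'.lTensor V

theorem assoc_spread (V X : Comod k C) :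
    (TensorProduct.assoc k V C X).toLinearMap ∘ₗ spread V X = X.coact'.lTensor V := by
  rw [spread, ← LinearMap.comp_assoc, LinearEquiv.comp_symm, LinearMap.id_comp]

/-- By coassociativity, coacting on `X` before spreading is the same as comultiplying the `C`-factor
after it. Colinearity of a morphism `V ⊗ C ⟶ V` can then convert this into the coaction of `V`. -/
theorem spread_actL (V X : Comod k C) : (spread V X).rTensor C ∘ₗ actR V X.coact =
    actL (actR V Coalgebra.comul) X ∘ₗ spread V X := by
  apply comp_cancel (rTensor_inj (TensorProduct.assoc k V C X).injective C)
  have h := actR_map (LinearMap.id (M := V)) X.coact' (coact'_actL X)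
  rw [← LinearMap.comp_assoc, ← LinearMap.rTensor_comp]
  erw [assoc_spread]
  rw [← LinearMap.comp_assoc]
  erw [assoc_actL_actR]
  rw [LinearMap.comp_assoc, assoc_spread]
  exact h

section Retraction

variable {V : Comod k C} (r : free V (unit k C) ⟶ V)

/-- The linear map `V ⊗ C → V` underlying a morphism from a cofree comodule. -/
noncomputable def retLin : V ⊗[k] C →ₗ[k] V := r.lin

theorem retLin_colinear : (retLin r).rTensor C ∘ₗ actR V Coalgebra.comul =
    V.coact ∘ₗ retLin r := r.colinear

/-- The map `V ⊗ X → V ⊗ X` induced by a morphism `V ⊗ C ⟶ V`. -/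
noncomputable def retractLin (X : Comod k C) : V ⊗[k] X →ₗ[k] V ⊗[k] X :=
  (retLin r).rTensor X ∘ₗ spread V X

theorem retractLin_actL (X : Comod k C) :
    (retractLin r X).rTensor C ∘ₗ actR V X.coact = actL V.coact X ∘ₗ retractLin r X := by
  have h := actL_map (retLin r) (LinearMap.id (M := X)) (retLin_colinear r)
  rw [retractLin, LinearMap.rTensor_comp, LinearMap.comp_assoc, spread_actL,
    ← LinearMap.comp_assoc]
  exact congrArg (· ∘ₗ spread V X) h

variable (W : Comod k C)

/-- The map `Hom(V, W) ⊗ C → Hom(V, W)` given by precomposition with `V ⊗ C → V`. -/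
noncomputable def precomp : (V →ₗ[k] W) ⊗[k] C →ₗ[k] (V →ₗ[k] W) :=
  TensorProduct.lift
    ((LinearMap.llcomp k V V W).compl₂ (TensorProduct.curry (retLin r)).flip)

theorem precomp_tmul (f : V →ₗ[k] W) (c : C) (v : V) :
    precomp r W (f ⊗ₜ c) v = f (retLin r (v ⊗ₜ c)) := rfl

/-- The space of those elements of `Hom(V, W) ⊗ C` which are compatible with the coaction of `W`
and with the retraction. -/
noncomputable def homSpace : Submodule k ((V →ₗ[k] W) ⊗[k] C) :=
  LinearMap.eqLocus (precomp r W) (slice (V →ₗ[k] W) Coalgebra.counit) ⊓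
    ⨅ v : V, LinearMap.eqLocus
      (W.coact ∘ₗ LinearMap.applyₗ v ∘ₗ slice (V →ₗ[k] W) Coalgebra.counit)
      ((LinearMap.applyₗ v : (V →ₗ[k] W) →ₗ[k] W).rTensor C)

theorem mem_homSpace {z : (V →ₗ[k] W) ⊗[k] C} : z ∈ homSpace r W ↔
    precomp r W z = slice (V →ₗ[k] W) Coalgebra.counit z ∧
      ∀ v : V, W.coact (slice (V →ₗ[k] W) Coalgebra.counit z v) =
        (LinearMap.applyₗ v : (V →ₗ[k] W) →ₗ[k] W).rTensor C z := by
  simp [homSpace, Submodule.mem_iInf]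

/-- The internal hom from `V` to `W`. -/
noncomputable def ihom : Comod k C :=
  sub (free (V →ₗ[k] W) (unit k C)) (core _ (homSpace r W)) (slice_mem_core _ _)

/-- The inclusion of the internal hom in the cofree comodule. -/
noncomputable def ihomIncl : ihom r W ⟶ free (V →ₗ[k] W) (unit k C) := subHom _ _ _

/-- The linear map underlying an element of the internal hom. -/
noncomputable def ihomLin : ihom r W →ₗ[k] V →ₗ[k] W :=
  slice (V →ₗ[k] W) (Coalgebra.counit (R := k) (A := C)) ∘ₗ (ihomIncl r W).lin

theorem ihomIncl_mem (z : ihom r W) : (ihomIncl r W).lin z ∈ homSpace r W :=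
  core_le (free (V →ₗ[k] W) (unit k C)) _ z.2

theorem ihomIncl_eq (z : ihom r W) :
    (ihomIncl r W).lin z = (ihomLin r W).rTensor C ((ihom r W).coact z) :=
  cofree_lin_apply (ihomIncl r W) (ihomLin r W) (fun _ => rfl) z

/-- The evaluation of the internal hom. -/
noncomputable def ihomEv : free V (ihom r W) ⟶ W where
  lin := TensorProduct.lift (ihomLin r W).flip
  colinear := by
    apply TensorProduct.ext'
    intro v z
    have h1 := ((mem_homSpace r W).1 (ihomIncl_mem r W z)).2 v
    refine (rTensor_actR_tmul (TensorProduct.lift (ihomLin r W).flip) v z).trans ?_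
    refine Eq.trans ?_ h1.symm
    -- The second condition in `homSpace` is the colinearity of evaluation, once `z` is expressed
    -- through `ihomLin` and its own coaction.
    rw [ihomIncl_eq, ← LinearMap.rTensor_comp_apply]
    rfl

end Retraction

variable [Coalgebra.IsCocomm k C]

/-- The inclusion of `V ⊗^C X` in `V ⊗ X`, as a morphism. -/
noncomputable def inclHom (V X : Comod k C) : cotensor V X ⟶ free V X where
  lin := incl V X
  colinear := incl_coact V X

theorem coact'_actR (X : Comod k C) :
    X.coact'.rTensor C ∘ₗ X.coact = actR C X.coact ∘ₗ X.coact' := by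
  rw [coact', LinearMap.rTensor_comp, LinearMap.comp_assoc, coact_actL, ← LinearMap.comp_assoc,
    actL_comm, LinearMap.comp_assoc]

/-- Here cocommutativity is used: the coaction of `X` may equally be taken on the `X`-factor after
spreading. With `spread_actL`, this makes `retractLin` colinear for both coactions, so that it lands
in the cotensor product. -/
theorem spread_actR (V X : Comod k C) : (spread V X).rTensor C ∘ₗ actR V X.coact =
    actR (V ⊗[k] C) X.coact ∘ₗ spread V X := by
  apply comp_cancel (rTensor_inj (TensorProduct.assoc k V C X).injective C)
  have h := actR_map (LinearMap.id (M := V)) X.coact' (coact'_actR X)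
  rw [← LinearMap.comp_assoc, ← LinearMap.rTensor_comp]
  erw [assoc_spread]
  rw [← LinearMap.comp_assoc]
  erw [assoc_actR]
  rw [LinearMap.comp_assoc, assoc_spread]
  exact h

section Retraction

variable {V W : Comod k C} (r : free V (unit k C) ⟶ V)

theorem retractLin_actR (X : Comod k C) :
    (retractLin r X).rTensor C ∘ₗ actR V X.coact = actR V X.coact ∘ₗ retractLin r X := by
  have h := actR_map (retLin r) (LinearMap.id (M := X)) (b := X.coact) (b' := X.coact) (by simp)
  rw [retractLin, LinearMap.rTensor_comp, LinearMap.comp_assoc, spread_actR,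
    ← LinearMap.comp_assoc]
  exact congrArg (· ∘ₗ spread V X) h

/-- The morphism `V ⊗ X ⟶ V ⊗^C X` induced by a morphism `V ⊗ C ⟶ V`. -/
noncomputable def retract (X : Comod k C) : free V X ⟶ cotensor V X :=
  lift (Z := free V X) (retractLin r X) (retractLin_actL r X) (retractLin_actR r X)

theorem incl_retract (X : Comod k C) (t : V ⊗[k] X) :
    incl V X ((retract r X).lin t) = (retLin r).rTensor X (spread V X t) := rfl

variable {r} in
-- On `V ⊗^C X` spreading the coaction of `X` agrees with the coaction of `V`, which `r` undoes.
-- Thus `V ⊗^C X` is a direct summand of `V ⊗ X`.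
theorem inclHom_retract (hr : coactHom V ≫ r = 𝟙 V) (X : Comod k C) :
    inclHom V X ≫ retract r X = 𝟙 _ := by
  apply hom_ext_incl
  apply LinearMap.ext
  intro t
  have h1 : retLin r ∘ₗ V.coact = LinearMap.id := congrArg Hom.lin hr
  have h2 : TensorProduct.assoc k V C X (V.coact.rTensor X (incl V X t)) =
    X.coact'.lTensor V (incl V X t) := t.2
  change (retLin r).rTensor X ((TensorProduct.assoc k V C X).symm
    (X.coact'.lTensor V (incl V X t))) = incl V X t
  rw [← h2, LinearEquiv.symm_apply_apply, ← LinearMap.comp_apply, ← LinearMap.rTensor_comp, h1,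
    LinearMap.rTensor_id, LinearMap.id_apply]

/-- Precomposing a map `V ⊗ X → W` with the idempotent `incl ∘ retract` corresponds, on the side of
`Hom(V, W)`, to `precomp`. The first condition in `homSpace` thus says that the map is determined by
its restriction to `V ⊗^C X`. -/
theorem lift_retract {X : Comod k C} (h : X →ₗ[k] V →ₗ[k] W) (v : V) (x : X) :
    TensorProduct.lift h.flip (incl V X ((retract r X).lin (v ⊗ₜ x))) =
      precomp r W (h.rTensor C (X.coact x)) v := by
  rw [incl_retract]
  change TensorProduct.lift h.flip ((retLin r).rTensor X ((TensorProduct.assoc k V C X).symm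
    (v ⊗ₜ (TensorProduct.comm k X C (X.coact x))))) = _
  induction X.coact x using TensorProduct.induction_on with
  | zero => simp
  | tmul y c => simp [precomp_tmul]
  | add y z hy hz => simp only [TensorProduct.tmul_add, map_add, hy, hz, LinearMap.add_apply]

/-- The extension of `f` to `V ⊗ X` along the retraction is unchanged by the idempotent and is
colinear; these facts are the two conditions in `homSpace`. -/
theorem cofreeLift_mem (hr : coactHom V ≫ r = 𝟙 V) {X : Comod k C} (f : cotensor V X ⟶ W)
    (h : X →ₗ[k] V →ₗ[k] W) (hh : TensorProduct.lift h.flip = (retract r X ≫ f).lin) (x : X) :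
    (cofreeLift h).lin x ∈ homSpace r W := by
  refine (mem_homSpace r W).2 ?_
  change precomp r W (h.rTensor C (X.coact x)) =
      slice (V →ₗ[k] W) Coalgebra.counit (h.rTensor C (X.coact x)) ∧
    ∀ v : V, W.coact (slice (V →ₗ[k] W) Coalgebra.counit (h.rTensor C (X.coact x)) v) =
        (LinearMap.applyₗ v : (V →ₗ[k] W) →ₗ[k] W).rTensor C (h.rTensor C (X.coact x))
  rw [slice_cofreeLift]
  have hv : ∀ v x, h x v = f.lin ((retract r X).lin (v ⊗ₜ x)) := fun v x =>
    LinearMap.congr_fun hh (v ⊗ₜ x)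
  refine ⟨LinearMap.ext fun v => ?_, fun v => ?_⟩
  · rw [← lift_retract, hh, hv]
    have h1 := LinearMap.congr_fun (congrArg Hom.lin (inclHom_retract hr X))
      ((retract r X).lin (v ⊗ₜ x))
    exact congrArg f.lin h1
  · rw [← LinearMap.rTensor_comp_apply]
    have h1 := LinearMap.congr_fun (retract r X ≫ f).colinear (v ⊗ₜ x)
    refine Eq.trans ?_ ((h1.symm.trans (rTensor_actR_tmul _ v x)).trans ?_)
    · exact congrArg W.coact (hv v x)
    · congr 2
      exact LinearMap.ext fun y => (hv v y).symm

end Retraction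

/-- Morphisms `V ⊗^C X → W` are the colinear maps `V ⊗ X → W` invariant under the idempotent of the
retraction. Currying and cofreeness turn these into morphisms from `X` to `Hom(V, W) ⊗ C` with
values in `homSpace`, hence in its core `ihom r W`. -/
theorem hasTerminal_costructuredArrow_tensorLeft (hC : IsCosemisimple k C) (V W : Comod k C) :
    Limits.HasTerminal (CostructuredArrow (tensorLeft V) W) := by
  obtain ⟨r, hr⟩ := exists_retraction hC V
  let T : CostructuredArrow (tensorLeft V) W :=
    CostructuredArrow.mk (S := tensorLeft V) (Y := ihom r W)
      (inclHom V (ihom r W) ≫ ihomEv r W)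
  have hT : ∀ A : CostructuredArrow (tensorLeft V) W, Nonempty (Unique (A ⟶ T)) := by
    intro A
    let X : Comod k C := A.left
    let f : cotensor V X ⟶ W := A.hom
    let g : V ⊗[k] X →ₗ[k] W := (retract r X ≫ f).lin
    let h : X →ₗ[k] V →ₗ[k] W := (TensorProduct.curry g).flip
    have hh : TensorProduct.lift h.flip = (retract r X ≫ f).lin :=
      TensorProduct.ext' fun v x => rfl
    let m : X ⟶ ihom r W := subLift _ _ (cofreeLift h)
      (hom_mem_core (cofreeLift h) (cofreeLift_mem r hr f h hh))
    have hm : ihomLin r W ∘ₗ m.lin = h := LinearMap.ext fun x => slice_cofreeLift h x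
    have hlift : ∀ m : X ⟶ ihom r W, (ihomEv r W).lin ∘ₗ (m.lin.lTensor V) =
        TensorProduct.lift (ihomLin r W ∘ₗ m.lin).flip := fun m =>
      TensorProduct.ext' fun v x => rfl
    have hw : cotensorHom (𝟙 V) m ≫ inclHom V (ihom r W) ≫ ihomEv r W = f := by
      apply hom_ext
      change ((ihomEv r W).lin ∘ₗ (m.lin.lTensor V)) ∘ₗ incl V X = f.lin
      rw [hlift, hm, hh]
      have := congrArg (· ≫ f) (inclHom_retract hr X)
      rw [Category.assoc, Category.id_comp] at this
      exact congrArg Hom.lin this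
    refine ⟨⟨⟨CostructuredArrow.homMk m hw⟩, fun n => ?_⟩⟩
    apply CostructuredArrow.hom_ext
    let n' : X ⟶ ihom r W := n.left
    change n' = m
    have hn : cotensorHom (𝟙 V) n' ≫ inclHom V (ihom r W) ≫ ihomEv r W = f :=
      CostructuredArrow.w n
    have hn1 : TensorProduct.lift (ihomLin r W ∘ₗ n'.lin).flip ∘ₗ incl V X = f.lin := by
      rw [← hlift]
      exact congrArg Hom.lin hn
    have hn2 : ∀ x, (ihomIncl r W).lin (n'.lin x) =
        (ihomLin r W ∘ₗ n'.lin).rTensor C (X.coact x) :=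
      cofree_lin_apply (n' ≫ ihomIncl r W) (ihomLin r W ∘ₗ n'.lin) fun _ => rfl
    -- Invariance under the idempotent, which is built into `homSpace`, recovers the linear map from
    -- its values on `V ⊗^C X`, where it is prescribed by `f`.
    have hn3 : ihomLin r W ∘ₗ n'.lin = h := by
      apply LinearMap.ext
      intro x
      apply LinearMap.ext
      intro v
      have h1 := LinearMap.congr_fun
        ((mem_homSpace r W).1 (ihomIncl_mem r W (n'.lin x))).1 v
      refine h1.symm.trans ?_
      rw [hn2, ← lift_retract]
      exact LinearMap.congr_fun hn1 _
    have hn4 : ∀ x, (ihomIncl r W).lin (m.lin x) =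
        (ihomLin r W ∘ₗ m.lin).rTensor C (X.coact x) :=
      cofree_lin_apply (m ≫ ihomIncl r W) (ihomLin r W ∘ₗ m.lin) fun _ => rfl
    apply hom_ext
    apply LinearMap.ext
    intro x
    apply Subtype.val_injective
    rw [hn3] at hn2
    rw [hm] at hn4
    exact (hn2 x).trans (hn4 x).symm
  have := fun A => (hT A).some
  exact Limits.hasTerminal_of_unique T

/-- Over a cosemisimple coalgebra, comodules form a closed monoidal category. -/
noncomputable abbrev monoidalClosed (hC : IsCosemisimple k C) : MonoidalClosed (Comod k C) where
  closed V :=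
    have := hasTerminal_costructuredArrow_tensorLeft hC V
    { rightAdj := rightAdjointOfCostructuredArrowTerminals (tensorLeft V)
      adj := adjunctionOfCostructuredArrowTerminals (tensorLeft V) }

end Comod

end Closed

-- From a strong monoidal left adjoint to an LNL adjunction

universe v₁ v₂ u₁ u₂

/-- A right adjoint of a strong monoidal functor from a cartesian category to a symmetric
monoidal closed one is part of an LNL adjunction. -/
theorem exists_lnlAdjunction_isStrong {𝒞 : Type u₁} [Category.{v₁} 𝒞]
    [CartesianMonoidalCategory 𝒞] {ℳ : Type u₂} [Category.{v₂} ℳ] [MonoidalCategory ℳ]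
    [SymmetricCategory ℳ] (closed : MonoidalClosed ℳ) {F : 𝒞 ⥤ ℳ} [F.Monoidal] {G : ℳ ⥤ 𝒞}
    (adj : F ⊣ G) : ∃ L : LNLAdjunction F G, L.IsStrong := by
  -- Doctrinal adjunction: the lax structure on `G` is the mate of the inverse structure of `F`, and
  -- for it the unit and counit are monoidal.
  let := adj.rightAdjointLaxMonoidal
  exact ⟨
    { cartesian := inferInstance
      closed := closed
      adj := adj
      laxU := inferInstance
      laxR := inferInstance
      unit_isMonoidal := inferInstance
      counit_isMonoidal := inferInstance },
    (inferInstance : IsIso (Functor.LaxMonoidal.ε F)),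
    fun X Y => (inferInstance : IsIso (Functor.LaxMonoidal.μ F X Y))⟩

end ComodLNL

theorem mainTheorem2 (k : Type u) [Field k] (C : Type u) [AddCommGroup C] [Module k C]
    [Coalgebra k C] [Coalgebra.IsCocomm k C] (hC : ComodLNL.IsCosemisimple k C) :
    ∃ (R : ComodLNL.Comod k C ⥤ ComodLNL.CoalgOver k C)
      (L : ComodLNL.LNLAdjunction (ComodLNL.U k C) R), L.IsStrong := by
  exact ⟨_, ComodLNL.exists_lnlAdjunction_isStrong (ComodLNL.Comod.monoidalClosed hC)
    (adjunctionOfCostructuredArrowTerminals (ComodLNL.U k C))⟩
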